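/- **Setting.** Let $\mathfrak g$ be a simple Lie algebra over $\mathbb C$ of rank $N$, $A=(a_{ij})_{i,j\in I}$, $I=\{0,\dots,N\}$, the generalized Cartan matrix of the corresponding untwisted affine Lie algebra, $d_i$ the coprime positive integers for which $b_{ij}=d_ia_{ij}$ is symmetric, $a_i^\vee$ the co-labels, and $m_{ij}=\delta_{i,j+1}-\delta_{i+1,j}$ (indices modulo $N+1$) if $\mathfrak g=A_N$, $m_{ij}=0$ otherwise. Fix $h_i\in\mathfrak h$, $\alpha_i\in\mathfrak h^*$ a realization of $A$ ($\langle\alpha_j,h_i\rangle=a_{ij}$), a space $H_P$ spanned by $P_0,\dots,P_N$ and $Q_i\in H_P^*$ with $\langle Q_i,P_j\rangle=a_{ij}$. Let $\mathbb F$ be the field of meromorphic functions $g(h,P)$ on $\mathfrak h^*\oplus H_P^*$; $g(h+\langle\beta,h\rangle,P+\langle\gamma,P\rangle)$ denotes the translate of $g$ by $(\beta,\gamma)$. Let $q,p,\kappa\in\mathbb C^\times$, $q$ not a root of unity, with a fixed value of $\log q$; $q_i=q^{d_i}$, $[n]_i=\frac{q_i^n-q_i^{-n}}{q_i-q_i^{-1}}$,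 $[n]=\frac{q^n-q^{-n}}{q-q^{-1}}$, $\left[{a\atop r}\right]_i$ the Gaussian binomials. Let $k\in\mathbb C^\times$, $l\in\mathbb C$, $p^*=pq^{-2k}$, and assume $|p|,|p^*|,|q^{2k}|<1$. Put $\delta(x)=\sum_{n\in\mathbb Z}x^n$, $(x;s)_\infty=\prod_{n\ge0}(1-xs^n)$, and $g_{ij}(x;s)=\exp\bigl(-\sum_{n>0}\frac1n\frac{q^{b_{ij}n}-q^{-b_{ij}n}}{1-s^n}(sx)^n\bigr)$. All identities below are identities of formal series, every factor being expanded in nonnegative powers of its argument $w/z$, $z/w$, etc. **Modules.** Let $\mathcal V$ be a level-$(k,l)$ module of the elliptic quantum toroidal algebra $U_{q,\kappa,p}(\mathfrak g_{tor})$ in $\mathfrak C_{k,l}$, that is: an $\mathbb F$-vector space with $\mathbb C$-linear operators $x^\pm_{i,n}$ $(n\in\mathbb Z)$, $\alpha^\vee_{i,n}$ $(n\neq0)$ and invertible $K_i^\pm$, $q^d$, with currents $x_i^\pm(z)=\sum_n x^\pm_{i,n}z^{-n}$ and $$\phi_i^+(q^{k/2}z)=K_i^+e^{-(q_i-q_i^{-1})\sum_{n>0}\frac{p^n\alpha^\vee_{i,-n}}{1-p^n}z^n}e^{(q_i-q_i^{-1})\sum_{n>0}\frac{\alpha^\vee_{i,n}}{1-p^n}z^{-n}},\quad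 \phi_i^-(q^{-k/2}z)=K_i^-e^{-(q_i-q_i^{-1})\sum_{n>0}\frac{\alpha^\vee_{i,-n}}{1-p^n}z^n}e^{(q_i-q_i^{-1})\sum_{n>0}\frac{p^n\alpha^\vee_{i,n}}{1-p^n}z^{-n}},$$ satisfying the following relations: - $\prod_i(K_i^\pm)^{a_i^\vee}$ is central, and $\prod_i(K_i^+)^{a_i^\vee}=q^{-l}$; - $g(h,P)x_j^+(z)=x_j^+(z)g(h+\langle\alpha_j,h\rangle,P-\langle Q_j,P\rangle)$, $g(h,P)x_j^-(z)=x_j^-(z)g(h-\langle\alpha_j,h\rangle,P)$, $g(h,P)K_j^\pm=K_j^\pm g(h,P-\langle Q_j,P\rangle)$, and $g(h,P)$ commutes with $\alpha^\vee_{i,n}$, $q^d$ (for all $g\in\mathbb F$); - $q^d\alpha^\vee_{j,n}q^{-d}=q^n\alpha^\vee_{j,n}$, $q^dx^\pm_{j,n}q^{-d}=q^nx^\pm_{j,n}$; the $K_i^\pm$ commute with each other and with the $\alpha^\vee_{j,n}$; $K_i^\pm x_j^+(z)(K_i^\pm)^{-1}=q^{\pm a_{ij}}x_j^+(z)$, $K_i^\pm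 x_j^-(z)(K_i^\pm)^{-1}=q^{\mp a_{ij}}x_j^-(z)$; - $[\alpha^\vee_{i,n},\alpha^\vee_{j,s}]=\delta_{n+s,0}\frac{[a_{ij}n]_i}{n}\frac{q^{nk}-q^{-nk}}{q_j-q_j^{-1}}\frac{1-p^n}{1-p^{*n}}\kappa^{-nm_{ij}}q^{-nk}$, $[\alpha^\vee_{i,n},x_j^+(z)]=\frac{[a_{ij}n]_i}{n}\frac{1-p^n}{1-p^{*n}}q^{-nk}\kappa^{-nm_{ij}}z^nx_j^+(z)$, $[\alpha^\vee_{i,n},x_j^-(z)]=-\frac{[a_{ij}n]_i}{n}\kappa^{-nm_{ij}}z^nx_j^-(z)$; - $(\kappa^{m_{ij}}z-q^{b_{ij}}w)g_{ij}(\kappa^{-m_{ij}}\tfrac wz;p^*)x_i^+(z)x_j^+(w)=(\kappa^{m_{ij}}q^{b_{ij}}z-w)g_{ij}(\kappa^{m_{ij}}\tfrac zw;p^*)x_j^+(w)x_i^+(z)$, and $(\kappa^{m_{ij}}z-q^{-b_{ij}}w)g_{ij}(\kappa^{-m_{ij}}\tfrac wz;p)^{-1}x_i^-(z)x_j^-(w)=(\kappa^{m_{ij}}q^{-b_{ij}}z-w)g_{ij}(\kappa^{m_{ij}}\tfrac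 zw;p)^{-1}x_j^-(w)x_i^-(z)$; - $[x_i^+(z),x_j^-(w)]=\frac{\delta_{ij}}{q_i-q_i^{-1}}\bigl(\delta(q^k\tfrac wz)\phi_i^+(q^{k/2}w)-\delta(q^{-k}\tfrac wz)\phi_i^-(q^{k/2}z)\bigr)$; - for $i\ne j$, $a=1-a_{ij}$, the Serre relations $S_{ij}(x^+;g_{ii}(\cdot\,;p^*),g_{ij}(\cdot\,;p^*))$ and $S_{ij}(x^-;g_{ii}(\cdot\,;p)^{-1},g_{ij}(\cdot\,;p)^{-1})$, where $S_{ij}(A;F,G)$ denotes the identity $$\sum_{\sigma\in\mathfrak S_a}\prod_{1\le u<v\le a}F\Bigl(\tfrac{z_{\sigma(v)}}{z_{\sigma(u)}}\Bigr)\sum_{r=0}^a(-1)^r\left[{a\atop r}\right]_i\prod_{s\le r}G\Bigl(\kappa^{-m_{ij}}\tfrac{w}{z_{\sigma(s)}}\Bigr)\prod_{s>r}G\Bigl(\kappa^{m_{ij}}\tfrac{z_{\sigma(s)}}{w}\Bigr)A_i(z_{\sigma(1)})\cdots A_i(z_{\sigma(r)})A_j(w)A_i(z_{\sigma(r+1)})\cdots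 A_i(z_{\sigma(a)})=0;$$ - $\mathcal V$ is the sum of the subspaces $\mathcal V_\omega=\{v: q^dv=q^\omega v\}$, $\omega\in\mathbb C$, and for every $\omega$ one has $\mathcal V_{\omega+n}=0$ for all sufficiently large $n\in\mathbb N$. Put $\alpha_{i,n}=[d_i]\alpha^\vee_{i,n}$, $\alpha'_{i,n}=\frac{1-p^{*n}}{1-p^n}q^{kn}\alpha_{i,n}$, $$E^\pm(\alpha_i,z)=\exp\Bigl\{\pm\sum_{n\ge1}\tfrac{q-q^{-1}}{q^{kn}-q^{-kn}}\alpha_{i,\pm n}z^{\mp n}\Bigr\},\qquad E^\pm(\alpha'_i,z)=\exp\Bigl\{\mp\sum_{n\ge1}\tfrac{q-q^{-1}}{q^{kn}-q^{-kn}}\alpha'_{i,\pm n}z^{\mp n}\Bigr\},$$ $$\mathcal Z_i^+(z)=E^-(\alpha_i,z)x_i^+(z)E^+(\alpha_i,z),\qquad \mathcal Z_i^-(z)=E^-(\alpha'_i,z)x_i^-(z)E^+(\alpha'_i,z).$$ **Theorem.** The coefficients of $\mathcal Z_i^\pm(z)$ are well-defined operators on $\mathcal V$, and for all $i,j\in I$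 and $g\in\mathbb F$: 1. $[\alpha_{i,n},\mathcal Z_j^\pm(z)]=0$ for $n\ne0$; both products $\prod_i(K_i^+)^{a_i^\vee}$ and $\prod_i(K_i^-)^{a_i^\vee}$ commute with $\mathcal Z_j^+(z)$ and $\mathcal Z_j^-(z)$. 2. $g(h,P)\mathcal Z_i^+(z)=\mathcal Z_i^+(z)g(h+\langle\alpha_i,h\rangle,P-\langle Q_i,P\rangle)$, $g(h,P)\mathcal Z_i^-(z)=\mathcal Z_i^-(z)g(h-\langle\alpha_i,h\rangle,P)$, $g(h,P)K_i^\pm=K_i^\pm g(h,P-\langle Q_i,P\rangle)$. 3. $K_i^\pm\mathcal Z_j^+(z)(K_i^\pm)^{-1}=q^{\pm a_{ij}}\mathcal Z_j^+(z)$ and $K_i^\pm\mathcal Z_j^-(z)(K_i^\pm)^{-1}=q^{\mp a_{ij}}\mathcal Z_j^-(z)$. 4. For $\mathcal Z=\mathcal Z^+$ and for $\mathcal Z=\mathcal Z^-$, $$z\frac{(q^{-b_{ij}}\kappa^{-m_{ij}}\frac wz;q^{2k})_\infty}{(q^{2k}q^{b_{ij}}\kappa^{-m_{ij}}\frac wz;q^{2k})_\infty}\mathcal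 Z_i(z)\mathcal Z_j(w)=-w\kappa^{-m_{ij}}\frac{(q^{-b_{ij}}\kappa^{m_{ij}}\frac zw;q^{2k})_\infty}{(q^{2k}q^{b_{ij}}\kappa^{m_{ij}}\frac zw;q^{2k})_\infty}\mathcal Z_j(w)\mathcal Z_i(z).$$ 5. $$\frac{(q^{b_{ij}}q^k\kappa^{-m_{ij}}\frac wz;q^{2k})_\infty}{(q^{-b_{ij}}q^k\kappa^{-m_{ij}}\frac wz;q^{2k})_\infty}\mathcal Z_i^+(z)\mathcal Z_j^-(w)-\frac{(q^{b_{ij}}q^k\kappa^{m_{ij}}\frac zw;q^{2k})_\infty}{(q^{-b_{ij}}q^k\kappa^{m_{ij}}\frac zw;q^{2k})_\infty}\mathcal Z_j^-(w)\mathcal Z_i^+(z)=\frac{\delta_{ij}}{q_i-q_i^{-1}}\Bigl\{\delta(q^k\tfrac wz)K_i^+-\delta(q^{-k}\tfrac wz)K_i^-\Bigr\}.$$ 6. For $i\neq j$ and $a=1-a_{ij}$ the Serre relations $S_{ij}(\mathcal Z^+;F_{ii},F_{ij})$ and $S_{ij}(\mathcal Z^-;F'_{ii},F'_{ij})$ hold,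 where $F_{ij}(x)=\frac{(q^{-b_{ij}}x;q^{2k})_\infty}{(q^{b_{ij}}x;q^{2k})_\infty}$ and $F'_{ij}(x)=\frac{(q^{2k}q^{-b_{ij}}x;q^{2k})_\infty}{(q^{2k}q^{b_{ij}}x;q^{2k})_\infty}$. -/

import Mathlib

open scoped PowerSeries Nat

noncomputable section

namespace EllTor

/-! ### Untwisted affine Cartan data -/

/-- The simple Lie algebras over `ℂ`, listed by type and rank `N`. -/
inductive SimpleType : Type
  | A (N : ℕ) (hN : 1 ≤ N)
  | B (N : ℕ) (hN : 3 ≤ N)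
  | C (N : ℕ) (hN : 2 ≤ N)
  | D (N : ℕ) (hN : 4 ≤ N)
  | E6
  | E7
  | E8
  | F4
  | G2

namespace SimpleType

/-- The rank `N` of the simple Lie algebra. -/
def rank : SimpleType → ℕ
  | A N _ => N
  | B N _ => N
  | C N _ => N
  | D N _ => N
  | E6 => 6
  | E7 => 7
  | E8 => 8
  | F4 => 4
  | G2 => 2

/-- The index set `I = {0, 1, …, N}`: the nodes of the affine Dynkin diagram (finite nodes in the
Bourbaki numbering, `0` the affine node). -/
abbrev Idx (t : SimpleType) : Type := Fin (t.rank + 1)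

/-- The symmetrizing integers `d_i` (proportional to the squared root lengths). -/
def dNat : SimpleType → ℕ → ℕ
  | A _ _, _ => 1
  | B N _, i => if i = N then 1 else 2
  | C N _, i => if i = 0 ∨ i = N then 2 else 1
  | D _ _, _ => 1
  | E6, _ => 1
  | E7, _ => 1
  | E8, _ => 1
  | F4, i => if i ≤ 2 then 2 else 1
  | G2, i => if i = 1 then 1 else 3

/-- The edges `{i, j}`, `i < j`, of the affine Dynkin diagram. -/
def edge : SimpleType → ℕ → ℕ → Prop
  | A N _, i, j => j = i + 1 ∨ (i = 0 ∧ j = N)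
  | B _ _, i, j => (i = 0 ∧ j = 2) ∨ (1 ≤ i ∧ j = i + 1)
  | C _ _, i, j => j = i + 1
  | D N _, i, j => (i = 0 ∧ j = 2) ∨ (1 ≤ i ∧ j = i + 1 ∧ j < N) ∨ (i + 2 = N ∧ j = N)
  | E6, i, j => (i, j) ∈ [(0, 2), (1, 3), (3, 4), (2, 4), (4, 5), (5, 6)]
  | E7, i, j => (i, j) ∈ [(0, 1), (1, 3), (3, 4), (2, 4), (4, 5), (5, 6), (6, 7)]
  | E8, i, j => (i, j) ∈ [(0, 8), (1, 3), (3, 4), (2, 4), (4, 5), (5, 6), (6, 7), (7, 8)]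
  | F4, i, j => j = i + 1
  | G2, i, j => (i = 0 ∧ j = 2) ∨ (i = 1 ∧ j = 2)

instance (t : SimpleType) (i j : ℕ) : Decidable (t.edge i j) := by
  cases t <;> unfold edge <;> infer_instance

/-- `2` for the diagram `A_1^{(1)}`, where `a_{01} = a_{10} = -2`; `1` for all other diagrams. -/
def bond : SimpleType → ℕ
  | A N _ => if N = 1 then 2 else 1
  | _ => 1

/-- `d_i`. -/
def d (t : SimpleType) (i : t.Idx) : ℕ := t.dNat i

/-- The generalized Cartan matrix `a_{ij} = ⟨α_j, h_i⟩` of the untwisted affine Lie algebra: for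
adjacent nodes `i, j` one has `a_{ij} = - max(d_i, d_j) / d_i`
(and `a_{01} = a_{10} = -2` for `A_1^{(1)}`). -/
def a (t : SimpleType) : Matrix t.Idx t.Idx ℤ := fun i j =>
  if i = j then 2
  else if t.edge (min (i : ℕ) j) (max (i : ℕ) j) then
    -((t.bond * (max (t.d i) (t.d j) / t.d i) : ℕ) : ℤ)
  else 0

/-- `b_{ij} = d_i a_{ij}`. -/
def b (t : SimpleType) : Matrix t.Idx t.Idx ℤ := fun i j => (t.d i : ℤ) * t.a i j

/-- The co-labels `a_i^∨` of the affine Dynkin diagram. -/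
def colabelNat : SimpleType → ℕ → ℕ
  | A _ _, _ => 1
  | B N _, i => if i = 0 ∨ i = 1 ∨ i = N then 1 else 2
  | C _ _, _ => 1
  | D N _, i => if i = 0 ∨ i = 1 ∨ i + 1 = N ∨ i = N then 1 else 2
  | E6, i => [1, 1, 2, 2, 3, 2, 1].getD i 0
  | E7, i => [1, 2, 2, 3, 4, 3, 2, 1].getD i 0
  | E8, i => [1, 2, 3, 4, 6, 5, 4, 3, 2].getD i 0
  | F4, i => [1, 2, 3, 2, 1].getD i 0
  | G2, i => [1, 1, 2].getD i 0

/-- `a_i^∨`. -/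
def colabel (t : SimpleType) (i : t.Idx) : ℕ := t.colabelNat i

/-- The matrix `m_{ij}`: `δ_{i,j+1} - δ_{i+1,j}` for `𝔤 = A_N`, with indices read cyclically
(modulo `N + 1`; this is the addition of `Fin (N + 1)`), and `0` otherwise. -/
def m : (t : SimpleType) → Matrix t.Idx t.Idx ℤ
  | A N _ => fun i j : Fin (N + 1) => (if i = j + 1 then 1 else 0) - (if i + 1 = j then 1 else 0)
  | _ => 0

end SimpleType

/-! ### The dynamical parameters -/

/-- A realization `(𝔥, Π, Π^∨)` of the affine Cartan matrix, described on `𝔥^*`, together with the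
space `H_P^*`: vectors `α_j ∈ 𝔥^*`, `Q_j ∈ H_P^*` and functionals `h_i` on `𝔥^*`, `P_i` on
`H_P^*`, with `⟨α_j, h_i⟩ = a_{ij}` and `⟨Q_i, P_j⟩ = a_{ij}`, such that the `P_j` span `H_P`. -/
structure Realization (t : SimpleType) (hS pS : Type*)
    [AddCommGroup hS] [Module ℂ hS] [AddCommGroup pS] [Module ℂ pS] where
  α : t.Idx → hS
  h : t.Idx → Module.Dual ℂ hS
  Q : t.Idx → pS
  P : t.Idx → Module.Dual ℂ pS
  finrank_eq : Module.finrank ℂ hS = t.rank + 2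
  α_indep : LinearIndependent ℂ α
  h_indep : LinearIndependent ℂ h
  h_α : ∀ i j, h i (α j) = t.a i j
  P_Q : ∀ i j, P j (Q i) = t.a i j
  P_span : Submodule.span ℂ (Set.range P) = ⊤

/-- The algebra of entire functions on a complex normed space. -/
def Entire (W : Type*) [NormedAddCommGroup W] [NormedSpace ℂ W] : Subalgebra ℂ (W → ℂ) where
  carrier := {f | AnalyticOnNhd ℂ f Set.univ}
  mul_mem' hf hg := hf.mul hg
  add_mem' hf hg := hf.add hg
  algebraMap_mem' _ := analyticOnNhd_const

instance (W : Type*) [NormedAddCommGroup W] [NormedSpace ℂ W] : IsDomain (Entire W) := by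
  have : NoZeroDivisors (Entire W) := by
    refine ⟨fun {f g} hfg => ?_⟩
    by_contra hcon
    simp only [not_or] at hcon
    obtain ⟨hf, hg⟩ := hcon
    have hfun : ∀ x, f.1 x * g.1 x = 0 := fun x => congrFun (congrArg Subtype.val hfg) x
    obtain ⟨x, hx⟩ : ∃ x, f.1 x ≠ 0 := by
      by_contra hne
      simp only [not_exists, not_not] at hne
      exact hf (Subtype.ext (funext hne))
    have hev : g.1 =ᶠ[nhds x] 0 := by
      have hc : ContinuousAt f.1 x := (f.2 x (Set.mem_univ x)).continuousAt
      filter_upwards [hc.eventually_ne hx] with y hy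
      exact (mul_eq_zero.mp (hfun y)).resolve_left hy
    have := AnalyticOnNhd.eqOn_zero_of_preconnected_of_eventuallyEq_zero g.2
      isPreconnected_univ (Set.mem_univ x) hev
    exact hg (Subtype.ext (funext fun y => this (Set.mem_univ y)))
  have : Nontrivial (Entire W) :=
    ⟨⟨0, 1, fun hh => by simpa using congrFun (congrArg Subtype.val hh) (0 : W)⟩⟩
  exact NoZeroDivisors.to_isDomain _

/-- The field of meromorphic functions on a finite-dimensional complex vector space: every such
function is a quotient of two entire functions. -/
abbrev Mero (W : Type*) [NormedAddCommGroup W] [NormedSpace ℂ W] : Type _ :=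
  FractionRing (Entire W)

/-- The translation `f(μ) ↦ f(μ + β)` of entire functions. -/
def entireShift {W : Type*} [NormedAddCommGroup W] [NormedSpace ℂ W] (β : W) :
    Entire W ≃+* Entire W where
  toFun f := ⟨fun μ => f.1 (μ + β), fun μ _ =>
    (f.2 (μ + β) (Set.mem_univ _)).comp_of_eq (analyticAt_id.add analyticAt_const) rfl⟩
  invFun f := ⟨fun μ => f.1 (μ - β), fun μ _ =>
    (f.2 (μ - β) (Set.mem_univ _)).comp_of_eq (analyticAt_id.sub analyticAt_const) rfl⟩
  left_inv f := Subtype.ext (funext fun μ => by simp)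
  right_inv f := Subtype.ext (funext fun μ => by simp)
  map_mul' _ _ := rfl
  map_add' _ _ := rfl

/-- The translation `g(μ) ↦ g(μ + β)` of meromorphic functions. For `W = H^*` and
`β = (β₁, β₂) ∈ 𝔥^* ⊕ H_P^*` this is `g(h, P) ↦ g(h + ⟨β₁, h⟩, P + ⟨β₂, P⟩)`. -/
def shift {W : Type*} [NormedAddCommGroup W] [NormedSpace ℂ W] (β : W) : Mero W ≃+* Mero W :=
  IsFractionRing.ringEquivOfRingEquiv (entireShift β)

/-! ### Numerical parameters -/

/-- The complex parameters: a value `ħ` of `log q`, and `κ`, `p`, and the level `(k, l)`. -/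
structure Params where
  (ħ κ p k l : ℂ)

namespace Params

variable (c : Params)

/-- `q^x = exp(ħ x)`. -/
def qpow (x : ℂ) : ℂ := Complex.exp (c.ħ * x)

/-- `q`. -/
def q : ℂ := c.qpow 1

/-- `p^* = p q^{-2k}`. -/
def pst : ℂ := c.p * c.qpow (-2 * c.k)

end Params

/-- `[n]` with respect to the base `x`: `(x^n - x^{-n}) / (x - x^{-1})`. -/
def qInt (x : ℂ) (n : ℤ) : ℂ := (x ^ n - x ^ (-n)) / (x - x⁻¹)

/-- `[n]! = [n] ⋯ [1]` with respect to the base `x`. -/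
def qFact (x : ℂ) (n : ℕ) : ℂ := ∏ s ∈ Finset.Icc 1 n, qInt x s

/-- The Gaussian binomial coefficient with respect to the base `x`. -/
def qBinom (x : ℂ) (n r : ℕ) : ℂ := qFact x n / (qFact x (n - r) * qFact x r)

/-! ### Formal series -/

/-- `exp(∑_{n ≥ 1} f_n X^n)` as a formal power series over a possibly noncommutative algebra. -/
def expSeries {R : Type*} [Ring R] [Algebra ℂ R] (f : ℕ → R) : R⟦X⟧ :=
  PowerSeries.mk fun n => ∑ j ∈ Finset.range (n + 1),
    ((j ! : ℂ)⁻¹) • PowerSeries.coeff n ((PowerSeries.mk fun s => if s = 0 then 0 else f s) ^ j)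

/-- `(yX; s)_∞ = ∏_{n ≥ 0} (1 - y s^n X)` as a formal power series in `X` (for `|s| < 1`): the
coefficientwise limit of the partial products. -/
def qPoch (s y : ℂ) : ℂ⟦X⟧ :=
  PowerSeries.mk fun n => Filter.limUnder Filter.atTop fun M : ℕ =>
    PowerSeries.coeff n (∏ r ∈ Finset.range M, (1 - PowerSeries.C (y * s ^ r) * PowerSeries.X))

/-- The limits defining `(yX; s)_∞` exist for `|s| < 1`. -/
theorem qPoch_tendsto (s y : ℂ) (hs : ‖s‖ < 1) (n : ℕ) :
    Filter.Tendsto (fun M : ℕ =>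
      PowerSeries.coeff n (∏ r ∈ Finset.range M, (1 - PowerSeries.C (y * s ^ r) * PowerSeries.X)))
      Filter.atTop (nhds (PowerSeries.coeff n (qPoch s y))) := by
  have key : ∃ l, Filter.Tendsto (fun M : ℕ =>
      PowerSeries.coeff n (∏ r ∈ Finset.range M, (1 - PowerSeries.C (y * s ^ r) * PowerSeries.X)))
      Filter.atTop (nhds l) := by
    induction n with
    | zero =>
      refine ⟨1, tendsto_const_nhds.congr fun M => ?_⟩
      simp [map_prod]
    | succ n ih =>
      obtain ⟨l, hl⟩ := ih
      obtain ⟨K, hK⟩ := (Metric.isBounded_range_of_tendsto _ hl).exists_norm_le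
      refine cauchySeq_tendsto_of_complete
        (cauchySeq_of_le_geometric ‖s‖ (‖y‖ * K) hs fun M => ?_)
      have hb := hK _ (Set.mem_range_self M)
      rw [Finset.prod_range_succ, mul_sub, mul_one, mul_left_comm, map_sub, ← mul_assoc,
        PowerSeries.coeff_succ_mul_X, PowerSeries.coeff_C_mul, dist_eq_norm, sub_sub_cancel,
        norm_mul, norm_mul, norm_pow]
      have h0 : 0 ≤ ‖y‖ * ‖s‖ ^ M := by positivity
      nlinarith [mul_le_mul_of_nonneg_left hb h0]
  rw [qPoch, PowerSeries.coeff_mk]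
  exact tendsto_nhds_limUnder key

/-- The power series `(xX; s)_∞ / (yX; s)_∞`. -/
def qRatio (s x y : ℂ) : ℂ⟦X⟧ := qPoch s x * (qPoch s y)⁻¹

/-- The power series `g(X; s) = exp(- ∑_{n>0} (1/n) (q^{bn} - q^{-bn}) / (1 - s^n) (sX)^n)`,
which for `b = b_{ij}` is `g_{ij}(X; s)`. -/
def gSer (c : Params) (b : ℤ) (s : ℂ) : ℂ⟦X⟧ :=
  expSeries fun n => -(1 / (n : ℂ) * ((c.qpow (b * n) - c.qpow (-(b * n))) / (1 - s ^ n)) * s ^ n)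

section Operators

variable {V : Type*} [AddCommGroup V] [Module ℂ V]

/-- A family of operators is locally finite if only finitely many members act nontrivially on any
given vector. -/
def LocFin {T : Type*} (F : T → Module.End ℂ V) : Prop :=
  ∀ v : V, (Function.support fun x => F x v).Finite

open Classical in
/-- The sum of a locally finite family of operators (`0` if the family is not locally finite). -/
def locSum {T : Type*} (F : T → Module.End ℂ V) : Module.End ℂ V :=
  if hF : LocFin F then
    { toFun := fun v => ∑ᶠ x, F x v
      map_add' := fun v w => by
        simp only [map_add]
        exact finsum_add_distrib (hF v) (hF w)
      map_smul' := fun r v => by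
        simp only [map_smul, RingHom.id_apply]
        exact (smul_finsum' r (hF v)).symm }
  else 0

/-- Operator-valued formal distributions in variables `z_x`, `x ∈ X`: the value at `e` is the
coefficient of `∏_x z_x^{-e_x}`. -/
abbrev Dist (X V : Type*) [AddCommGroup V] [Module ℂ V] : Type _ := (X → ℤ) → Module.End ℂ V

/-- The product of currents `A₁(z_{x₁}) A₂(z_{x₂}) ⋯`, in pairwise distinct variables, where a
current `A(z) = ∑_n A_n z^{-n}` is given by its modes. -/
def prodCurrents {X : Type*} (L : List (X × (ℤ → Module.End ℂ V))) : Dist X V :=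
  fun e => (L.map fun y => y.2 (e y.1)).prod

/-- The product `F(z_x / z_y) D`, for a power series `F`. -/
def mulRatio {X : Type*} [DecidableEq X] (F : ℂ⟦X⟧) (x y : X) (D : Dist X V) : Dist X V :=
  fun e => locSum fun n : ℕ =>
    PowerSeries.coeff n F • D (e + Pi.single x (n : ℤ) - Pi.single y (n : ℤ))

/-- The product of `D` with all the factors `F(z_x / z_y)`, `(F, x, y)` in a list. -/
def mulRatios {X : Type*} [DecidableEq X] (L : List (ℂ⟦X⟧ × X × X)) (D : Dist X V) : Dist X V :=
  L.foldr (fun f D => mulRatio f.1 f.2.1 f.2.2 D) D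

/-- The product `z_x D`. -/
def mulVar {X : Type*} [DecidableEq X] (x : X) (D : Dist X V) : Dist X V :=
  fun e => D (e + Pi.single x 1)

/-- `δ(r w/z) A(w)` in the variables `z = z_0`, `w = z_1`, where `δ(x) = ∑_{n ∈ ℤ} x^n` and
`A(w) = ∑_n A_n w^{-n}`. -/
def deltaW (r : ℂ) (A : ℤ → Module.End ℂ V) : Dist (Fin 2) V :=
  fun e => r ^ (e 0) • A (e 0 + e 1)

/-- `δ(r w/z) A(z)` in the variables `z = z_0`, `w = z_1`. -/
def deltaZ (r : ℂ) (A : ℤ → Module.End ℂ V) : Dist (Fin 2) V :=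
  fun e => r ^ (-(e 1)) • A (e 0 + e 1)

/-- The current `A(rz)`. -/
def scaleCurrent (r : ℂ) (A : ℤ → Module.End ℂ V) : ℤ → Module.End ℂ V :=
  fun n => r ^ (-n) • A n

/-- The constant current `A(z) = T`. -/
def constCurrent (T : Module.End ℂ V) : ℤ → Module.End ℂ V :=
  fun n => if n = 0 then T else 0

/-- The relation
`∑_{σ ∈ S_a} ∏_{u<v} F(z_{σ(v)}/z_{σ(u)}) ∑_{r=0}^a (-1)^r [a, r] ∏_{s ≤ r} G(κ^{-m} w/z_{σ(s)})
  ∏_{s>r} G(κ^m z_{σ(s)}/w) A(z_{σ(1)})⋯A(z_{σ(r)}) B(w) A(z_{σ(r+1)})⋯A(z_{σ(a)}) = 0`,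
with Gaussian binomials to the base `x` and `μ = κ^m`. The variable `w` is `none`, and the
variables `z_1, …, z_a` are `some 0, …, some (a - 1)`. -/
def SerreRel (a : ℕ) (x μ : ℂ) (F G : ℂ⟦X⟧) (A B : ℤ → Module.End ℂ V) : Prop :=
  ∀ e : Option (Fin a) → ℤ,
    ∑ σ : Equiv.Perm (Fin a), ∑ r ∈ Finset.range (a + 1), ((-1 : ℂ) ^ r * qBinom x a r) •
      mulRatios
        ((((List.finRange a).product (List.finRange a)).filter fun y => y.1 < y.2).map
            (fun y => (F, some (σ y.2), some (σ y.1))) ++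
          ((List.finRange a).take r).map
            (fun s => (PowerSeries.rescale μ⁻¹ G, none, some (σ s))) ++
          ((List.finRange a).drop r).map
            (fun s => (PowerSeries.rescale μ G, some (σ s), none)))
        (prodCurrents
          (((List.finRange a).take r).map (fun s => (some (σ s), A)) ++ [(none, B)] ++
            ((List.finRange a).drop r).map (fun s => (some (σ s), A)))) e = 0

end Operators

/-! ### Representations of the elliptic quantum toroidal algebra -/

/-- Operators on `V` by which the generators `x^±_{i,n}`, `α^∨_{i,n}` (`n ≠ 0`; the value at
`n = 0` is not used), `K^±_i`, `q^d` act. The central element `q^{c/2}` acts as the scalar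
`q^{k/2}`. -/
structure GenOps (t : SimpleType) (V : Type*) [AddCommGroup V] [Module ℂ V] where
  xp : t.Idx → ℤ → Module.End ℂ V
  xm : t.Idx → ℤ → Module.End ℂ V
  αv : t.Idx → ℤ → Module.End ℂ V
  Kp : t.Idx → (Module.End ℂ V)ˣ
  Km : t.Idx → (Module.End ℂ V)ˣ
  qd : (Module.End ℂ V)ˣ

namespace GenOps

variable {t : SimpleType} {V : Type*} [AddCommGroup V] [Module ℂ V]
variable (c : Params) (R : GenOps t V)

/-- `q_i = q^{d_i}`. -/
def qi (t : SimpleType) (c : Params) (i : t.Idx) : ℂ := c.qpow (t.d i)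

/-- `∏_i (K^+_i)^{a_i^∨}`. -/
def KpProd : (Module.End ℂ V)ˣ := (List.ofFn fun i => R.Kp i ^ t.colabel i).prod

/-- `∏_i (K^-_i)^{a_i^∨}`. -/
def KmProd : (Module.End ℂ V)ˣ := (List.ofFn fun i => R.Km i ^ t.colabel i).prod

/-- The modes of `φ^+_i(q^{c/2} z) = K^+_i exp(-(q_i - q_i^{-1}) ∑_{n>0} p^n α^∨_{i,-n} z^n/(1-p^n))
exp((q_i - q_i^{-1}) ∑_{n>0} α^∨_{i,n} z^{-n}/(1-p^n))`. -/
def phiP (i : t.Idx) (n : ℤ) : Module.End ℂ V :=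
  locSum fun y : ℕ × ℕ => if (y.2 : ℤ) - y.1 = n then
    (R.Kp i : Module.End ℂ V) *
      PowerSeries.coeff y.1 (expSeries fun s : ℕ =>
        (-((qi t c i - (qi t c i)⁻¹) * (c.p ^ s / (1 - c.p ^ s)))) • R.αv i (-(s : ℤ))) *
      PowerSeries.coeff y.2 (expSeries fun s : ℕ =>
        ((qi t c i - (qi t c i)⁻¹) * (1 / (1 - c.p ^ s))) • R.αv i s)
    else 0

/-- The modes of `φ^-_i(q^{-c/2} z) = K^-_i exp(-(q_i - q_i^{-1}) ∑_{n>0} α^∨_{i,-n} z^n/(1-p^n))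
exp((q_i - q_i^{-1}) ∑_{n>0} p^n α^∨_{i,n} z^{-n}/(1-p^n))`. -/
def phiM (i : t.Idx) (n : ℤ) : Module.End ℂ V :=
  locSum fun y : ℕ × ℕ => if (y.2 : ℤ) - y.1 = n then
    (R.Km i : Module.End ℂ V) *
      PowerSeries.coeff y.1 (expSeries fun s : ℕ =>
        (-((qi t c i - (qi t c i)⁻¹) * (1 / (1 - c.p ^ s)))) • R.αv i (-(s : ℤ))) *
      PowerSeries.coeff y.2 (expSeries fun s : ℕ =>
        ((qi t c i - (qi t c i)⁻¹) * (c.p ^ s / (1 - c.p ^ s))) • R.αv i s)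
    else 0

/-- The defining relations of the elliptic quantum toroidal algebra, for operators on a vector
space `V` over the field `𝔽` of meromorphic functions on `H^* = 𝔥^* ⊕ H_P^*`, with `q^{c/2}`
acting as `q^{k/2}`. Relations between currents are identities of formal distributions. -/
structure IsRep {hS pS : Type*} [NormedAddCommGroup hS] [NormedSpace ℂ hS]
    [NormedAddCommGroup pS] [NormedSpace ℂ pS] (ρ : Realization t hS pS)
    [Module (Mero (hS × pS)) V] : Prop where
  Kp_central_x : ∀ j n, Commute (R.KpProd : Module.End ℂ V) (R.xp j n) ∧
    Commute (R.KpProd : Module.End ℂ V) (R.xm j n)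
  Km_central_x : ∀ j n, Commute (R.KmProd : Module.End ℂ V) (R.xp j n) ∧
    Commute (R.KmProd : Module.End ℂ V) (R.xm j n)
  K_central_qd : Commute R.KpProd R.qd ∧ Commute R.KmProd R.qd
  g_xp : ∀ (g : Mero (hS × pS)) j n v,
    g • R.xp j n v = R.xp j n (shift (ρ.α j, -ρ.Q j) g • v)
  g_xm : ∀ (g : Mero (hS × pS)) j n v, g • R.xm j n v = R.xm j n (shift (-ρ.α j, 0) g • v)
  g_α : ∀ (g : Mero (hS × pS)) i n v, n ≠ 0 → g • R.αv i n v = R.αv i n (g • v)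
  g_qd : ∀ (g : Mero (hS × pS)) v,
    g • (R.qd : Module.End ℂ V) v = (R.qd : Module.End ℂ V) (g • v)
  g_Kp : ∀ (g : Mero (hS × pS)) j v,
    g • (R.Kp j : Module.End ℂ V) v = (R.Kp j : Module.End ℂ V) (shift (0, -ρ.Q j) g • v)
  g_Km : ∀ (g : Mero (hS × pS)) j v,
    g • (R.Km j : Module.End ℂ V) v = (R.Km j : Module.End ℂ V) (shift (0, -ρ.Q j) g • v)
  qd_α : ∀ j n, n ≠ 0 →
    (R.qd : Module.End ℂ V) * R.αv j n * (R.qd⁻¹ : (Module.End ℂ V)ˣ) = c.qpow n • R.αv j n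
  qd_xp : ∀ j n,
    (R.qd : Module.End ℂ V) * R.xp j n * (R.qd⁻¹ : (Module.End ℂ V)ˣ) = c.qpow n • R.xp j n
  qd_xm : ∀ j n,
    (R.qd : Module.End ℂ V) * R.xm j n * (R.qd⁻¹ : (Module.End ℂ V)ˣ) = c.qpow n • R.xm j n
  K_K : ∀ i j, Commute (R.Kp i) (R.Kp j) ∧ Commute (R.Kp i) (R.Km j) ∧ Commute (R.Km i) (R.Km j)
  K_α : ∀ i j n, n ≠ 0 → Commute (R.Kp i : Module.End ℂ V) (R.αv j n) ∧
    Commute (R.Km i : Module.End ℂ V) (R.αv j n)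
  Kp_xp : ∀ i j n, (R.Kp i : Module.End ℂ V) * R.xp j n * ((R.Kp i)⁻¹ : (Module.End ℂ V)ˣ) =
    c.qpow (t.a i j) • R.xp j n
  Km_xp : ∀ i j n, (R.Km i : Module.End ℂ V) * R.xp j n * ((R.Km i)⁻¹ : (Module.End ℂ V)ˣ) =
    c.qpow (-(t.a i j)) • R.xp j n
  Kp_xm : ∀ i j n, (R.Kp i : Module.End ℂ V) * R.xm j n * ((R.Kp i)⁻¹ : (Module.End ℂ V)ˣ) =
    c.qpow (-(t.a i j)) • R.xm j n
  Km_xm : ∀ i j n, (R.Km i : Module.End ℂ V) * R.xm j n * ((R.Km i)⁻¹ : (Module.End ℂ V)ˣ) =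
    c.qpow (t.a i j) • R.xm j n
  α_α : ∀ i j (n s : ℤ), n ≠ 0 → s ≠ 0 → R.αv i n * R.αv j s - R.αv j s * R.αv i n =
    (if n + s = 0 then qInt (qi t c i) (t.a i j * n) / n *
      ((c.qpow (n * c.k) - c.qpow (-(n * c.k))) / (qi t c j - (qi t c j)⁻¹)) *
      ((1 - c.p ^ n) / (1 - c.pst ^ n)) * c.κ ^ (-(n * t.m i j)) * c.qpow (-(n * c.k)) else 0) •
      (1 : Module.End ℂ V)
  α_xp : ∀ i j (n s : ℤ), n ≠ 0 → R.αv i n * R.xp j s - R.xp j s * R.αv i n =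
    (qInt (qi t c i) (t.a i j * n) / n * ((1 - c.p ^ n) / (1 - c.pst ^ n)) *
      c.qpow (-(n * c.k)) * c.κ ^ (-(n * t.m i j))) • R.xp j (s + n)
  α_xm : ∀ i j (n s : ℤ), n ≠ 0 → R.αv i n * R.xm j s - R.xm j s * R.αv i n =
    (-(qInt (qi t c i) (t.a i j * n) / n * c.κ ^ (-(n * t.m i j)))) • R.xm j (s + n)
  xp_xp : ∀ i j,
    let D₁ := mulRatio (PowerSeries.rescale (c.κ ^ (-t.m i j)) (gSer c (t.b i j) c.pst)) 1 0
      (prodCurrents [((0 : Fin 2), R.xp i), (1, R.xp j)])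
    let D₂ := mulRatio (PowerSeries.rescale (c.κ ^ t.m i j) (gSer c (t.b i j) c.pst)) 0 1
      (prodCurrents [((1 : Fin 2), R.xp j), (0, R.xp i)])
    c.κ ^ t.m i j • mulVar 0 D₁ - c.qpow (t.b i j) • mulVar 1 D₁ =
      (c.κ ^ t.m i j * c.qpow (t.b i j)) • mulVar 0 D₂ - mulVar 1 D₂
  xm_xm : ∀ i j,
    let D₁ := mulRatio (PowerSeries.rescale (c.κ ^ (-t.m i j)) (gSer c (t.b i j) c.p)⁻¹) 1 0
      (prodCurrents [((0 : Fin 2), R.xm i), (1, R.xm j)])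
    let D₂ := mulRatio (PowerSeries.rescale (c.κ ^ t.m i j) (gSer c (t.b i j) c.p)⁻¹) 0 1
      (prodCurrents [((1 : Fin 2), R.xm j), (0, R.xm i)])
    c.κ ^ t.m i j • mulVar 0 D₁ - c.qpow (-(t.b i j)) • mulVar 1 D₁ =
      (c.κ ^ t.m i j * c.qpow (-(t.b i j))) • mulVar 0 D₂ - mulVar 1 D₂
  xp_xm : ∀ i j,
    prodCurrents [((0 : Fin 2), R.xp i), (1, R.xm j)] -
        prodCurrents [((1 : Fin 2), R.xm j), (0, R.xp i)] =
      if i = j then (qi t c i - (qi t c i)⁻¹)⁻¹ •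
        (deltaW (c.qpow c.k) (R.phiP c i) -
          deltaZ (c.qpow (-c.k)) (scaleCurrent (c.qpow c.k) (R.phiM c i)))
      else 0
  serre_p : ∀ i j, i ≠ j → SerreRel (1 - t.a i j).toNat (qi t c i) (c.κ ^ t.m i j)
    (gSer c (t.b i i) c.pst) (gSer c (t.b i j) c.pst) (R.xp i) (R.xp j)
  serre_m : ∀ i j, i ≠ j → SerreRel (1 - t.a i j).toNat (qi t c i) (c.κ ^ t.m i j)
    (gSer c (t.b i i) c.p)⁻¹ (gSer c (t.b i j) c.p)⁻¹ (R.xm i) (R.xm j)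

/-- The conditions singling out the category `ℭ_{k,l}`: the level is `(k, l)`, the space is the
sum of the eigenspaces `V_ω = {v | q^d v = q^ω v}`, and for every `ω` one has `V_{ω+n} = 0` for
all large `n`. -/
structure IsInC : Prop where
  level : (R.KpProd : Module.End ℂ V) = c.qpow (-c.l) • (1 : Module.End ℂ V)
  graded : ⨆ ω : ℂ, Module.End.eigenspace (R.qd : Module.End ℂ V) (c.qpow ω) = ⊤
  truncated : ∀ ω : ℂ, ∃ n₀ : ℕ, ∀ n : ℕ, n₀ < n →
    Module.End.eigenspace (R.qd : Module.End ℂ V) (c.qpow (ω + n)) = ⊥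

/-! ### The `Z`-operators -/

/-- `α_{i,n} = [d_i] α^∨_{i,n}`. -/
def al (i : t.Idx) (n : ℤ) : Module.End ℂ V := qInt c.q (t.d i) • R.αv i n

/-- `α'_{i,n} = (1 - p^{*n})/(1 - p^n) q^{kn} α_{i,n}`. -/
def alPrime (i : t.Idx) (n : ℤ) : Module.End ℂ V :=
  ((1 - c.pst ^ n) / (1 - c.p ^ n) * c.qpow (c.k * n)) • R.al c i n

/-- `(q - q^{-1}) / (q^{kn} - q^{-kn})`. -/
def eCoef (c : Params) (n : ℕ) : ℂ :=
  (c.q - c.q⁻¹) / (c.qpow (c.k * n) - c.qpow (-(c.k * n)))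

/-- `E^+(α_i, z)`, as a power series in `z^{-1}`. -/
def Ep (i : t.Idx) : (Module.End ℂ V)⟦X⟧ :=
  expSeries fun n : ℕ => eCoef c n • R.al c i n

/-- `E^-(α_i, z)`, as a power series in `z`. -/
def Em (i : t.Idx) : (Module.End ℂ V)⟦X⟧ :=
  expSeries fun n : ℕ => (-eCoef c n) • R.al c i (-(n : ℤ))

/-- `E^+(α'_i, z)`, as a power series in `z^{-1}`. -/
def EpPrime (i : t.Idx) : (Module.End ℂ V)⟦X⟧ :=
  expSeries fun n : ℕ => (-eCoef c n) • R.alPrime c i n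

/-- `E^-(α'_i, z)`, as a power series in `z`. -/
def EmPrime (i : t.Idx) : (Module.End ℂ V)⟦X⟧ :=
  expSeries fun n : ℕ => eCoef c n • R.alPrime c i (-(n : ℤ))

/-- The operators summing to the coefficient of `z^{-n}` in `E^-(α_i, z) x^+_i(z) E^+(α_i, z)`. -/
def ZpTerm (i : t.Idx) (n : ℤ) (y : ℕ × ℕ) : Module.End ℂ V :=
  PowerSeries.coeff y.1 (R.Em c i) * R.xp i (n + y.1 - y.2) * PowerSeries.coeff y.2 (R.Ep c i)

/-- The operators summing to the coefficient of `z^{-n}` in `E^-(α'_i, z) x^-_i(z) E^+(α'_i, z)`. -/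
def ZmTerm (i : t.Idx) (n : ℤ) (y : ℕ × ℕ) : Module.End ℂ V :=
  PowerSeries.coeff y.1 (R.EmPrime c i) * R.xm i (n + y.1 - y.2) *
    PowerSeries.coeff y.2 (R.EpPrime c i)

/-- The modes of `𝒵^+_i(z) = E^-(α_i, z) x^+_i(z) E^+(α_i, z)`. -/
def Zp (i : t.Idx) (n : ℤ) : Module.End ℂ V := locSum (R.ZpTerm c i n)

/-- The modes of `𝒵^-_i(z) = E^-(α'_i, z) x^-_i(z) E^+(α'_i, z)`. -/
def Zm (i : t.Idx) (n : ℤ) : Module.End ℂ V := locSum (R.ZmTerm c i n)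

end GenOps

end EllTor

end

/-! The theorem is a Heisenberg computation. The vertex operators `E^±` are chosen so that the
commutator of each `α_{i,n}` with them is opposite to its commutator with the current they surround.
Hence the dressed currents commute with all `α_{i,n}` (`HeisData.IsHeis.commute_A_Z`), and so with
all `E^+`. In a product `𝒵_s(z) 𝒵_u(w)` the factor `E^+_s(z)` therefore moves to the far right for
free, and the only costly reordering is that of `x_s(z)` past `E^-_u(w)`, which yields a scalar
series `σ_{su}(w/z)`. By induction, a product of dressed currents in any number of variables is the
product of the `σ` over all pairs of variables, times the dressing of the product of the bare
currents (`Dressing.Compat.prodOf_Z`). The dressing does not depend on the order of the variables,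
because the `E^-` commute among themselves and so do the `E^+`.

Consequently a relation between bare currents with scalar factors `W` becomes the same relation
between dressed currents with factors `W / σ`; `exchange_relation`, `commutator_relation` and
`serreRel` are the three instances. Identifying `W / σ` with the stated quotients of infinite
products amounts, after writing these as exponentials (`qPoch_eq_expSeries`), to one identity of
rational functions of `q^{bn}`, `q^{kn}`, `p^{*n}` for each `n ≥ 1`. In the relation between `𝒵^+`
and `𝒵^-` the factors cancel `σ` completely, and on the support of the delta functions the dressing
cancels the exponentials in `φ^±`, so that only `K^±` survives.

Products of series make sense because every vector is killed by all operators of sufficiently large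
degree (`IsInC.isTruncGrading`). In a product of currents the factors on the right act first, so a
coefficient vanishes on a given vector once the exponents of some final segment of variables have a
large sum. A power of `z_u / z_y`, with `y` to the left of `u`, pushes exponents in that direction
(`posDir_varPairs`); hence all rearrangements reduce to finite sums on each vector. `Adm` and
`PosDir` record this bookkeeping. -/

noncomputable section

namespace EllTor

/-! ### Exponentials of formal power series over a noncommutative algebra -/

section ExpSeries

variable {R : Type*} [Ring R]

/-- The Euler operator `X d/dX`. -/
def euler (F : R⟦X⟧) : R⟦X⟧ := PowerSeries.mk fun n => n • PowerSeries.coeff n F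

@[simp] theorem coeff_euler (F : R⟦X⟧) (n : ℕ) :
    PowerSeries.coeff n (euler F) = n • PowerSeries.coeff n F := PowerSeries.coeff_mk _ _

theorem euler_add (F G : R⟦X⟧) : euler (F + G) = euler F + euler G := by
  ext n; simp

theorem euler_sub (F G : R⟦X⟧) : euler (F - G) = euler F - euler G := by
  ext n; simp [mul_sub]

theorem euler_one : euler (1 : R⟦X⟧) = 0 := by
  ext n
  rcases n with _ | n <;> simp [PowerSeries.coeff_one]

theorem euler_mul (F G : R⟦X⟧) : euler (F * G) = euler F * G + F * euler G := by
  ext n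
  simp only [coeff_euler, PowerSeries.coeff_mul, map_add, Finset.smul_sum,
    ← Finset.sum_add_distrib]
  refine Finset.sum_congr rfl fun p hp => ?_
  rw [← Finset.HasAntidiagonal.mem_antidiagonal.mp hp, add_nsmul, smul_mul_assoc, mul_smul_comm]

theorem euler_C_mul (T : R) (F : R⟦X⟧) :
    euler (PowerSeries.C T * F) = PowerSeries.C T * euler F := by
  ext n
  simp only [coeff_euler, PowerSeries.coeff_C_mul, mul_smul_comm]

theorem euler_mul_C (T : R) (F : R⟦X⟧) :
    euler (F * PowerSeries.C T) = euler F * PowerSeries.C T := by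
  ext n
  simp only [coeff_euler, PowerSeries.coeff_mul_C, smul_mul_assoc]

theorem euler_pow_succ {F : R⟦X⟧} (h : Commute F (euler F)) (j : ℕ) :
    euler (F ^ (j + 1)) = (j + 1) • (euler F * F ^ j) := by
  induction j with
  | zero => simp
  | succ j ih =>
    rw [pow_succ, euler_mul, ih, add_nsmul _ (j + 1) 1, one_nsmul, smul_mul_assoc, mul_assoc,
      ← pow_succ, (h.pow_left (j + 1)).eq]

/-- The series `∑_{n ≥ 1} f_n X^n`. -/
def posPart (f : ℕ → R) : R⟦X⟧ := PowerSeries.mk fun s => if s = 0 then 0 else f s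

theorem coeff_posPart (f : ℕ → R) (n : ℕ) :
    PowerSeries.coeff n (posPart f) = if n = 0 then 0 else f n := PowerSeries.coeff_mk _ _

@[simp] theorem coeff_zero_posPart (f : ℕ → R) : PowerSeries.coeff 0 (posPart f) = 0 := by
  simp [coeff_posPart]

theorem posPart_congr {f g : ℕ → R} (h : ∀ n, n ≠ 0 → f n = g n) : posPart f = posPart g := by
  ext n
  rw [coeff_posPart, coeff_posPart]
  split_ifs with hn
  · rfl
  · exact h n hn

theorem coeff_posPart_pow_eq_zero (f : ℕ → R) {a j : ℕ} (h : a < j) :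
    PowerSeries.coeff a (posPart f ^ j) = 0 := by
  induction j generalizing a with
  | zero => omega
  | succ j ih =>
    rw [pow_succ, PowerSeries.coeff_mul]
    refine Finset.sum_eq_zero fun p hp => ?_
    rw [Finset.HasAntidiagonal.mem_antidiagonal] at hp
    rcases Nat.eq_zero_or_pos p.2 with h0 | h0
    · rw [h0, coeff_zero_posPart, mul_zero]
    · rw [ih (by omega), zero_mul]

theorem commute_of_coeff {F G : R⟦X⟧}
    (h : ∀ m n, Commute (PowerSeries.coeff m F) (PowerSeries.coeff n G)) : Commute F G := by
  ext n
  rw [PowerSeries.coeff_mul, PowerSeries.coeff_mul, ← Finset.Nat.sum_antidiagonal_swap]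
  exact Finset.sum_congr rfl fun p _ => (h _ _).eq

theorem coeff_pow_mem (A : Subring R) {F : R⟦X⟧} (h : ∀ n, PowerSeries.coeff n F ∈ A) (j n : ℕ) :
    PowerSeries.coeff n (F ^ j) ∈ A := by
  induction j generalizing n with
  | zero =>
    rw [pow_zero, PowerSeries.coeff_one]
    split_ifs
    exacts [A.one_mem, A.zero_mem]
  | succ j ih =>
    rw [pow_succ, PowerSeries.coeff_mul]
    exact A.sum_mem fun p _ => A.mul_mem (ih _) (h _)

theorem commute_posPart {f g : ℕ → R} (h : ∀ m n, m ≠ 0 → n ≠ 0 → Commute (f m) (g n)) :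
    Commute (posPart f) (posPart g) := by
  refine commute_of_coeff fun m n => ?_
  rw [coeff_posPart, coeff_posPart]
  split_ifs with hm hn hn
  exacts [Commute.zero_left _, Commute.zero_left _, Commute.zero_right _, h m n hm hn]

theorem euler_posPart (f : ℕ → R) : euler (posPart f) = posPart fun n => n • f n := by
  ext n
  rw [coeff_euler, coeff_posPart, coeff_posPart]
  split_ifs <;> simp

variable [Algebra ℂ R]

/-- Uniqueness for the equation `X D' = h D`: as `h` has no constant term, its `n`-th coefficient
expresses `n D_n` through lower coefficients of `D`. Identities between exponentials are proved this
way below. -/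
theorem eq_zero_of_euler_eq {h D : R⟦X⟧} (h0 : PowerSeries.coeff 0 h = 0)
    (hD : PowerSeries.coeff 0 D = 0) (he : euler D = h * D) : D = 0 := by
  ext n
  induction n using Nat.strong_induction_on with
  | _ n ih =>
    rcases Nat.eq_zero_or_pos n with rfl | hn
    · simpa using hD
    have h1 := congrArg (PowerSeries.coeff n) he
    rw [coeff_euler, PowerSeries.coeff_mul, Finset.sum_eq_zero] at h1
    · have h2 : ((n : ℂ)) • PowerSeries.coeff n D = 0 := by rw [Nat.cast_smul_eq_nsmul, h1]
      have h3 := congrArg (fun y => (n : ℂ)⁻¹ • y) h2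
      simpa [smul_smul, inv_mul_cancel₀ (Nat.cast_ne_zero.mpr hn.ne' : (n : ℂ) ≠ 0)] using h3
    · rintro ⟨p, r⟩ hp
      rw [Finset.HasAntidiagonal.mem_antidiagonal] at hp
      rcases Nat.eq_zero_or_pos p with rfl | hp0
      · simp [h0]
      · rw [ih r (by simp at hp; omega)]; simp

/-- The `j`-th power starts in degree `j`, so the cut-off in the definition may be any `N > n`;
coefficients of different degrees can then share one range. -/
theorem coeff_expSeries (f : ℕ → R) {n N : ℕ} (h : n < N) :
    PowerSeries.coeff n (expSeries f) =
      ∑ j ∈ Finset.range N, ((j ! : ℂ)⁻¹) • PowerSeries.coeff n (posPart f ^ j) := by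
  rw [expSeries, PowerSeries.coeff_mk]
  refine Finset.sum_subset (Finset.range_subset_range.mpr h) fun j _ hj => ?_
  rw [Finset.mem_range, not_lt] at hj
  have := coeff_posPart_pow_eq_zero f (show n < j by omega)
  rw [posPart] at this
  rw [this, smul_zero]

/-- The value at `0` never enters, so exponents that divide by `n` or by `1 - s ^ n` need no care
there. -/
theorem expSeries_congr {f g : ℕ → R} (h : ∀ n, n ≠ 0 → f n = g n) :
    expSeries f = expSeries g := by
  ext n
  rw [coeff_expSeries f n.lt_succ_self, coeff_expSeries g n.lt_succ_self, posPart_congr h]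

@[simp] theorem coeff_zero_expSeries (f : ℕ → R) : PowerSeries.coeff 0 (expSeries f) = 1 := by
  rw [coeff_expSeries f zero_lt_one]; simp

theorem coeff_expSeries_mem (A : Subalgebra ℂ R) {f : ℕ → R} (h : ∀ n, n ≠ 0 → f n ∈ A) (n : ℕ) :
    PowerSeries.coeff n (expSeries f) ∈ A := by
  rw [coeff_expSeries f n.lt_succ_self]
  refine A.sum_mem fun j _ => A.smul_mem (coeff_pow_mem A.toSubring (fun s => ?_) j n) _
  rw [coeff_posPart]
  split_ifs with hs
  exacts [A.zero_mem, h s hs]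

@[simp] theorem constantCoeff_expSeries (f : ℕ → R) :
    PowerSeries.constantCoeff (expSeries f) = 1 := by
  rw [← PowerSeries.coeff_zero_eq_constantCoeff_apply, coeff_zero_expSeries]

theorem commute_coeff_expSeries {T : R} {f : ℕ → R} (h : ∀ n, n ≠ 0 → Commute T (f n)) (n : ℕ) :
    Commute T (PowerSeries.coeff n (expSeries f)) := by
  have := coeff_expSeries_mem (Subalgebra.centralizer ℂ {T}) (f := f) (fun n hn => by
    rw [Subalgebra.mem_centralizer_iff]
    rintro _ rfl
    exact (h n hn).eq) n
  rw [Subalgebra.mem_centralizer_iff] at this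
  exact this T rfl

theorem commute_coeff_expSeries_coeff_expSeries {f g : ℕ → R}
    (h : ∀ m n, m ≠ 0 → n ≠ 0 → Commute (f m) (g n)) (m n : ℕ) :
    Commute (PowerSeries.coeff m (expSeries f)) (PowerSeries.coeff n (expSeries g)) :=
  commute_coeff_expSeries (fun n hn =>
    (commute_coeff_expSeries (fun m hm => (h m n hm hn).symm) m).symm) n

theorem euler_expSeries {f : ℕ → R} (h : ∀ m n, m ≠ 0 → n ≠ 0 → Commute (f m) (f n)) :
    euler (expSeries f) = euler (posPart f) * expSeries f := by
  have hc : Commute (posPart f) (euler (posPart f)) := by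
    rw [euler_posPart]
    exact commute_posPart fun m n hm hn => (h m n hm hn).smul_right n
  ext n
  -- One term more than necessary is kept: after `j = 0` is split off, the range agrees with that in
  -- `hR`, and `(j + 1) / (j + 1)! = 1 / j!` matches the summands.
  have hL : PowerSeries.coeff n (euler (expSeries f)) = ∑ j ∈ Finset.range (n + 2),
      ((j ! : ℂ)⁻¹) • PowerSeries.coeff n (euler (posPart f ^ j)) := by
    rw [coeff_euler, coeff_expSeries f (show n < n + 2 by omega), Finset.smul_sum]
    exact Finset.sum_congr rfl fun j _ => by rw [coeff_euler, smul_comm]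
  rw [hL, Finset.sum_range_succ', pow_zero, euler_one, map_zero, smul_zero, add_zero,
    PowerSeries.coeff_mul]
  have hR : ∀ p ∈ Finset.HasAntidiagonal.antidiagonal n, PowerSeries.coeff p.1 (euler (posPart f)) *
      PowerSeries.coeff p.2 (expSeries f) = ∑ j ∈ Finset.range (n + 1), ((j ! : ℂ)⁻¹) •
        (PowerSeries.coeff p.1 (euler (posPart f)) * PowerSeries.coeff p.2 (posPart f ^ j)) := by
    intro p hp
    rw [Finset.HasAntidiagonal.mem_antidiagonal] at hp
    rw [coeff_expSeries f (show p.2 < n + 1 by omega), Finset.mul_sum]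
    exact Finset.sum_congr rfl fun j _ => by rw [mul_smul_comm]
  rw [Finset.sum_congr rfl hR, Finset.sum_comm]
  refine Finset.sum_congr rfl fun j _ => ?_
  rw [← Finset.smul_sum, ← PowerSeries.coeff_mul, euler_pow_succ hc, map_nsmul,
    ← Nat.cast_smul_eq_nsmul ℂ, smul_smul, Nat.factorial_succ]
  congr 1
  have : (j ! : ℂ) ≠ 0 := Nat.cast_ne_zero.mpr j.factorial_ne_zero
  have : ((j + 1 : ℕ) : ℂ) ≠ 0 := Nat.cast_ne_zero.mpr j.succ_ne_zero
  rw [Nat.cast_mul]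
  field_simp

/-- For commuting exponents the exponential is the only solution of its Euler equation with constant
term `1`. This replaces manipulation of the double sum of powers. -/
theorem eq_expSeries {f : ℕ → R} (h : ∀ m n, m ≠ 0 → n ≠ 0 → Commute (f m) (f n)) {E : R⟦X⟧}
    (h0 : PowerSeries.coeff 0 E = 1) (hE : euler E = euler (posPart f) * E) :
    E = expSeries f := by
  rw [← sub_eq_zero]
  refine eq_zero_of_euler_eq (h := euler (posPart f)) (by simp)
    (by rw [map_sub, h0, coeff_zero_expSeries, sub_self]) ?_
  rw [euler_sub, hE, euler_expSeries h, mul_sub]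

theorem expSeries_zero : expSeries (fun _ => (0 : R)) = 1 := by
  refine (eq_expSeries (fun _ _ _ _ => Commute.zero_left _) (by simp) ?_).symm
  have : posPart (fun _ => (0 : R)) = 0 := by ext n; simp [coeff_posPart]
  rw [this, euler_one]
  ext n; simp

theorem expSeries_add {f g : ℕ → R} (hf : ∀ m n, m ≠ 0 → n ≠ 0 → Commute (f m) (f n))
    (hg : ∀ m n, m ≠ 0 → n ≠ 0 → Commute (g m) (g n))
    (hfg : ∀ m n, m ≠ 0 → n ≠ 0 → Commute (f m) (g n)) :
    expSeries (fun n => f n + g n) = expSeries f * expSeries g := by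
  symm
  refine eq_expSeries (fun m n hm hn => ?_) (by simp [PowerSeries.coeff_mul]) ?_
  · exact ((hf m n hm hn).add_right (hfg m n hm hn)).add_left
      ((hfg n m hn hm).symm.add_right (hg m n hm hn))
  · have h1 : posPart (fun n => f n + g n) = posPart f + posPart g := by
      ext n
      simp only [coeff_posPart, map_add]
      split_ifs <;> simp
    have h2 : Commute (expSeries f) (euler (posPart g)) := by
      refine commute_of_coeff fun m n => ?_
      rw [coeff_euler, coeff_posPart]
      refine Commute.smul_right ?_ n
      split_ifs with hn
      · exact Commute.zero_right _
      · exact (commute_coeff_expSeries (fun m hm => (hfg m n hm hn).symm) m).symm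
    rw [euler_mul, euler_expSeries hf, euler_expSeries hg, h1, euler_add, add_mul, mul_assoc,
      ← mul_assoc (expSeries f), h2.eq, mul_assoc]

theorem expSeries_mul_neg {f g : ℕ → R} (hf : ∀ m n, m ≠ 0 → n ≠ 0 → Commute (f m) (f n))
    (hg : ∀ n, n ≠ 0 → g n = -f n) : expSeries f * expSeries g = 1 := by
  have hg' : expSeries g = expSeries (fun n => -f n) := expSeries_congr hg
  rw [hg', ← expSeries_add hf (fun m n hm hn => (hf m n hm hn).neg_left.neg_right)
    (fun m n hm hn => (hf m n hm hn).neg_right)]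
  simp [expSeries_zero]

/-- If `T` has scalar commutator with the `f_s`, supported on `s = n`, then `[T, exp f]` is a
multiple of `X ^ n exp f`. -/
theorem commutator_coeff_expSeries {f : ℕ → R} {T : R} {n : ℕ} {r : ℂ} (hn : n ≠ 0)
    (h : ∀ m n, m ≠ 0 → n ≠ 0 → Commute (f m) (f n))
    (hT : ∀ s, s ≠ 0 → T * f s - f s * T = (if s = n then r else 0) • (1 : R)) (a : ℕ) :
    T * PowerSeries.coeff a (expSeries f) - PowerSeries.coeff a (expSeries f) * T =
      r • if n ≤ a then PowerSeries.coeff (a - n) (expSeries f) else 0 := by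
  set E := expSeries f with hE
  set L := posPart f with hL
  have hcomm : PowerSeries.C T * euler L - euler L * PowerSeries.C T =
      euler (PowerSeries.C (algebraMap ℂ R r) * PowerSeries.X ^ n) := by
    ext s
    simp only [map_sub, PowerSeries.coeff_C_mul, PowerSeries.coeff_mul_C, coeff_euler,
      PowerSeries.coeff_X_pow, hL, coeff_posPart]
    rcases eq_or_ne s 0 with rfl | hs
    · simp
    · rw [if_neg hs, mul_smul_comm, smul_mul_assoc, ← smul_sub, hT s hs]
      split_ifs <;> simp [Algebra.algebraMap_eq_smul_one]
  have hcen : ∀ G : R⟦X⟧, Commute (PowerSeries.C (algebraMap ℂ R r) * PowerSeries.X ^ n) G := by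
    intro G
    refine Commute.mul_left (commute_of_coeff fun i j => ?_) ((PowerSeries.commute_X_pow G n).symm)
    rw [PowerSeries.coeff_C]
    split_ifs
    exacts [Algebra.commutes r _, Commute.zero_left _]
  -- By `hcomm` the commutator of `T` with `euler L` is the central series `euler (r X ^ n)`. So
  -- both sides have Euler derivative `euler L` times themselves plus `euler (r X ^ n) * E`, and
  -- their difference solves the homogeneous equation.
  have key : PowerSeries.C T * E - E * PowerSeries.C T =
      PowerSeries.C (algebraMap ℂ R r) * PowerSeries.X ^ n * E := by
    rw [← sub_eq_zero]
    refine eq_zero_of_euler_eq (h := euler L) (by simp [hL]) ?_ ?_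
    · rw [mul_assoc]
      simp [hE, hn]
    · have hEe : euler E = euler L * E := euler_expSeries h
      have h1 : euler (PowerSeries.C T * E - E * PowerSeries.C T) =
          euler L * (PowerSeries.C T * E - E * PowerSeries.C T) +
            euler (PowerSeries.C (algebraMap ℂ R r) * PowerSeries.X ^ n) * E := by
        rw [euler_sub, euler_C_mul, euler_mul_C, hEe, ← hcomm]
        noncomm_ring
      have h2 : euler (PowerSeries.C (algebraMap ℂ R r) * PowerSeries.X ^ n * E) =
          euler (PowerSeries.C (algebraMap ℂ R r) * PowerSeries.X ^ n) * E +
            euler L * (PowerSeries.C (algebraMap ℂ R r) * PowerSeries.X ^ n * E) := by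
        rw [euler_mul, hEe, ← mul_assoc, (hcen (euler L)).eq, mul_assoc (euler L)]
      rw [euler_sub, h1, h2, mul_sub (euler L) (PowerSeries.C T * E - E * PowerSeries.C T)]
      abel
  have := congrArg (PowerSeries.coeff a) key
  rw [map_sub, PowerSeries.coeff_C_mul, PowerSeries.coeff_mul_C, mul_assoc,
    PowerSeries.coeff_C_mul, PowerSeries.coeff_X_pow_mul'] at this
  rw [this, Algebra.algebraMap_eq_smul_one, smul_mul_assoc, one_mul]

theorem coeff_expSeries_smul_pow (S : R) (f : ℕ → ℂ) (n : ℕ) :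
    PowerSeries.coeff n (expSeries fun s => f s • S ^ s) =
      PowerSeries.coeff n (expSeries f) • S ^ n := by
  have hp : ∀ j n, PowerSeries.coeff n (posPart (fun s => f s • S ^ s) ^ j) =
      PowerSeries.coeff n (posPart f ^ j) • S ^ n := by
    intro j
    induction j with
    | zero =>
      intro n
      simp only [pow_zero, PowerSeries.coeff_one]
      split_ifs with hn <;> simp [hn]
    | succ j ih =>
      intro n
      rw [pow_succ, pow_succ, PowerSeries.coeff_mul, PowerSeries.coeff_mul, Finset.sum_smul]
      refine Finset.sum_congr rfl fun p hp => ?_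
      rw [ih, coeff_posPart, coeff_posPart]
      split_ifs
      · simp
      · rw [smul_mul_smul_comm, ← pow_add, Finset.HasAntidiagonal.mem_antidiagonal.mp hp]
  rw [coeff_expSeries _ n.lt_succ_self, coeff_expSeries _ n.lt_succ_self, Finset.sum_smul]
  exact Finset.sum_congr rfl fun j _ => by rw [hp, smul_assoc]

theorem rescale_expSeries (r : ℂ) (f : ℕ → ℂ) :
    PowerSeries.rescale r (expSeries f) = expSeries fun n => r ^ n * f n := by
  ext n
  have := coeff_expSeries_smul_pow r f n
  simp only [smul_eq_mul] at this
  rw [PowerSeries.coeff_rescale, mul_comm, ← this]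
  simp only [mul_comm]

theorem expSeries_inv (f : ℕ → ℂ) : (expSeries f)⁻¹ = expSeries fun n => -f n := by
  rw [PowerSeries.inv_eq_iff_mul_eq_one (by
    rw [← PowerSeries.coeff_zero_eq_constantCoeff_apply, coeff_zero_expSeries]; exact one_ne_zero)]
  rw [mul_comm]
  exact expSeries_mul_neg (fun m n _ _ => Commute.all _ _) fun _ _ => rfl

end ExpSeries

/-! ### Moving currents past exponentials -/

section Intertwine

variable {V W : Type*} [AddCommGroup V] [Module ℂ V] [AddCommGroup W] [Module ℂ W]

/-- Source and target spaces are kept distinct because the lemma is applied to the map that collects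
all modes of a current into one sequence. -/
theorem comp_coeff_expSeries {f : ℕ → Module.End ℂ V} {g : ℕ → Module.End ℂ W} (x : V →ₗ[ℂ] W)
    (h : ∀ s, s ≠ 0 → x ∘ₗ f s = g s ∘ₗ x) (n : ℕ) :
    x ∘ₗ PowerSeries.coeff n (expSeries f) = PowerSeries.coeff n (expSeries g) ∘ₗ x := by
  have hp : ∀ (j n : ℕ) (v : V), x ((PowerSeries.coeff n (posPart f ^ j) : Module.End ℂ V) v) =
      (PowerSeries.coeff n (posPart g ^ j) : Module.End ℂ W) (x v) := by
    intro j
    induction j with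
    | zero =>
      intro n v
      simp only [pow_zero, PowerSeries.coeff_one]
      split_ifs <;> simp
    | succ j ih =>
      intro n v
      rw [pow_succ, pow_succ, PowerSeries.coeff_mul, PowerSeries.coeff_mul, LinearMap.sum_apply,
        LinearMap.sum_apply, map_sum]
      refine Finset.sum_congr rfl fun p _ => ?_
      rw [Module.End.mul_apply, Module.End.mul_apply, ih, coeff_posPart, coeff_posPart]
      split_ifs with hs
      · simp
      · exact congrArg _ (congrArg (fun T => T v) (h _ hs))
  ext v
  rw [coeff_expSeries _ n.lt_succ_self, coeff_expSeries _ n.lt_succ_self, LinearMap.comp_apply,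
    LinearMap.comp_apply, LinearMap.sum_apply, LinearMap.sum_apply, map_sum]
  exact Finset.sum_congr rfl fun j _ => by
    rw [LinearMap.smul_apply, LinearMap.smul_apply, map_smul, hp]

/-- If `[f_s, x_m] = c_s x_{m-s}`, then `x(z) exp(f(w)) = exp(-c(w/z)) exp(f(w)) x(z)`. -/
theorem mul_coeff_expSeries {f : ℕ → Module.End ℂ V} {x : ℤ → Module.End ℂ V} {c : ℕ → ℂ}
    (hf : ∀ m n, m ≠ 0 → n ≠ 0 → Commute (f m) (f n))
    (h : ∀ (s : ℕ) m, s ≠ 0 → f s * x m - x m * f s = c s • x (m - s)) (m : ℤ) (a : ℕ) :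
    x m * PowerSeries.coeff a (expSeries f) = ∑ y ∈ Finset.HasAntidiagonal.antidiagonal a,
      PowerSeries.coeff y.1 (expSeries fun n => -c n) •
        (PowerSeries.coeff y.2 (expSeries f) * x (m - y.1)) := by
  -- All modes are gathered into one map `xh : V → (ℤ → V)`, with `S` shifting the mode index. The
  -- commutation relation becomes the intertwining relation `xh f_s = (f_s - c_s S ^ s) xh`. Since
  -- `S` commutes with operators acting entrywise, the exponential on the right splits into a scalar
  -- series in `S` and `exp f`.
  let S : Module.End ℂ (ℤ → V) := LinearMap.funLeft ℂ V fun m : ℤ => m - 1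
  have hS : ∀ (n : ℕ) (w : ℤ → V) (m : ℤ), (S ^ n) w m = w (m - n) := by
    intro n
    induction n with
    | zero => intro w m; simp
    | succ n ih =>
      intro w m
      rw [pow_succ, Module.End.mul_apply, ih]
      change w (m - n - 1) = _
      congr 1; push_cast; ring
  let Pw : Module.End ℂ V → Module.End ℂ (ℤ → V) := fun T => LinearMap.compLeft T ℤ
  let xh : V →ₗ[ℂ] (ℤ → V) := LinearMap.pi x
  have hPi : ∀ T w m, Pw T w m = T (w m) := fun _ _ _ => rfl
  have hPc : ∀ T (n : ℕ), Commute (Pw T) (S ^ n) := by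
    intro T n
    ext1 w
    funext m
    rw [Module.End.mul_apply, Module.End.mul_apply, hPi, hS, hS, hPi]
  have hPP : ∀ m n, m ≠ 0 → n ≠ 0 → Commute (Pw (f m)) (Pw (f n)) := by
    intro m n hm hn
    ext1 w
    funext r
    have := congrArg (fun T => T (w r)) (hf m n hm hn).eq
    exact this
  have h1 := comp_coeff_expSeries (f := f) (g := fun s => Pw (f s) + (-c s) • S ^ s) xh
    (fun s hs => by
      ext1 v
      funext m
      have := congrArg (fun T => T v) (h s m hs)
      simp only [LinearMap.sub_apply, Module.End.mul_apply, LinearMap.smul_apply] at this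
      simp only [LinearMap.comp_apply, LinearMap.add_apply, LinearMap.smul_apply, Pi.add_apply,
        Pi.smul_apply, hS]
      change x m (f s v) = f s (x m v) + (-c s) • x (m - s) v
      rw [neg_smul, ← this]; abel) a
  rw [expSeries_add hPP (fun m n _ _ => (Commute.pow_pow (Commute.refl S) m n).smul_left _
    |>.smul_right _) (fun m n _ _ => (hPc _ n).smul_right _)] at h1
  ext v
  have h2 := congrArg (fun T => T v m) h1
  simp only [LinearMap.comp_apply] at h2
  rw [Module.End.mul_apply]
  refine Eq.trans (show x m _ = xh _ m from rfl) (h2.trans ?_)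
  rw [PowerSeries.coeff_mul, LinearMap.sum_apply, Finset.sum_apply, LinearMap.sum_apply,
    ← Finset.Nat.sum_antidiagonal_swap]
  refine Finset.sum_congr rfl fun p _ => ?_
  have h3 : ∀ w : ℤ → V, PowerSeries.coeff p.2 (expSeries fun s => Pw (f s)) w m =
      PowerSeries.coeff p.2 (expSeries f) (w m) := fun w =>
    (congrArg (fun T => T w) (comp_coeff_expSeries (f := fun s => Pw (f s)) (g := f)
      (LinearMap.proj (R := ℂ) m) (fun s _ => rfl) p.2))
  simp only [Prod.fst_swap, Prod.snd_swap]
  rw [coeff_expSeries_smul_pow, Module.End.mul_apply, h3, LinearMap.smul_apply, Pi.smul_apply, hS,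
    map_smul]
  rfl

end Intertwine

end EllTor

end

noncomputable section

namespace EllTor

/-! ### Convolution of operator-valued formal distributions with power series -/

/-- Triangle and square agree because all terms off the triangle vanish. It turns truncated double
sums into coefficients of a product of series. -/
theorem sum_range_antidiagonal {M : Type*} [AddCommMonoid M] (f : ℕ → ℕ → M) (N : ℕ)
    (hf : ∀ a b, N ≤ a + b → f a b = 0) :
    ∑ n ∈ Finset.range N, ∑ p ∈ Finset.HasAntidiagonal.antidiagonal n, f p.1 p.2 =
      ∑ a ∈ Finset.range N, ∑ b ∈ Finset.range N, f a b := by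
  simp only [Finset.Nat.sum_antidiagonal_eq_sum_range_succ f]
  refine (Finset.sum_range_diag_flip N f).trans (Finset.sum_congr rfl fun a _ => ?_)
  refine Finset.sum_subset (Finset.range_subset_range.mpr (Nat.sub_le _ _)) fun b _ hb => ?_
  rw [Finset.mem_range] at hb
  exact hf _ _ (by omega)

section Conv

open Filter

variable {V : Type*} [AddCommGroup V] [Module ℂ V]

theorem locSum_apply {T : Type*} {F : T → Module.End ℂ V} (hF : LocFin F) (v : V) :
    locSum F v = ∑ᶠ x, F x v := by
  rw [locSum, dif_pos hF]; rfl

/-- The coefficients of the series annihilate any given vector from some index on. -/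
def EvZero (E : (Module.End ℂ V)⟦X⟧) : Prop :=
  ∀ v : V, ∀ᶠ n in atTop, PowerSeries.coeff n E v = 0

theorem locFin_of_eventually {F : ℕ → Module.End ℂ V} (h : ∀ v, ∀ᶠ n in atTop, F n v = 0) :
    LocFin F := by
  intro v
  obtain ⟨N, hN⟩ := eventually_atTop.mp (h v)
  refine (Finset.range N).finite_toSet.subset fun n hn => ?_
  by_contra hn'
  exact hn (hN n (by simpa using hn'))

theorem locSum_apply_eventually {F : ℕ → Module.End ℂ V} (h : ∀ v, ∀ᶠ n in atTop, F n v = 0)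
    (v : V) {N : ℕ} (hN : ∀ n, N ≤ n → F n v = 0) :
    locSum F v = ∑ n ∈ Finset.range N, F n v := by
  rw [locSum_apply (locFin_of_eventually h)]
  refine finsum_eq_sum_of_support_subset _ fun n hn => ?_
  by_contra hn'
  exact hn (hN n (by simpa using hn'))

variable {G : Type*} [AddCommGroup G]

/-- The distribution `E(g) D`, where `g` stands for the monomial `z^{-g}`. -/
def conv (E : (Module.End ℂ V)⟦X⟧) (g : G) (D : G → Module.End ℂ V) : G → Module.End ℂ V :=
  fun e => locSum fun a : ℕ => PowerSeries.coeff a E * D (e + a • g)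

/-- The distribution `D E(g)`, where `g` stands for the monomial `z^{-g}`. -/
def rconv (E : (Module.End ℂ V)⟦X⟧) (g : G) (D : G → Module.End ℂ V) : G → Module.End ℂ V :=
  fun e => locSum fun a : ℕ => D (e + a • g) * PowerSeries.coeff a E

/-- For every vector `v` and every functional `f` in `S`, the values `D e v` vanish when `f e` is
large. -/
def Adm (S : Set (G →+ ℤ)) (D : G → Module.End ℂ V) : Prop :=
  ∀ f ∈ S, ∀ v, ∃ C : ℤ, ∀ e, C < f e → D e v = 0

/-- The direction `g` is nonnegative for all functionals in `S`. -/
def NonnegDir (S : Set (G →+ ℤ)) (g : G) : Prop := ∀ f ∈ S, 0 ≤ f g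

/-- The direction `g` is nonnegative for all functionals in `S`, and positive for one of them. -/
def PosDir (S : Set (G →+ ℤ)) (g : G) : Prop := NonnegDir S g ∧ ∃ f ∈ S, 0 < f g

variable {S : Set (G →+ ℤ)} {D D' : G → Module.End ℂ V} {E F : (Module.End ℂ V)⟦X⟧} {g h : G}

theorem Adm.mono {S' : Set (G →+ ℤ)} (hD : Adm S D) (hS : S' ⊆ S) : Adm S' D :=
  fun f hf => hD f (hS hf)

/-- Moving along `g` never lowers `f`, so one bound on `n` serves all `a`. This uniformity allows
iterated convolutions to be truncated at a single `N`. -/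
theorem Adm.eventually_all (hD : Adm S D) (hh : PosDir S h) (hg : NonnegDir S g) (e : G) (v : V) :
    ∀ᶠ n : ℕ in atTop, ∀ a : ℕ, D (e + a • g + n • h) v = 0 := by
  obtain ⟨f, hf, hfh⟩ := hh.2
  obtain ⟨C, hC⟩ := hD f hf v
  filter_upwards [eventually_gt_atTop (C - f e).toNat] with n hn a
  refine hC _ ?_
  have h1 : (n : ℤ) ≤ n * f h := le_mul_of_one_le_right (by positivity) hfh
  have h2 : 0 ≤ (a : ℤ) * f g := mul_nonneg (by positivity) (hg f hf)
  simp only [map_add, map_nsmul, nsmul_eq_mul]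
  omega

theorem Adm.eventually (hD : Adm S D) (hh : PosDir S h) (e : G) (v : V) :
    ∀ᶠ n : ℕ in atTop, D (e + n • h) v = 0 := by
  filter_upwards [hD.eventually_all hh (fun f _ => (map_zero f).ge) e v] with n hn
  simpa using hn 0

theorem eventually_forall_le {p : ℕ → Prop} (hp : ∀ᶠ n in atTop, p n) :
    ∀ᶠ N in atTop, ∀ n, N ≤ n → p n :=
  eventually_forall_ge_atTop.mpr hp

theorem Adm.conv_apply_all (hD : Adm S D) (hh : PosDir S h) (hg : NonnegDir S g) (e : G) (v : V) :
    ∀ᶠ N in atTop, ∀ a : ℕ, conv E h D (e + a • g) v =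
      ∑ n ∈ Finset.range N, PowerSeries.coeff n E (D (e + a • g + n • h) v) := by
  filter_upwards [eventually_forall_le (hD.eventually_all hh hg e v)] with N hN a
  refine locSum_apply_eventually (fun w => ?_) v fun n hn => ?_
  · filter_upwards [hD.eventually hh (e + a • g) w] with n hn
    rw [Module.End.mul_apply, hn, map_zero]
  · rw [Module.End.mul_apply, hN n hn a, map_zero]

theorem Adm.conv_apply (hD : Adm S D) (hh : PosDir S h) (e : G) (v : V) :
    ∀ᶠ N in atTop, conv E h D e v =
      ∑ n ∈ Finset.range N, PowerSeries.coeff n E (D (e + n • h) v) := by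
  filter_upwards [hD.conv_apply_all (E := E) hh (fun f _ => (map_zero f).ge) e v] with N hN
  simpa using hN 0

theorem rconv_apply (hE : EvZero E) (v : V) :
    ∀ᶠ N in atTop, ∀ (D : G → Module.End ℂ V) (e : G), rconv E g D e v =
      ∑ n ∈ Finset.range N, D (e + n • g) (PowerSeries.coeff n E v) := by
  filter_upwards [eventually_forall_le (hE v)] with N hN D e
  refine locSum_apply_eventually (fun w => ?_) v fun n hn => ?_
  · filter_upwards [hE w] with n hn
    rw [Module.End.mul_apply, hn, map_zero]
  · rw [Module.End.mul_apply, hN n hn, map_zero]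

theorem Adm.conv (hD : Adm S D) (hg : PosDir S g) : Adm S (conv E g D) := by
  intro f hf v
  obtain ⟨C, hC⟩ := hD f hf v
  refine ⟨C, fun e he => ?_⟩
  obtain ⟨N, hN⟩ := (hD.conv_apply (E := E) hg e v).exists
  rw [hN]
  refine Finset.sum_eq_zero fun n _ => ?_
  have h2 : 0 ≤ (n : ℤ) * f g := mul_nonneg (by positivity) (hg.1 f hf)
  rw [hC _ (by simp only [map_add, map_nsmul, nsmul_eq_mul]; omega), map_zero]

/-- Only finitely many vectors `E_n v` are nonzero, so finitely many bounds suffice, each corrected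
by the shift `n f(g)`. Hence no sign condition on `g` is needed. -/
theorem Adm.rconv (hD : Adm S D) (hE : EvZero E) : Adm S (rconv E g D) := by
  intro f hf v
  choose C hC using hD f hf
  obtain ⟨N, hN⟩ := (rconv_apply (g := g) hE v).exists
  obtain ⟨B, hB⟩ := ((Finset.range N).image fun n : ℕ =>
    C (PowerSeries.coeff n E v) - (n : ℤ) * f g).bddAbove
  refine ⟨B, fun e he => ?_⟩
  rw [hN]
  refine Finset.sum_eq_zero fun n hn => hC _ _ ?_
  have := hB (Finset.mem_coe.mpr (Finset.mem_image_of_mem _ hn))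
  simp only [map_add, map_nsmul, nsmul_eq_mul]
  omega

theorem Adm.add (hD : Adm S D) (hD' : Adm S D') : Adm S (D + D') := by
  intro f hf v
  obtain ⟨C, hC⟩ := hD f hf v
  obtain ⟨C', hC'⟩ := hD' f hf v
  refine ⟨max C C', fun e he => ?_⟩
  rw [max_lt_iff] at he
  rw [Pi.add_apply, LinearMap.add_apply, hC e he.1, hC' e he.2, add_zero]

theorem Adm.smul (hD : Adm S D) (r : ℂ) : Adm S (r • D) := by
  intro f hf v
  obtain ⟨C, hC⟩ := hD f hf v
  refine ⟨C, fun e he => ?_⟩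
  rw [Pi.smul_apply, LinearMap.smul_apply, hC e he, smul_zero]

theorem Adm.zero : Adm S (0 : G → Module.End ℂ V) := fun _ _ _ => ⟨0, fun _ _ => rfl⟩

theorem Adm.sum {ι : Type*} (s : Finset ι) {D : ι → G → Module.End ℂ V}
    (hD : ∀ i ∈ s, Adm S (D i)) : Adm S (∑ i ∈ s, D i) := by
  classical
  induction s using Finset.induction_on with
  | empty => exact Adm.zero
  | insert i s hi ih =>
    rw [Finset.sum_insert hi]
    exact (hD i (Finset.mem_insert_self i s)).add
      (ih fun j hj => hD j (Finset.mem_insert_of_mem hj))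

theorem Adm.comp_add (hD : Adm S D) (g : G) : Adm S fun e => D (e + g) := by
  intro f hf v
  obtain ⟨C, hC⟩ := hD f hf v
  exact ⟨C - f g, fun e he => hC _ (by rw [map_add]; omega)⟩

theorem conv_add (hD : Adm S D) (hD' : Adm S D') (hg : PosDir S g) :
    EllTor.conv E g (D + D') = EllTor.conv E g D + EllTor.conv E g D' := by
  funext e
  ext v
  obtain ⟨N, ⟨h1, h2⟩, h3⟩ := (((hD.conv_apply (E := E) hg e v).and
    (hD'.conv_apply (E := E) hg e v)).and ((hD.add hD').conv_apply (E := E) hg e v)).exists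
  rw [h3, Pi.add_apply, LinearMap.add_apply, h1, h2, ← Finset.sum_add_distrib]
  simp

theorem conv_smul (hD : Adm S D) (hg : PosDir S g) (r : ℂ) :
    EllTor.conv E g (r • D) = r • EllTor.conv E g D := by
  funext e
  ext v
  obtain ⟨N, h1, h2⟩ := ((hD.conv_apply (E := E) hg e v).and
    ((hD.smul r).conv_apply (E := E) hg e v)).exists
  rw [h2, Pi.smul_apply, LinearMap.smul_apply, h1, Finset.smul_sum]
  simp

theorem rconv_add (hE : EvZero E) (D D' : G → Module.End ℂ V) :
    EllTor.rconv E g (D + D') = EllTor.rconv E g D + EllTor.rconv E g D' := by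
  funext e
  ext v
  obtain ⟨N, hN⟩ := (rconv_apply (g := g) hE v).exists
  rw [hN, Pi.add_apply, LinearMap.add_apply, hN, hN, ← Finset.sum_add_distrib]
  simp

theorem rconv_smul (hE : EvZero E) (D : G → Module.End ℂ V) (r : ℂ) :
    EllTor.rconv E g (r • D) = r • EllTor.rconv E g D := by
  funext e
  ext v
  obtain ⟨N, hN⟩ := (rconv_apply (g := g) hE v).exists
  rw [hN, Pi.smul_apply, LinearMap.smul_apply, hN, Finset.smul_sum]
  simp

theorem conv_comp_add (E : (Module.End ℂ V)⟦X⟧) (g h : G) (D : G → Module.End ℂ V) :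
    EllTor.conv E g (fun e => D (e + h)) = fun e => EllTor.conv E g D (e + h) := by
  funext e
  simp only [EllTor.conv, add_right_comm]

theorem rconv_comp_add (E : (Module.End ℂ V)⟦X⟧) (g h : G) (D : G → Module.End ℂ V) :
    EllTor.rconv E g (fun e => D (e + h)) = fun e => EllTor.rconv E g D (e + h) := by
  funext e
  simp only [EllTor.rconv, add_right_comm]

theorem conv_conv_comm (hD : Adm S D) (hg : PosDir S g) (hh : PosDir S h)
    (hEF : ∀ a b, Commute (PowerSeries.coeff a E) (PowerSeries.coeff b F)) :
    EllTor.conv E g (EllTor.conv F h D) = EllTor.conv F h (EllTor.conv E g D) := by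
  funext e
  ext v
  obtain ⟨N, ⟨⟨h1, h2⟩, h3⟩, h4⟩ := ((((hD.conv (E := F) hh).conv_apply (E := E) hg e v).and
    ((hD.conv (E := E) hg).conv_apply (E := F) hh e v)).and
    (hD.conv_apply_all (E := F) hh hg.1 e v)).and
    (hD.conv_apply_all (E := E) hg hh.1 e v) |>.exists
  rw [h1, h2]
  simp only [h3, h4, map_sum]
  rw [Finset.sum_comm]
  refine Finset.sum_congr rfl fun b _ => Finset.sum_congr rfl fun a _ => ?_
  rw [← Module.End.mul_apply, (hEF a b).eq, Module.End.mul_apply, add_right_comm]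

/-- The two series act on opposite sides of `D` and need not commute. The right one is truncated
first, on `v`; the left one is then truncated on the finitely many vectors that result. -/
theorem conv_rconv_comm (hD : Adm S D) (hg : PosDir S g) (hF : EvZero F) :
    EllTor.conv E g (EllTor.rconv F h D) = EllTor.rconv F h (EllTor.conv E g D) := by
  funext e
  ext v
  obtain ⟨M, hM⟩ := (rconv_apply (g := h) hF v).exists
  have h2 : ∀ᶠ N in atTop, ∀ b ∈ Finset.range M,
      EllTor.conv E g D (e + b • h) (PowerSeries.coeff b F v) = ∑ n ∈ Finset.range N,
        PowerSeries.coeff n E (D (e + b • h + n • g) (PowerSeries.coeff b F v)) :=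
    (eventually_all_finset _).mpr fun b _ => hD.conv_apply hg _ _
  obtain ⟨N, h1, h2⟩ := (((hD.rconv (g := h) hF).conv_apply (E := E) hg e v).and h2).exists
  rw [h1, hM, Finset.sum_congr rfl h2]
  simp only [hM, map_sum]
  rw [Finset.sum_comm]
  simp only [add_right_comm]

theorem rconv_rconv_apply (hE : EvZero E) (hF : EvZero F) (v : V) :
    ∀ᶠ N in atTop, ∀ (D : G → Module.End ℂ V) (e : G),
      EllTor.rconv E g (EllTor.rconv F h D) e v = ∑ a ∈ Finset.range N, ∑ b ∈ Finset.range N,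
        D (e + a • g + b • h) (PowerSeries.coeff b F (PowerSeries.coeff a E v)) := by
  obtain ⟨M, hM⟩ := (eventually_forall_le (hE v)).exists
  have h3 : ∀ᶠ N in atTop, ∀ a ∈ Finset.range M, ∀ (D : G → Module.End ℂ V) (e : G),
      EllTor.rconv F h D e (PowerSeries.coeff a E v) = ∑ n ∈ Finset.range N,
        D (e + n • h) (PowerSeries.coeff n F (PowerSeries.coeff a E v)) :=
    (eventually_all_finset _).mpr fun a _ => rconv_apply hF _
  filter_upwards [rconv_apply (g := g) hE v, h3] with N h1 h2 D e
  rw [h1]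
  refine Finset.sum_congr rfl fun a _ => ?_
  by_cases ha : a < M
  · exact h2 a (Finset.mem_range.mpr ha) D _
  · simp [hM a (by omega)]

theorem rconv_rconv_comm (hE : EvZero E) (hF : EvZero F)
    (hEF : ∀ a b, Commute (PowerSeries.coeff a E) (PowerSeries.coeff b F))
    (D : G → Module.End ℂ V) :
    EllTor.rconv E g (EllTor.rconv F h D) = EllTor.rconv F h (EllTor.rconv E g D) := by
  funext e
  ext v
  obtain ⟨N, h1, h2⟩ := ((rconv_rconv_apply (g := g) (h := h) hE hF v).and
    (rconv_rconv_apply (g := h) (h := g) hF hE v)).exists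
  rw [h1, h2, Finset.sum_comm]
  refine Finset.sum_congr rfl fun b _ => Finset.sum_congr rfl fun a _ => ?_
  rw [← Module.End.mul_apply (PowerSeries.coeff b F), ← (hEF a b).eq, Module.End.mul_apply,
    add_right_comm]

theorem conv_mul (hD : Adm S D) (hg : PosDir S g) :
    EllTor.conv (E * F) g D = EllTor.conv E g (EllTor.conv F g D) := by
  funext e
  ext v
  obtain ⟨N, ⟨⟨h1, h2⟩, h3⟩, h4⟩ := ((((hD.conv (E := F) hg).conv_apply (E := E) hg e v).and
    (hD.conv_apply_all (E := F) hg hg.1 e v)).and (hD.conv_apply (E := E * F) hg e v)).and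
    (eventually_forall_le (hD.eventually hg e v)) |>.exists
  rw [h1, h3]
  simp only [h2, map_sum, PowerSeries.coeff_mul, LinearMap.sum_apply, Module.End.mul_apply]
  rw [← sum_range_antidiagonal (fun a b => PowerSeries.coeff a E
    (PowerSeries.coeff b F (D (e + a • g + b • g) v))) N fun a b hab => by
      rw [add_assoc, ← add_nsmul, h4 _ hab, map_zero, map_zero]]
  refine Finset.sum_congr rfl fun n _ => Finset.sum_congr rfl fun p hp => ?_
  rw [add_assoc, ← add_nsmul, Finset.HasAntidiagonal.mem_antidiagonal.mp hp]

theorem EvZero.exists_mul (hE : EvZero E) (hF : EvZero F) (v : V) :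
    ∀ᶠ N in atTop, ∀ a b, N ≤ a + b → PowerSeries.coeff b F (PowerSeries.coeff a E v) = 0 := by
  obtain ⟨M, hM⟩ := (eventually_forall_le (hE v)).exists
  have h3 : ∀ᶠ N in atTop, ∀ a ∈ Finset.range M, ∀ n, N ≤ n →
      PowerSeries.coeff n F (PowerSeries.coeff a E v) = 0 :=
    (eventually_all_finset _).mpr fun a _ => eventually_forall_le (hF _)
  obtain ⟨N, hN⟩ := h3.exists
  filter_upwards [eventually_ge_atTop (M + N)] with K hK a b hab
  by_cases ha : a < M
  · exact hN a (Finset.mem_range.mpr ha) b (by omega)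
  · rw [hM a (by omega), map_zero]

theorem EvZero.mul (hE : EvZero E) (hF : EvZero F) : EvZero (F * E) := by
  intro v
  filter_upwards [hE.exists_mul hF v] with N hN
  rw [PowerSeries.coeff_mul, LinearMap.sum_apply]
  refine Finset.sum_eq_zero fun p hp => ?_
  rw [Finset.HasAntidiagonal.mem_antidiagonal] at hp
  exact hN _ _ (by omega)

theorem rconv_mul (hE : EvZero E) (hF : EvZero F) (D : G → Module.End ℂ V) :
    EllTor.rconv (F * E) g D = EllTor.rconv E g (EllTor.rconv F g D) := by
  funext e
  ext v
  obtain ⟨N, ⟨h1, h2⟩, h3⟩ := (((rconv_rconv_apply (g := g) (h := g) hE hF v).and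
    (rconv_apply (g := g) (hE.mul hF) v)).and (hE.exists_mul hF v)).exists
  rw [h1, h2]
  rw [← sum_range_antidiagonal (fun a b => D (e + a • g + b • g)
    (PowerSeries.coeff b F (PowerSeries.coeff a E v))) N fun a b hab => by
      rw [h3 _ _ hab, map_zero]]
  refine Finset.sum_congr rfl fun n _ => ?_
  rw [PowerSeries.coeff_mul, ← Finset.Nat.sum_antidiagonal_swap, LinearMap.sum_apply, map_sum]
  refine Finset.sum_congr rfl fun p hp => ?_
  rw [add_assoc, ← add_nsmul, Finset.HasAntidiagonal.mem_antidiagonal.mp hp]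
  rfl

end Conv

end EllTor

end

noncomputable section

namespace EllTor

/-! ### Truncated gradings -/

section Grading

open Filter

variable {V : Type*} [AddCommGroup V] [Module ℂ V]

/-- A notion of homogeneous operators such that operators of large degree annihilate any given
vector. -/
structure IsTruncGrading (H : ℤ → Submodule ℂ (Module.End ℂ V)) : Prop where
  one_mem : 1 ∈ H 0
  mul_mem : ∀ {m n T T'}, T ∈ H m → T' ∈ H n → T * T' ∈ H (m + n)
  locSum_mem : ∀ {ι : Type} {F : ι → Module.End ℂ V} {n}, (∀ i, F i ∈ H n) → locSum F ∈ H n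
  trunc : ∀ v, ∃ N : ℤ, ∀ n, N < n → ∀ T ∈ H n, T v = 0

/-- The `a`-th coefficient of the series has degree `a r`. -/
def IsHomogSeries (H : ℤ → Submodule ℂ (Module.End ℂ V)) (r : ℤ) (E : (Module.End ℂ V)⟦X⟧) : Prop :=
  ∀ a : ℕ, PowerSeries.coeff a E ∈ H (a * r)

/-- The coefficient of `z^{-e}` has degree `f e`. -/
def HomogDist {G : Type*} [AddCommGroup G] (H : ℤ → Submodule ℂ (Module.End ℂ V)) (f : G →+ ℤ)
    (D : G → Module.End ℂ V) : Prop :=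
  ∀ e, D e ∈ H (f e)

/-- A scalar power series as a series of operators. -/
def scal (F : ℂ⟦X⟧) : (Module.End ℂ V)⟦X⟧ := PowerSeries.map (algebraMap ℂ (Module.End ℂ V)) F

theorem coeff_scal (F : ℂ⟦X⟧) (n : ℕ) : PowerSeries.coeff n (scal F : (Module.End ℂ V)⟦X⟧) =
    algebraMap ℂ (Module.End ℂ V) (PowerSeries.coeff n F) := PowerSeries.coeff_map _ _ _

theorem coeff_scal_apply (F : ℂ⟦X⟧) (n : ℕ) (v : V) :
    PowerSeries.coeff n (scal F : (Module.End ℂ V)⟦X⟧) v = PowerSeries.coeff n F • v := by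
  rw [coeff_scal, Module.algebraMap_end_apply]

theorem scal_mul (F F' : ℂ⟦X⟧) :
    (scal (F * F') : (Module.End ℂ V)⟦X⟧) = scal F * scal F' := map_mul _ _ _

theorem commute_coeff_scal (F : ℂ⟦X⟧) (E : (Module.End ℂ V)⟦X⟧) (a b : ℕ) :
    Commute (PowerSeries.coeff a (scal F)) (PowerSeries.coeff b E) := by
  rw [coeff_scal]
  exact Algebra.commutes _ _

variable {H : ℤ → Submodule ℂ (Module.End ℂ V)}

theorem IsHomogSeries.evZero (hH : IsTruncGrading H) {E : (Module.End ℂ V)⟦X⟧}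
    (hE : IsHomogSeries H 1 E) : EvZero E := by
  intro v
  obtain ⟨N, hN⟩ := hH.trunc v
  filter_upwards [eventually_gt_atTop N.toNat] with n hn
  exact hN (n * 1) (by omega) _ (hE n)

variable {G : Type*} [AddCommGroup G] {f : G →+ ℤ} {D : G → Module.End ℂ V} {g : G}
  {E : (Module.End ℂ V)⟦X⟧} {r : ℤ}

theorem HomogDist.adm (hH : IsTruncGrading H) (hD : HomogDist H f D) : Adm {f} D := by
  rintro _ rfl v
  obtain ⟨N, hN⟩ := hH.trunc v
  exact ⟨N, fun e he => hN _ he _ (hD e)⟩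

end Grading

/-! ### Distributions in an ordered list of variables -/

section Variables

open Filter

variable {V : Type*} [AddCommGroup V] [Module ℂ V] {X : Type*} [DecidableEq X]

/-- The sum of the exponents of the variables in a list. -/
def tot (L : List X) : (X → ℤ) →+ ℤ := (L.map fun x => Pi.evalAddMonoidHom (fun _ => ℤ) x).sum

omit [DecidableEq X] in
theorem tot_cons (y : X) (L : List X) (e : X → ℤ) : tot (y :: L) e = e y + tot L e := by
  simp [tot]

omit [DecidableEq X] in
theorem tot_perm {L L' : List X} (h : L.Perm L') : tot L = tot L' := (h.map _).sum_eq

theorem tot_single (L : List X) (u : X) : tot L (Pi.single u 1) = L.count u := by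
  induction L with
  | nil => simp [tot]
  | cons y L ih =>
    rw [tot_cons, ih, List.count_cons, Pi.single_apply]
    by_cases h : y = u <;> simp [h, add_comm]

/-- The functionals `tot L'` for the nonempty final segments `L'` of a list `L`. -/
def finalTots : List X → Set ((X → ℤ) →+ ℤ)
  | [] => ∅
  | y :: L => insert (tot (y :: L)) (finalTots L)

theorem nonnegDir_single (L : List X) (u : X) : NonnegDir (finalTots L) (Pi.single u 1) := by
  induction L with
  | nil => exact fun _ h => h.elim
  | cons y L ih =>
    rintro f (rfl | hf)
    · rw [tot_single]; positivity
    · exact ih f hf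

omit [DecidableEq X] in
theorem tot_mem_finalTots {L : List X} (hL : L ≠ []) : tot L ∈ finalTots L := by
  cases L with
  | nil => exact absurd rfl hL
  | cons y L => exact Set.mem_insert _ _

theorem posDir_tot_single {L : List X} {u : X} (hu : u ∈ L) :
    PosDir {tot L} (Pi.single u (1 : ℤ)) := by
  have : 0 < tot L (Pi.single u 1) := by
    rw [tot_single]; exact_mod_cast List.count_pos_iff.mpr hu
  exact ⟨by rintro _ rfl; exact this.le, _, rfl, this⟩

theorem posDir_single {L : List X} {u : X} (hu : u ∈ L) :
    PosDir (finalTots L) (Pi.single u (1 : ℤ)) :=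
  ⟨nonnegDir_single L u, tot L, tot_mem_finalTots (List.ne_nil_of_mem hu), by
    rw [tot_single]; exact_mod_cast List.count_pos_iff.mpr hu⟩

theorem finalTots_single_eq_zero {L : List X} {z : X} (hz : z ∉ L) :
    ∀ f ∈ finalTots L, f (Pi.single z 1) = 0 := by
  induction L with
  | nil => exact fun _ h => h.elim
  | cons y L ih =>
    rintro f (rfl | hf)
    · rw [tot_single, List.count_eq_zero_of_not_mem hz, Nat.cast_zero]
    · exact ih (fun h => hz (List.mem_cons_of_mem _ h)) f hf

/-- The pairs `(u, y)` of variables of a list with `y` to the left of `u`. -/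
def varPairs : List X → List (X × X)
  | [] => []
  | y :: L => varPairs L ++ L.map fun u => (u, y)

omit [DecidableEq X] in
theorem mem_of_mem_varPairs {L : List X} {p : X × X} (hp : p ∈ varPairs L) :
    p.1 ∈ L ∧ p.2 ∈ L := by
  induction L with
  | nil => simp [varPairs] at hp
  | cons y L ih =>
    rw [varPairs, List.mem_append, List.mem_map] at hp
    rcases hp with hp | ⟨u, hu, rfl⟩
    · exact ⟨List.mem_cons_of_mem _ (ih hp).1, List.mem_cons_of_mem _ (ih hp).2⟩
    · exact ⟨List.mem_cons_of_mem _ hu, List.mem_cons_self⟩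

theorem tot_single_sub_single {L : List X} (hL : L.Nodup) {u y : X} (hu : u ∈ L) (hy : y ∈ L) :
    tot L (Pi.single u 1 - Pi.single y 1) = 0 := by
  rw [map_sub, tot_single, tot_single, List.count_eq_one_of_mem hL hu,
    List.count_eq_one_of_mem hL hy, sub_self]

/-- The monomial `z_x / z_y`, encoded by the negative of its exponents. -/
def ratioDir (p : X × X) : X → ℤ := Pi.single p.1 1 - Pi.single p.2 1

/-- The functionals do not see the variable `z`, so the direction counts as that of `u` alone. -/
theorem posDir_ratioDir {L : List X} {u z : X} (hu : u ∈ L) (hz : z ∉ L) :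
    PosDir (finalTots L) (ratioDir (u, z)) := by
  have h1 : ∀ f ∈ finalTots L, f (ratioDir (u, z)) = f (Pi.single u 1) := fun f hf => by
    rw [ratioDir, map_sub, finalTots_single_eq_zero hz f hf, sub_zero]
  obtain ⟨h2, f, hf, h3⟩ := posDir_single hu
  exact ⟨fun f hf => (h1 f hf).symm ▸ h2 f hf, f, hf, (h1 f hf).symm ▸ h3⟩

/-- This makes factors expanded in `w/z` legitimate when `z` stands to the left of `w`. The total
over the whole list ignores a ratio of two of its variables; a shorter final segment that contains
`u` but not `y` sees it with a positive sign. -/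
theorem posDir_varPairs {L : List X} (hL : L.Nodup) {p : X × X} (hp : p ∈ varPairs L) :
    PosDir (finalTots L) (ratioDir p) := by
  induction L with
  | nil => simp [varPairs] at hp
  | cons z L ih =>
    have hz := tot_single_sub_single hL (mem_of_mem_varPairs hp).1 (mem_of_mem_varPairs hp).2
    suffices PosDir (finalTots L) (ratioDir p) by
      refine ⟨?_, this.2.imp fun f hf => ⟨Set.mem_insert_of_mem _ hf.1, hf.2⟩⟩
      rintro f (rfl | hf)
      · exact hz.ge
      · exact this.1 f hf
    rw [varPairs, List.mem_append, List.mem_map] at hp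
    rw [List.nodup_cons] at hL
    rcases hp with hp | ⟨u, hu, rfl⟩
    · exact ih hL.2 hp
    · exact posDir_ratioDir hu hL.1

theorem mulRatio_eq_conv (F : ℂ⟦X⟧) (x y : X) (D : Dist X V) :
    mulRatio F x y D = conv (scal F) (ratioDir (x, y)) D := by
  funext e
  rw [mulRatio, conv]
  congr 1
  funext n
  rw [coeff_scal, ← Algebra.smul_def, ratioDir, add_sub_assoc]
  congr 3
  rw [smul_sub, ← Pi.single_smul, ← Pi.single_smul]
  simp

/-- The product of `D` with the factors `W x y (z_x / z_y)` for the pairs `(x, y)` in a list. -/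
def mulPairs (W : X → X → ℂ⟦X⟧) (P : List (X × X)) (D : Dist X V) : Dist X V :=
  P.foldr (fun p D => mulRatio (W p.1 p.2) p.1 p.2 D) D

theorem mulPairs_cons (W : X → X → ℂ⟦X⟧) (p : X × X) (P : List (X × X)) (D : Dist X V) :
    mulPairs W (p :: P) D = conv (scal (W p.1 p.2)) (ratioDir p) (mulPairs W P D) :=
  mulRatio_eq_conv _ _ _ _

theorem mulPairs_append (W : X → X → ℂ⟦X⟧) (P P' : List (X × X)) (D : Dist X V) :
    mulPairs W (P ++ P') D = mulPairs W P (mulPairs W P' D) := List.foldr_append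

theorem mulRatios_map (W : X → X → ℂ⟦X⟧) (P : List (X × X)) (D : Dist X V) :
    mulRatios (P.map fun p => (W p.1 p.2, p.1, p.2)) D = mulPairs W P D := by
  rw [mulRatios, List.foldr_map, mulPairs]

variable {S : Set ((X → ℤ) →+ ℤ)} {W W' : X → X → ℂ⟦X⟧} {P P' : List (X × X)} {D : Dist X V}

theorem Adm.mulPairs (hD : Adm S D) (hP : ∀ p ∈ P, PosDir S (ratioDir p)) :
    Adm S (mulPairs W P D) := by
  induction P with
  | nil => exact hD
  | cons p P ih =>
    rw [mulPairs_cons]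
    exact (ih fun q hq => hP q (List.mem_cons_of_mem _ hq)).conv (hP p List.mem_cons_self)

theorem conv_mulPairs (hD : Adm S D) (hP : ∀ p ∈ P, PosDir S (ratioDir p))
    {E : (Module.End ℂ V)⟦X⟧} {g : X → ℤ} (hg : PosDir S g) :
    conv E g (EllTor.mulPairs W P D) = EllTor.mulPairs W P (conv E g D) := by
  induction P with
  | nil => rfl
  | cons p P ih =>
    have hP' : ∀ p ∈ P, PosDir S (ratioDir p) := fun q hq => hP q (List.mem_cons_of_mem _ hq)
    rw [mulPairs_cons, mulPairs_cons, ← ih hP', conv_conv_comm (hD.mulPairs hP') hg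
      (hP p List.mem_cons_self) fun a b => (commute_coeff_scal _ _ b a).symm]

theorem rconv_mulPairs (hD : Adm S D) (hP : ∀ p ∈ P, PosDir S (ratioDir p))
    {E : (Module.End ℂ V)⟦X⟧} (hE : EvZero E) {g : X → ℤ} :
    rconv E g (EllTor.mulPairs W P D) = EllTor.mulPairs W P (rconv E g D) := by
  induction P with
  | nil => rfl
  | cons p P ih =>
    have hP' : ∀ p ∈ P, PosDir S (ratioDir p) := fun q hq => hP q (List.mem_cons_of_mem _ hq)
    rw [mulPairs_cons, mulPairs_cons, ← ih hP', conv_rconv_comm (hD.mulPairs hP')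
      (hP p List.mem_cons_self) hE]

theorem mulPairs_perm (hD : Adm S D) (hP : ∀ p ∈ P, PosDir S (ratioDir p)) (h : P.Perm P') :
    EllTor.mulPairs W P D = EllTor.mulPairs W P' D := by
  induction h with
  | nil => rfl
  | cons p _ ih =>
    rw [mulPairs_cons, mulPairs_cons, ih fun q hq => hP q (List.mem_cons_of_mem _ hq)]
  | swap p q P =>
    have hP' : ∀ p ∈ P, PosDir S (ratioDir p) := fun r hr =>
      hP r (List.mem_cons_of_mem _ (List.mem_cons_of_mem _ hr))
    simp only [mulPairs_cons]
    exact conv_conv_comm (hD.mulPairs hP') (hP q (by simp)) (hP p (by simp))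
      fun a b => commute_coeff_scal _ _ _ _
  | trans h1 _ ih1 ih2 =>
    rw [ih1 hP, ih2 fun q hq => hP q (h1.mem_iff.mpr hq)]

theorem mulPairs_mulPairs (hD : Adm S D) (hP : ∀ p ∈ P, PosDir S (ratioDir p)) :
    EllTor.mulPairs W P (EllTor.mulPairs W' P D) =
      EllTor.mulPairs (fun x y => W x y * W' x y) P D := by
  induction P with
  | nil => rfl
  | cons p P ih =>
    have hP' : ∀ p ∈ P, PosDir S (ratioDir p) := fun q hq => hP q (List.mem_cons_of_mem _ hq)
    have hp := hP p List.mem_cons_self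
    rw [mulPairs_cons, mulPairs_cons, mulPairs_cons, ← conv_mulPairs (hD.mulPairs hP') hP' hp,
      ih hP', scal_mul, conv_mul (hD.mulPairs hP') hp]

/-- The product `A(z_y) D`. -/
def leftMul (y : X) (A : ℤ → Module.End ℂ V) (D : Dist X V) : Dist X V := fun e => A (e y) * D e

/-- The distribution `D` does not involve the variable `z_y`. -/
def IndepAt (y : X) (D : Dist X V) : Prop := ∀ e (n : ℤ), D (e + Pi.single y n) = D e

theorem IndepAt.conv {y : X} (hD : IndepAt y D) (E : (Module.End ℂ V)⟦X⟧) (g : X → ℤ) :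
    IndepAt y (conv E g D) := fun e n => by
  simp only [EllTor.conv, add_right_comm e (Pi.single y n), hD _ n]

theorem IndepAt.rconv {y : X} (hD : IndepAt y D) (E : (Module.End ℂ V)⟦X⟧) (g : X → ℤ) :
    IndepAt y (rconv E g D) := fun e n => by
  simp only [EllTor.rconv, add_right_comm e (Pi.single y n), hD _ n]

omit [DecidableEq X] in
theorem Adm.leftMul (hD : Adm S D) (y : X) (A : ℤ → Module.End ℂ V) : Adm S (leftMul y A D) := by
  intro f hf v
  obtain ⟨C, hC⟩ := hD f hf v
  exact ⟨C, fun e he => by rw [EllTor.leftMul, Module.End.mul_apply, hC e he, map_zero]⟩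

omit [DecidableEq X] in
theorem leftMul_conv_scal (hD : Adm S D) {g : X → ℤ} (hg : PosDir S g) {y : X} (hy : g y = 0)
    (A : ℤ → Module.End ℂ V) (F : ℂ⟦X⟧) :
    leftMul y A (conv (scal F) g D) = conv (scal F) g (leftMul y A D) := by
  funext e
  ext v
  obtain ⟨N, h1, h2⟩ := ((hD.conv_apply (E := scal F) hg e v).and
    ((hD.leftMul y A).conv_apply (E := scal F) hg e v)).exists
  rw [h2, leftMul, Module.End.mul_apply, h1, map_sum]
  refine Finset.sum_congr rfl fun n _ => ?_
  simp [leftMul, coeff_scal_apply, hy]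

omit [DecidableEq X] in
theorem leftMul_rconv {E : (Module.End ℂ V)⟦X⟧} (hE : EvZero E) {g : X → ℤ} {y : X}
    (hy : g y = 0) (A : ℤ → Module.End ℂ V) (D : Dist X V) :
    leftMul y A (rconv E g D) = rconv E g (leftMul y A D) := by
  funext e
  ext v
  obtain ⟨N, h1⟩ := (rconv_apply (g := g) hE v).exists
  rw [h1, leftMul, Module.End.mul_apply, h1, map_sum]
  refine Finset.sum_congr rfl fun n _ => ?_
  simp [leftMul, hy]

theorem leftMul_mulPairs (hD : Adm S D) (hP : ∀ p ∈ P, PosDir S (ratioDir p)) {y : X}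
    (hy : ∀ p ∈ P, p.1 ≠ y ∧ p.2 ≠ y) (A : ℤ → Module.End ℂ V) :
    leftMul y A (EllTor.mulPairs W P D) = EllTor.mulPairs W P (leftMul y A D) := by
  induction P with
  | nil => rfl
  | cons p P ih =>
    have hP' : ∀ p ∈ P, PosDir S (ratioDir p) := fun q hq => hP q (List.mem_cons_of_mem _ hq)
    have hp := hy p List.mem_cons_self
    rw [mulPairs_cons, mulPairs_cons, ← ih hP' fun q hq => hy q (List.mem_cons_of_mem _ hq),
      leftMul_conv_scal (hD.mulPairs hP') (hP p List.mem_cons_self)]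
    simp [ratioDir, hp.1.symm, hp.2.symm]

/-- Moving a current past a series of operators in another variable. -/
theorem leftMul_conv {x : ℤ → Module.End ℂ V} {E : (Module.End ℂ V)⟦X⟧} {F : ℂ⟦X⟧}
    (hx : ∀ m a, x m * PowerSeries.coeff a E = ∑ p ∈ Finset.HasAntidiagonal.antidiagonal a,
      PowerSeries.coeff p.1 F • (PowerSeries.coeff p.2 E * x (m - p.1)))
    {u y : X} (huy : u ≠ y) (hD : Adm S D) (hu : PosDir S (Pi.single u 1))
    (hg : PosDir S (ratioDir (u, y))) (hy : IndepAt y D) :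
    leftMul y x (conv E (Pi.single u 1) D) =
      conv (scal F) (ratioDir (u, y)) (conv E (Pi.single u 1) (leftMul y x D)) := by
  funext e
  ext v
  obtain ⟨N, ⟨⟨h1, h2⟩, h3⟩, h4⟩ := ((((hD.conv_apply (E := E) hu e v).and
    (((hD.leftMul y x).conv (E := E) hu).conv_apply (E := scal F) hg e v)).and
    ((hD.leftMul y x).conv_apply_all (E := E) hu hg.1 e v)).and
    (eventually_forall_le (hD.eventually hu e v))).exists
  rw [h2, leftMul, Module.End.mul_apply, h1, map_sum]
  -- As `D` does not involve `z_y`, the part of the ratio along `y` can be dropped here; by `h6` it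
  -- survives only as a shift of the mode of `x`.
  have h5 : ∀ n a : ℕ, D (e + n • ratioDir (u, y) + a • Pi.single u (1 : ℤ)) =
      D (e + (n + a) • Pi.single u (1 : ℤ)) := by
    intro n a
    rw [← hy _ (n : ℤ)]
    congr 1
    rw [ratioDir, smul_sub, add_nsmul,
      show n • (Pi.single y (1 : ℤ) : X → ℤ) = Pi.single y (n : ℤ) by
        rw [← Pi.single_smul]; simp]
    abel
  have h6 : ∀ n a : ℕ, (e + n • ratioDir (u, y) + a • Pi.single u (1 : ℤ) : X → ℤ) y = e y - n := by
    intro n a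
    simp [ratioDir, huy.symm, sub_eq_add_neg]
  simp only [h3, coeff_scal_apply, Finset.smul_sum, leftMul, Module.End.mul_apply, h5, h6]
  -- The vectors depend on `n` and `a` only through `n + a` and vanish once `n + a ≥ N`, so the
  -- square sum regroups along antidiagonals, where `hx` applies.
  generalize hw : (fun n : ℕ => D (e + n • Pi.single u (1 : ℤ)) v) = w
  have hw' : ∀ n : ℕ, D (e + n • Pi.single u (1 : ℤ)) v = w n := fun n => congrFun hw n
  simp only [hw'] at h4 ⊢
  rw [← sum_range_antidiagonal (fun n a => PowerSeries.coeff n F •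
    PowerSeries.coeff a E (x (e y - n) (w (n + a)))) N
    fun n a h => by rw [h4 _ h, map_zero, map_zero, smul_zero]]
  refine Finset.sum_congr rfl fun a _ => ?_
  rw [← Module.End.mul_apply, hx, LinearMap.sum_apply]
  refine Finset.sum_congr rfl fun p hp => ?_
  rw [Finset.HasAntidiagonal.mem_antidiagonal.mp hp]
  rfl

end Variables

end EllTor

end

noncomputable section

namespace EllTor

/-! ### Dressed currents -/

open Filter

variable {V : Type*} [AddCommGroup V] [Module ℂ V]

/-- Currents `x_s(z)` together with series `E^-_s(z)` in `z` and `E^+_s(z)` in `z^{-1}`. -/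
structure Dressing (V S : Type*) [AddCommGroup V] [Module ℂ V] where
  x : S → ℤ → Module.End ℂ V
  Em : S → (Module.End ℂ V)⟦X⟧
  Ep : S → (Module.End ℂ V)⟦X⟧

namespace Dressing

variable {S : Type*} (T : Dressing V S)

/-- The operators summing to the coefficient of `z^{-n}` in `E^-_s(z) x_s(z) E^+_s(z)`. -/
def term (s : S) (n : ℤ) (y : ℕ × ℕ) : Module.End ℂ V :=
  PowerSeries.coeff y.1 (T.Em s) * T.x s (n + y.1 - y.2) * PowerSeries.coeff y.2 (T.Ep s)

/-- The modes of `E^-_s(z) x_s(z) E^+_s(z)`. -/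
def Z (s : S) (n : ℤ) : Module.End ℂ V := locSum (T.term s n)

/-- Homogeneity and commutation of the data of a dressing. -/
structure Compat (H : ℤ → Submodule ℂ (Module.End ℂ V)) : Prop where
  grading : IsTruncGrading H
  x_mem : ∀ s n, T.x s n ∈ H n
  Em_homog : ∀ s, IsHomogSeries H (-1) (T.Em s)
  Ep_homog : ∀ s, IsHomogSeries H 1 (T.Ep s)
  Em_comm : ∀ s u a b, Commute (PowerSeries.coeff a (T.Em s)) (PowerSeries.coeff b (T.Em u))
  Ep_comm : ∀ s u a b, Commute (PowerSeries.coeff a (T.Ep s)) (PowerSeries.coeff b (T.Ep u))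

/-- The exchange relation `x_s(z) E^-_u(w) = σ_{su}(w/z) E^-_u(w) x_s(z)`. -/
def Exchange (σ : S → S → ℂ⟦X⟧) : Prop :=
  ∀ s u m a, T.x s m * PowerSeries.coeff a (T.Em u) =
    ∑ p ∈ Finset.HasAntidiagonal.antidiagonal a,
      PowerSeries.coeff p.1 (σ s u) • (PowerSeries.coeff p.2 (T.Em u) * T.x s (m - p.1))

variable {T} {H : ℤ → Submodule ℂ (Module.End ℂ V)}

theorem Compat.evZero (hT : T.Compat H) (s : S) : EvZero (T.Ep s) :=
  (hT.Ep_homog s).evZero hT.grading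

/-- On `v` only finitely many coefficients of `E^+` survive, which bounds `b`. For each such `b`,
modes of `x` of large index kill the resulting vector, which bounds `a`. -/
theorem Compat.term_eventually (hT : T.Compat H) (s : S) (n : ℤ) (v : V) :
    ∀ᶠ N in atTop, ∀ y : ℕ × ℕ, N ≤ y.1 ∨ N ≤ y.2 → T.term s n y v = 0 := by
  obtain ⟨M, hM⟩ := (eventually_forall_le (hT.evZero s v)).exists
  have h : ∀ᶠ N : ℕ in atTop, ∀ b ∈ Finset.range M, ∀ a, N ≤ a →
      T.x s (n + a - b) (PowerSeries.coeff b (T.Ep s) v) = 0 := by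
    refine (eventually_all_finset _).mpr fun b _ => ?_
    obtain ⟨C, hC⟩ := hT.grading.trunc (PowerSeries.coeff b (T.Ep s) v)
    filter_upwards [eventually_gt_atTop (C - n + b).toNat] with N hN a ha
    exact hC _ (by omega) _ (hT.x_mem s _)
  filter_upwards [h, eventually_ge_atTop M] with N hN hMN y hy
  rw [term, Module.End.mul_apply, Module.End.mul_apply]
  by_cases hb : y.2 < M
  · rw [hN _ (Finset.mem_range.mpr hb) _ (by omega), map_zero]
  · rw [hM _ (by omega), map_zero, map_zero]

theorem Compat.locFin_term (hT : T.Compat H) (s : S) (n : ℤ) : LocFin (T.term s n) := by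
  intro v
  obtain ⟨N, hN⟩ := (hT.term_eventually s n v).exists
  refine (Finset.range N ×ˢ Finset.range N).finite_toSet.subset fun y hy => ?_
  by_contra h
  simp only [Finset.coe_product, Finset.coe_range, Set.mem_prod, Set.mem_Iio, not_and_or,
    not_lt] at h
  exact hy (hN y h)

theorem Compat.Z_apply (hT : T.Compat H) (s : S) (n : ℤ) (v : V) :
    ∀ᶠ N in atTop, T.Z s n v = ∑ a ∈ Finset.range N, ∑ b ∈ Finset.range N,
      T.term s n (a, b) v := by
  filter_upwards [hT.term_eventually s n v] with N hN
  rw [Z, locSum_apply (hT.locFin_term s n), ← Finset.sum_product']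
  refine finsum_eq_sum_of_support_subset _ fun y hy => ?_
  by_contra h
  simp only [Finset.coe_product, Finset.coe_range, Set.mem_prod, Set.mem_Iio, not_and_or,
    not_lt] at h
  exact hy (hN y h)

theorem Compat.Z_mem (hT : T.Compat H) (s : S) (n : ℤ) : T.Z s n ∈ H n := by
  refine hT.grading.locSum_mem fun y => ?_
  have := hT.grading.mul_mem (hT.grading.mul_mem (hT.Em_homog s y.1)
    (hT.x_mem s (n + y.1 - y.2))) (hT.Ep_homog s y.2)
  rwa [show (y.1 : ℤ) * -1 + (n + y.1 - y.2) + y.2 * 1 = n by ring] at this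

/-- An operator that commutes with `E^±_s` and intertwines `x_s` intertwines the dressed current. -/
theorem Compat.mul_Z (hT : T.Compat H) {A B : Module.End ℂ V} {s : S} (r : ℂ)
    (hA : ∀ a, Commute A (PowerSeries.coeff a (T.Em s)))
    (hB : ∀ a, Commute B (PowerSeries.coeff a (T.Ep s)))
    (hx : ∀ n, A * T.x s n = r • (T.x s n * B)) (n : ℤ) : A * T.Z s n = r • (T.Z s n * B) := by
  ext v
  obtain ⟨N, h1, h2⟩ := ((hT.Z_apply s n v).and (hT.Z_apply s n (B v))).exists
  rw [LinearMap.smul_apply, Module.End.mul_apply, Module.End.mul_apply, h1, h2]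
  simp only [map_sum, Finset.smul_sum]
  refine Finset.sum_congr rfl fun a _ => Finset.sum_congr rfl fun b _ => ?_
  rw [← Module.End.mul_apply, ← Module.End.mul_apply, ← LinearMap.smul_apply, term,
    ← mul_assoc, ← mul_assoc, (hA a).eq, mul_assoc _ A, hx, mul_assoc, smul_mul_assoc,
    mul_smul_comm, mul_assoc _ B, (hB b).eq]
  simp only [mul_assoc]

section Variables

variable {X : Type*} [DecidableEq X] (T) (sp : X → S)

/-- The product of currents of the given species in a list of variables. -/
def prodOf (A : S → ℤ → Module.End ℂ V) (L : List X) : Dist X V :=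
  prodCurrents (L.map fun u => (u, A (sp u)))

/-- The distribution `E^-(z_u) D E^+(z_u)`. -/
def dress (u : X) (D : Dist X V) : Dist X V :=
  conv (T.Em (sp u)) (Pi.single u 1) (rconv (T.Ep (sp u)) (-Pi.single u 1) D)

/-- The distribution `∏ E^-(z_u) D ∏ E^+(z_u)`, the products over a list of variables. -/
def dressAll (L : List X) (D : Dist X V) : Dist X V := L.foldr (T.dress sp) D

variable {T sp} {Φ : Set ((X → ℤ) →+ ℤ)} {D D' : Dist X V} {A : S → ℤ → Module.End ℂ V}

omit [DecidableEq X] in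
theorem prodOf_cons (y : X) (L : List X) :
    prodOf sp A (y :: L) = leftMul y (A (sp y)) (prodOf sp A L) := by
  funext e
  simp [prodOf, prodCurrents, leftMul]

omit [DecidableEq X] in
theorem homogDist_prodOf (hH : IsTruncGrading H) (hA : ∀ s n, A s n ∈ H n) (L : List X) :
    HomogDist H (tot L) (prodOf sp A L) := by
  induction L with
  | nil => exact fun e => by simpa [prodOf, prodCurrents, tot] using hH.one_mem
  | cons y L ih =>
    intro e
    rw [prodOf_cons, tot_cons]
    exact hH.mul_mem (hA _ _) (ih e)

omit [DecidableEq X] in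
theorem Adm.finalTots_cons (hH : IsTruncGrading H) {y : X} {L : List X}
    (h1 : HomogDist H (tot (y :: L)) D) (h2 : Adm (finalTots L) D) :
    Adm (finalTots (y :: L)) D := by
  rintro f (rfl | hf)
  · exact h1.adm hH _ rfl
  · exact h2 f hf

-- The functional added by a new leftmost variable is the total, controlled by the degree of the
-- whole product. The others concern the factors further right, which act first and already produce
-- `0`.
omit [DecidableEq X] in
theorem adm_prodOf (hH : IsTruncGrading H) (hA : ∀ s n, A s n ∈ H n) (L : List X) :
    Adm (finalTots L) (prodOf sp A L) := by
  induction L with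
  | nil => exact fun _ h => h.elim
  | cons y L ih =>
    refine Adm.finalTots_cons hH (homogDist_prodOf hH hA _) ?_
    rw [prodOf_cons]
    exact ih.leftMul _ _

theorem indepAt_prodOf {y : X} {L : List X} (hy : y ∉ L) : IndepAt y (prodOf sp A L) := by
  induction L with
  | nil => exact fun e n => by simp [prodOf, prodCurrents]
  | cons z L ih =>
    rw [List.mem_cons, not_or] at hy
    intro e n
    rw [prodOf_cons, leftMul, leftMul, ih hy.2 e n]
    simp [Ne.symm hy.1]

theorem _root_.EllTor.Adm.dress (hD : Adm Φ D) (hT : T.Compat H) {u : X}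
    (hu : PosDir Φ (Pi.single u 1)) : Adm Φ (T.dress sp u D) :=
  (hD.rconv (hT.evZero _)).conv hu

theorem _root_.EllTor.IndepAt.dress {y : X} (hD : IndepAt y D) (u : X) :
    IndepAt y (T.dress sp u D) := (hD.rconv _ _).conv _ _

theorem Compat.dress_dress (hT : T.Compat H) (hD : Adm Φ D) {u w : X}
    (hu : PosDir Φ (Pi.single u 1)) (hw : PosDir Φ (Pi.single w 1)) :
    T.dress sp u (T.dress sp w D) = T.dress sp w (T.dress sp u D) := by
  have hE := hT.evZero
  simp only [dress]
  rw [← conv_rconv_comm (hD.rconv (hE _)) hw (hE _), ← conv_rconv_comm (hD.rconv (hE _)) hu (hE _),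
    rconv_rconv_comm (hE _) (hE _) (hT.Ep_comm _ _),
    conv_conv_comm ((hD.rconv (hE _)).rconv (hE _)) hu hw (hT.Em_comm _ _)]

theorem Compat.dress_mulPairs (hT : T.Compat H) (hD : Adm Φ D) {u : X}
    (hu : PosDir Φ (Pi.single u 1)) {W : X → X → ℂ⟦X⟧} {P : List (X × X)}
    (hP : ∀ p ∈ P, PosDir Φ (ratioDir p)) :
    T.dress sp u (mulPairs W P D) = mulPairs W P (T.dress sp u D) := by
  rw [dress, rconv_mulPairs hD hP (hT.evZero _), conv_mulPairs (hD.rconv (hT.evZero _)) hP hu,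
    dress]

theorem Compat.dress_add (hT : T.Compat H) (hD : Adm Φ D) (hD' : Adm Φ D') {u : X}
    (hu : PosDir Φ (Pi.single u 1)) :
    T.dress sp u (D + D') = T.dress sp u D + T.dress sp u D' := by
  rw [dress, rconv_add (hT.evZero _), conv_add (hD.rconv (hT.evZero _)) (hD'.rconv (hT.evZero _)) hu,
    dress, dress]

theorem Compat.dress_smul (hT : T.Compat H) (hD : Adm Φ D) {u : X}
    (hu : PosDir Φ (Pi.single u 1)) (r : ℂ) :
    T.dress sp u (r • D) = r • T.dress sp u D := by
  rw [dress, rconv_smul (hT.evZero _), conv_smul (hD.rconv (hT.evZero _)) hu, dress]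

/-- The factor `E^+` lies to the right of `D` and is not met, so only the passage through `E^-`
contributes a scalar factor. -/
theorem Compat.leftMul_dress (hT : T.Compat H) {σ : S → S → ℂ⟦X⟧} (hσ : T.Exchange σ)
    (hD : Adm Φ D) {u y : X} (huy : u ≠ y) (hu : PosDir Φ (Pi.single u 1))
    (hg : PosDir Φ (ratioDir (u, y))) (hy : IndepAt y D) :
    leftMul y (T.x (sp y)) (T.dress sp u D) =
      mulPairs (fun u y => σ (sp y) (sp u)) [(u, y)] (T.dress sp u (leftMul y (T.x (sp y)) D)) := by
  rw [dress, leftMul_conv (hσ _ _) huy (hD.rconv (hT.evZero _)) hu hg (hy.rconv _ _),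
    leftMul_rconv (hT.evZero _) (by simp [huy.symm]), mulPairs_cons]
  rfl

theorem _root_.EllTor.Adm.dressAll (hD : Adm Φ D) (hT : T.Compat H) {L : List X}
    (hL : ∀ u ∈ L, PosDir Φ (Pi.single u 1)) : Adm Φ (T.dressAll sp L D) := by
  induction L with
  | nil => exact hD
  | cons u L ih =>
    exact (ih fun w hw => hL w (List.mem_cons_of_mem _ hw)).dress hT (hL u List.mem_cons_self)

theorem _root_.EllTor.IndepAt.dressAll {y : X} (hD : IndepAt y D) (L : List X) :
    IndepAt y (T.dressAll sp L D) := by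
  induction L with
  | nil => exact hD
  | cons u L ih => exact ih.dress u

theorem Compat.dressAll_perm (hT : T.Compat H) (hD : Adm Φ D) {L L' : List X}
    (hL : ∀ u ∈ L, PosDir Φ (Pi.single u 1)) (h : L.Perm L') :
    T.dressAll sp L D = T.dressAll sp L' D := by
  induction h with
  | nil => rfl
  | cons u _ ih =>
    exact congrArg (T.dress sp u) (ih fun w hw => hL w (List.mem_cons_of_mem _ hw))
  | swap u w L =>
    exact hT.dress_dress (hD.dressAll hT fun z hz => hL z (by simp [hz])) (hL _ (by simp))
      (hL _ (by simp))
  | trans h1 _ ih1 ih2 => rw [ih1 hL, ih2 fun u hu => hL u (h1.mem_iff.mpr hu)]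

theorem Compat.dressAll_mulPairs (hT : T.Compat H) (hD : Adm Φ D) {L : List X}
    (hL : ∀ u ∈ L, PosDir Φ (Pi.single u 1)) {W : X → X → ℂ⟦X⟧} {P : List (X × X)}
    (hP : ∀ p ∈ P, PosDir Φ (ratioDir p)) :
    T.dressAll sp L (mulPairs W P D) = mulPairs W P (T.dressAll sp L D) := by
  induction L with
  | nil => rfl
  | cons u L ih =>
    have hL' : ∀ u ∈ L, PosDir Φ (Pi.single u 1) := fun w hw => hL w (List.mem_cons_of_mem _ hw)
    exact (congrArg (T.dress sp u) (ih hL')).trans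
      (hT.dress_mulPairs (hD.dressAll hT hL') (hL u List.mem_cons_self) hP)

theorem Compat.dressAll_add (hT : T.Compat H) (hD : Adm Φ D) (hD' : Adm Φ D') {L : List X}
    (hL : ∀ u ∈ L, PosDir Φ (Pi.single u 1)) :
    T.dressAll sp L (D + D') = T.dressAll sp L D + T.dressAll sp L D' := by
  induction L with
  | nil => rfl
  | cons u L ih =>
    have hL' : ∀ u ∈ L, PosDir Φ (Pi.single u 1) := fun w hw => hL w (List.mem_cons_of_mem _ hw)
    exact (congrArg (T.dress sp u) (ih hL')).trans
      (hT.dress_add (hD.dressAll hT hL') (hD'.dressAll hT hL') (hL u List.mem_cons_self))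

theorem Compat.dressAll_smul (hT : T.Compat H) (hD : Adm Φ D) {L : List X}
    (hL : ∀ u ∈ L, PosDir Φ (Pi.single u 1)) (r : ℂ) :
    T.dressAll sp L (r • D) = r • T.dressAll sp L D := by
  induction L with
  | nil => rfl
  | cons u L ih =>
    have hL' : ∀ u ∈ L, PosDir Φ (Pi.single u 1) := fun w hw => hL w (List.mem_cons_of_mem _ hw)
    exact (congrArg (T.dress sp u) (ih hL')).trans
      (hT.dress_smul (hD.dressAll hT hL') (hL u List.mem_cons_self) r)

theorem Compat.dressAll_sub (hT : T.Compat H) (hD : Adm Φ D) (hD' : Adm Φ D') {L : List X}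
    (hL : ∀ u ∈ L, PosDir Φ (Pi.single u 1)) :
    T.dressAll sp L (D - D') = T.dressAll sp L D - T.dressAll sp L D' := by
  have h : ∀ B B' : Dist X V, B - B' = B + (-1 : ℂ) • B' := fun B B' => by
    rw [neg_smul, one_smul, sub_eq_add_neg]
  rw [h, h, hT.dressAll_add hD (hD'.smul _) hL, hT.dressAll_smul hD' hL]

theorem dressAll_zero (L : List X) :
    T.dressAll sp L (0 : Dist X V) = 0 := by
  induction L with
  | nil => rfl
  | cons u L ih =>
    refine (congrArg (T.dress sp u) ih).trans ?_
    have hl : locSum (fun _ : ℕ => (0 : Module.End ℂ V)) = 0 := by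
      ext v
      rw [locSum_apply fun v => by simp [Function.support]]
      simp
    funext e
    simp [dress, conv, rconv, hl]

theorem Compat.dressAll_sum (hT : T.Compat H) {ι : Type*} (s : Finset ι) {D : ι → Dist X V}
    (hD : ∀ i ∈ s, Adm Φ (D i)) {L : List X} (hL : ∀ u ∈ L, PosDir Φ (Pi.single u 1)) :
    T.dressAll sp L (∑ i ∈ s, D i) = ∑ i ∈ s, T.dressAll sp L (D i) := by
  classical
  induction s using Finset.induction_on with
  | empty => exact dressAll_zero L
  | insert i s hi ih =>
    have hs := fun j hj => hD j (Finset.mem_insert_of_mem hj)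
    rw [Finset.sum_insert hi, Finset.sum_insert hi,
      hT.dressAll_add (hD i (Finset.mem_insert_self i s)) (Adm.sum s hs) hL, ih hs]

theorem dressAll_comp_add (L : List X) (D : Dist X V) (h : X → ℤ) :
    T.dressAll sp L (fun e => D (e + h)) = fun e => T.dressAll sp L D (e + h) := by
  induction L with
  | nil => rfl
  | cons u L ih =>
    refine (congrArg (T.dress sp u) ih).trans ?_
    rw [dress, rconv_comp_add, conv_comp_add]
    rfl

theorem Compat.leftMul_dressAll (hT : T.Compat H) {σ : S → S → ℂ⟦X⟧} (hσ : T.Exchange σ)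
    (hD : Adm Φ D) {L : List X} {y : X} (hyL : y ∉ L) (hL : ∀ u ∈ L, PosDir Φ (Pi.single u 1))
    (hg : ∀ u ∈ L, PosDir Φ (ratioDir (u, y))) (hy : IndepAt y D) :
    leftMul y (T.x (sp y)) (T.dressAll sp L D) = mulPairs (fun u y => σ (sp y) (sp u))
      (L.map fun u => (u, y)) (T.dressAll sp L (leftMul y (T.x (sp y)) D)) := by
  induction L with
  | nil => rfl
  | cons u L ih =>
    rw [List.mem_cons, not_or] at hyL
    have hL' : ∀ u ∈ L, PosDir Φ (Pi.single u 1) := fun w hw => hL w (List.mem_cons_of_mem _ hw)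
    have hg' : ∀ u ∈ L, PosDir Φ (ratioDir (u, y)) := fun w hw => hg w (List.mem_cons_of_mem _ hw)
    have hu := hL u List.mem_cons_self
    have hP : ∀ p ∈ L.map fun u => (u, y), PosDir Φ (ratioDir p) := by
      simpa using hg'
    refine (hT.leftMul_dress hσ (hD.dressAll hT hL') (Ne.symm hyL.1) hu
      (hg u List.mem_cons_self) (hy.dressAll L)).trans ?_
    rw [ih hyL.2 hL' hg', hT.dress_mulPairs ((hD.leftMul _ _).dressAll hT hL') hu hP,
      ← mulPairs_append]
    rfl

/-- By `hZ`, the factor `E^+` of the leftmost dressed current passes all the others to the far right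
end, so the dressing in `z_y` surrounds the entire product. -/
theorem Compat.prodOf_Z_cons (hT : T.Compat H)
    (hZ : ∀ s u b m, Commute (PowerSeries.coeff b (T.Ep s)) (T.Z u m)) {y : X} {L : List X}
    (hy : (y :: L).Nodup) :
    prodOf sp T.Z (y :: L) = T.dress sp y (leftMul y (T.x (sp y)) (prodOf sp T.Z L)) := by
  rw [List.nodup_cons] at hy
  have hI : IndepAt y (prodOf sp T.Z L) := indepAt_prodOf hy.1
  have hA : Adm {tot (y :: L)} (leftMul y (T.x (sp y)) (prodOf sp T.Z L)) := by
    refine HomogDist.adm (H := H) hT.grading fun e => ?_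
    rw [tot_cons]
    exact hT.grading.mul_mem (hT.x_mem _ _) (homogDist_prodOf hT.grading hT.Z_mem L e)
  have hc : ∀ b e, Commute (PowerSeries.coeff b (T.Ep (sp y))) (prodOf sp T.Z L e) := by
    intro b e
    refine Commute.list_prod_right _ _ fun A hA => ?_
    simp only [List.map_map, List.mem_map, Function.comp] at hA
    obtain ⟨u, _, rfl⟩ := hA
    exact hZ _ _ _ _
  funext e
  ext v
  obtain ⟨N, ⟨h1, h2⟩, h3⟩ := (((hT.Z_apply (sp y) (e y) (prodOf sp T.Z L e v)).and
    (rconv_apply (g := (-Pi.single y (1 : ℤ) : X → ℤ)) (hT.evZero (sp y)) v)).and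
    ((hA.rconv (g := -Pi.single y (1 : ℤ)) (hT.evZero (sp y))).conv_apply
      (E := T.Em (sp y)) (posDir_tot_single List.mem_cons_self) e v)).exists
  rw [dress, h3, prodOf_cons, leftMul, Module.End.mul_apply, h1]
  simp only [h2, map_sum]
  refine Finset.sum_congr rfl fun a _ => Finset.sum_congr rfl fun b _ => ?_
  have hs : ∀ n : ℕ, n • (Pi.single y (1 : ℤ) : X → ℤ) = Pi.single y (n : ℤ) := fun n => by
    rw [← Pi.single_smul]; simp
  have h5 : e + a • Pi.single y (1 : ℤ) + b • -Pi.single y (1 : ℤ) =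
      e + Pi.single y (a - b : ℤ) := by
    rw [smul_neg, hs, hs, Pi.single_sub]; abel
  rw [h5, leftMul, hI, term, Module.End.mul_apply, Module.End.mul_apply, Module.End.mul_apply,
    ← Module.End.mul_apply (PowerSeries.coeff b _), (hc b e).eq, Module.End.mul_apply]
  simp [add_sub_assoc]

/-- Induction on the number of currents: the new bare current `x_y` crosses each `E^-_u` of the
product to its right and collects one factor `σ(z_u/z_y)` per crossing. -/
theorem Compat.prodOf_Z (hT : T.Compat H) {σ : S → S → ℂ⟦X⟧} (hσ : T.Exchange σ)
    (hZ : ∀ s u b m, Commute (PowerSeries.coeff b (T.Ep s)) (T.Z u m)) {L : List X}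
    (hL : L.Nodup) :
    prodOf sp T.Z L = mulPairs (fun u y => σ (sp y) (sp u)) (varPairs L)
      (T.dressAll sp L (prodOf sp T.x L)) := by
  induction L with
  | nil => rfl
  | cons y L ih =>
    have hP : ∀ p ∈ varPairs (y :: L), PosDir (finalTots (y :: L)) (ratioDir p) := fun p hp =>
      posDir_varPairs hL hp
    have hP₁ : ∀ p ∈ varPairs L, PosDir (finalTots (y :: L)) (ratioDir p) := fun p hp =>
      hP p (List.mem_append_left _ hp)
    have hu : ∀ u ∈ y :: L, PosDir (finalTots (y :: L)) (Pi.single u 1) := fun u hu =>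
      posDir_single hu
    have hL' := List.nodup_cons.mp hL
    -- Before `x_y` is multiplied on, finiteness is known for final segments of `L` only; the
    -- outermost dressing, in `z_y`, requires that of `y :: L`.
    have hx := adm_prodOf (sp := sp) hT.grading hT.x_mem L
    have hP₂ : ∀ p ∈ varPairs L, PosDir (finalTots L) (ratioDir p) := fun p hp =>
      posDir_varPairs hL'.2 hp
    have hu₂ : ∀ u ∈ L, PosDir (finalTots L) (Pi.single u 1) := fun u hu => posDir_single hu
    have hx₁ := adm_prodOf (sp := sp) hT.grading hT.x_mem (y :: L)
    have hg : ∀ u ∈ L, PosDir (finalTots L) (ratioDir (u, y)) := fun u hu =>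
      posDir_ratioDir hu hL'.1
    rw [hT.prodOf_Z_cons hZ hL, ih hL'.2, leftMul_mulPairs (hx.dressAll hT hu₂) hP₂
      (fun p hp => ⟨ne_of_mem_of_not_mem (mem_of_mem_varPairs hp).1 hL'.1,
        ne_of_mem_of_not_mem (mem_of_mem_varPairs hp).2 hL'.1⟩),
      hT.leftMul_dressAll hσ hx hL'.1 hu₂ hg (indepAt_prodOf hL'.1), ← prodOf_cons,
      ← mulPairs_append]
    exact hT.dress_mulPairs (hx₁.dressAll hT fun u h => hu u (List.mem_cons_of_mem _ h))
      (hu y List.mem_cons_self) hP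

/-- If `W' σ = W`, then the factors `W'` turn a product of dressed currents into the dressing of
the product of currents with the factors `W`. -/
theorem Compat.mulPairs_prodOf_Z (hT : T.Compat H) {σ : S → S → ℂ⟦X⟧} (hσ : T.Exchange σ)
    (hZ : ∀ s u b m, Commute (PowerSeries.coeff b (T.Ep s)) (T.Z u m)) {L L₀ : List X}
    (hL : L.Nodup) (hL₀ : L.Perm L₀) {P : List (X × X)} (hP : P.Perm (varPairs L))
    {W W' : X → X → ℂ⟦X⟧} (hW : ∀ p ∈ P, W' p.1 p.2 * σ (sp p.2) (sp p.1) = W p.1 p.2) :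
    mulPairs W' P (prodOf sp T.Z L) = T.dressAll sp L₀ (mulPairs W P (prodOf sp T.x L)) := by
  have hPd : ∀ p ∈ P, PosDir (finalTots L) (ratioDir p) := fun p hp =>
    posDir_varPairs hL (hP.mem_iff.mp hp)
  have hu : ∀ u ∈ L, PosDir (finalTots L) (Pi.single u 1) := fun u hu => posDir_single hu
  have hx := adm_prodOf (sp := sp) hT.grading hT.x_mem L
  have hx' := hx.dressAll (sp := sp) hT hu
  have hcongr : ∀ {W₁ W₂ : X → X → ℂ⟦X⟧} (P : List (X × X)) (D : Dist X V),
      (∀ p ∈ P, W₁ p.1 p.2 = W₂ p.1 p.2) → mulPairs W₁ P D = mulPairs W₂ P D := by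
    intro W₁ W₂ P D h
    induction P with
    | nil => rfl
    | cons p P ih =>
      rw [mulPairs_cons, mulPairs_cons, ih fun q hq => h q (List.mem_cons_of_mem _ hq),
        h p List.mem_cons_self]
  -- The `σ` factors are put in the order `P` and merged pairwise with the `W'`; the dressing is put
  -- in the order `L₀` and moved outside.
  rw [hT.prodOf_Z hσ hZ hL, ← mulPairs_perm hx' hPd hP, mulPairs_mulPairs hx' hPd,
    ← hT.dressAll_perm (hx.mulPairs hPd) hu hL₀, hT.dressAll_mulPairs hx hu hPd]
  exact hcongr P _ hW

end Variables

end Dressing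

end EllTor

end

noncomputable section

namespace EllTor

/-! ### Dressing by Heisenberg vertex operators -/

open Filter

variable {V : Type*} [AddCommGroup V] [Module ℂ V]

theorem coeff_expSeries_homog {H : ℤ → Submodule ℂ (Module.End ℂ V)} (hH : IsTruncGrading H)
    {f : ℕ → Module.End ℂ V} {r : ℤ} (hf : ∀ n : ℕ, n ≠ 0 → f n ∈ H (n * r)) :
    IsHomogSeries H r (expSeries f) := by
  have hp : ∀ (j n : ℕ), PowerSeries.coeff n (posPart f ^ j) ∈ H (n * r) := by
    intro j
    induction j with
    | zero =>
      intro n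
      rw [pow_zero, PowerSeries.coeff_one]
      split_ifs with hn
      · simpa [hn] using hH.one_mem
      · exact zero_mem _
    | succ j ih =>
      intro n
      rw [pow_succ, PowerSeries.coeff_mul]
      refine Submodule.sum_mem _ fun p hp => ?_
      rw [Finset.HasAntidiagonal.mem_antidiagonal] at hp
      rw [← hp, Nat.cast_add, add_mul]
      refine hH.mul_mem (ih _) ?_
      rw [coeff_posPart]
      split_ifs with h
      exacts [zero_mem _, hf _ h]
  intro n
  rw [coeff_expSeries f n.lt_succ_self]
  exact Submodule.sum_mem _ fun j _ => Submodule.smul_mem _ _ (hp j n)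

/-- This is the cancellation behind `commute_A_Z`: a shift of the summation index by `k` changes
nothing, because the terms pushed out of the range vanish. -/
theorem sum_range_shift {M : Type*} [AddCommMonoid M] (h : ℕ → M) (k N : ℕ)
    (hz : ∀ a, N ≤ a + k → h a = 0) :
    ∑ a ∈ Finset.range N, (if k ≤ a then h (a - k) else 0) = ∑ a ∈ Finset.range N, h a := by
  rcases lt_or_ge N k with hN | hN
  · rw [Finset.sum_eq_zero, Finset.sum_eq_zero]
    · exact fun a _ => hz a (by omega)
    · intro a ha
      rw [Finset.mem_range] at ha
      rw [if_neg (by omega)]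
  · obtain ⟨M', rfl⟩ := Nat.exists_eq_add_of_le hN
    rw [Finset.sum_range_add, Finset.sum_eq_zero, zero_add, add_comm k, Finset.sum_range_add,
      Finset.sum_eq_zero (s := Finset.range k), add_zero]
    · exact Finset.sum_congr rfl fun a _ => by simp
    · exact fun a _ => hz _ (by omega)
    · intro a ha
      rw [Finset.mem_range] at ha
      rw [if_neg (by omega)]

/-- Heisenberg operators `A_{i,n}`, currents `x_s(z)`, and the exponents of the vertex operators
`E^±_s(z) = exp(∑_n ε^±_{s,n} A_{ι s, ± n} z^{∓ n})`, with the structure constants `β`, `γ` of the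
commutators. -/
structure HeisData (V I S : Type*) [AddCommGroup V] [Module ℂ V] where
  A : I → ℤ → Module.End ℂ V
  x : S → ℤ → Module.End ℂ V
  ι : S → I
  em : S → ℕ → ℂ
  ep : S → ℕ → ℂ
  β : I → I → ℤ → ℂ
  γ : I → S → ℤ → ℂ

namespace HeisData

variable {I S : Type*} (K : HeisData V I S) (H : ℤ → Submodule ℂ (Module.End ℂ V))

/-- The dressing of the currents `x_s(z)` by the vertex operators `E^±_s(z)`. -/
def dressing : Dressing V S where
  x := K.x
  Em s := expSeries fun n : ℕ => K.em s n • K.A (K.ι s) (-n)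
  Ep s := expSeries fun n : ℕ => K.ep s n • K.A (K.ι s) n

/-- The commutation relations, with vertex operators whose commutators with `A_{i,n}` cancel those
of the currents. -/
structure IsHeis : Prop where
  grading : IsTruncGrading H
  A_mem : ∀ i n, n ≠ 0 → K.A i n ∈ H n
  x_mem : ∀ s n, K.x s n ∈ H n
  A_A : ∀ i j n m, n ≠ 0 → m ≠ 0 → K.A i n * K.A j m - K.A j m * K.A i n =
    (if n + m = 0 then K.β i j n else 0) • (1 : Module.End ℂ V)
  A_x : ∀ i s n m, n ≠ 0 → K.A i n * K.x s m - K.x s m * K.A i n = K.γ i s n • K.x s (m + n)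
  em_β : ∀ i s (n : ℕ), n ≠ 0 → K.em s n * K.β i (K.ι s) n + K.γ i s n = 0
  ep_β : ∀ i s (n : ℕ), n ≠ 0 → K.ep s n * K.β i (K.ι s) (-n) + K.γ i s (-n) = 0

variable {K H}

theorem IsHeis.A_comm (hK : K.IsHeis H) (i j : I) {n m : ℤ} (hn : n ≠ 0) (hm : m ≠ 0)
    (h : n + m ≠ 0) : Commute (K.A i n) (K.A j m) := by
  have := hK.A_A i j n m hn hm
  rw [if_neg h, zero_smul] at this
  exact sub_eq_zero.mp this

theorem IsHeis.em_comm (hK : K.IsHeis H) (s u : S) (m n : ℕ) (hm : m ≠ 0) (hn : n ≠ 0) :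
    Commute (K.em s m • K.A (K.ι s) (-m)) (K.em u n • K.A (K.ι u) (-n)) :=
  ((hK.A_comm _ _ (by omega) (by omega) (by omega)).smul_left _).smul_right _

theorem IsHeis.ep_comm (hK : K.IsHeis H) (s u : S) (m n : ℕ) (hm : m ≠ 0) (hn : n ≠ 0) :
    Commute (K.ep s m • K.A (K.ι s) m) (K.ep u n • K.A (K.ι u) n) :=
  ((hK.A_comm _ _ (by omega) (by omega) (by omega)).smul_left _).smul_right _

theorem IsHeis.compat (hK : K.IsHeis H) : K.dressing.Compat H where
  grading := hK.grading
  x_mem := hK.x_mem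
  Em_homog s := coeff_expSeries_homog hK.grading fun n hn => by
    rw [mul_neg_one]
    exact Submodule.smul_mem _ _ (hK.A_mem _ _ (by omega))
  Ep_homog s := coeff_expSeries_homog hK.grading fun n hn => by
    rw [mul_one]
    exact Submodule.smul_mem _ _ (hK.A_mem _ _ (by omega))
  Em_comm s u := commute_coeff_expSeries_coeff_expSeries (hK.em_comm s u)
  Ep_comm s u := commute_coeff_expSeries_coeff_expSeries (hK.ep_comm s u)

theorem IsHeis.exchange (hK : K.IsHeis H) : K.dressing.Exchange fun s u =>
    expSeries fun n => -(K.em u n * K.γ (K.ι u) s (-n)) := fun s u m a =>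
  mul_coeff_expSeries (hK.em_comm u u) (fun n m hn => by
    change _ * K.x s m - K.x s m * _ = _ • K.x s _
    rw [smul_mul_assoc, mul_smul_comm, ← smul_sub, hK.A_x _ _ _ _ (by omega), smul_smul, ← sub_eq_add_neg]) m a

/-- By the Leibniz rule the commutator with `E^- x E^+` has three terms. For `n > 0` the operator
commutes with `E^+`, while `E^-` and `x` contribute `em β` and `γ` times `z^n E^- x E^+`; these
cancel by `em_β`. For `n < 0` the roles of `E^-` and `E^+` are exchanged and `ep_β` is used. -/
theorem IsHeis.commute_A_Z (hK : K.IsHeis H) (i : I) (s : S) {n : ℤ} (hn : n ≠ 0) (m : ℤ) :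
    Commute (K.A i n) (K.dressing.Z s m) := by
  have hT := hK.compat
  set E := K.dressing.Em s with hE
  set F := K.dressing.Ep s with hF
  have key : ∀ v, ∀ᶠ N in atTop, ∑ a ∈ Finset.range N, ∑ b ∈ Finset.range N,
      (K.A i n (K.dressing.term s m (a, b) v) - K.dressing.term s m (a, b) (K.A i n v)) = 0 := by
    intro v
    have hterm : ∀ a b : ℕ, K.A i n * K.dressing.term s m (a, b) -
        K.dressing.term s m (a, b) * K.A i n =
        (K.A i n * PowerSeries.coeff a E - PowerSeries.coeff a E * K.A i n) *
          K.x s (m + a - b) * PowerSeries.coeff b F +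
        PowerSeries.coeff a E * (K.γ i s n • K.x s (m + a - b + n)) * PowerSeries.coeff b F +
        PowerSeries.coeff a E * K.x s (m + a - b) *
          (K.A i n * PowerSeries.coeff b F - PowerSeries.coeff b F * K.A i n) := by
      intro a b
      rw [← hK.A_x i s n _ hn]
      change K.A i n * (PowerSeries.coeff a E * K.x s (m + a - b) * PowerSeries.coeff b F) -
        (PowerSeries.coeff a E * K.x s (m + a - b) * PowerSeries.coeff b F) * K.A i n = _
      noncomm_ring
    have hterm' : ∀ a b : ℕ, K.dressing.term s (m + n) (a, b) =
        PowerSeries.coeff a E * K.x s (m + a - b + n) * PowerSeries.coeff b F := by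
      intro a b
      rw [show m + a - b + n = m + n + a - b by ring]
      rfl
    obtain ⟨k, rfl | rfl⟩ := n.eq_nat_or_neg
    · have hk : k ≠ 0 := by omega
      have h1 : ∀ a, K.A i k * PowerSeries.coeff a E - PowerSeries.coeff a E * K.A i k =
          (K.em s k * K.β i (K.ι s) k) • if k ≤ a then PowerSeries.coeff (a - k) E else 0 :=
        commutator_coeff_expSeries hk (hK.em_comm s s)
        fun q hq => by
          rw [mul_smul_comm, smul_mul_assoc, ← smul_sub, hK.A_A _ _ _ _ (by omega) (by omega),
            smul_smul]
          by_cases h : q = k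
          · simp [h]
          · rw [if_neg h, if_neg (by omega), mul_zero]
      have h2 : ∀ b, K.A i k * PowerSeries.coeff b F - PowerSeries.coeff b F * K.A i k = 0 :=
        fun b => sub_eq_zero.mpr (commute_coeff_expSeries (fun q hq =>
          (hK.A_comm _ _ (by omega) (by omega) (by omega)).smul_right _) b).eq
      -- The bound is required at `N - k`, so that terms already vanish in the last `k` places
      -- before the cut-off `N`.
      filter_upwards [tendsto_sub_atTop_nat k |>.eventually
        (hT.term_eventually s (m + k) v)] with N hN
      -- The commutator of each summand is a summand of mode `m + k` minus the same one shifted in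
      -- `a`, so the sum over `a` is zero although the individual terms are not.
      have h3 : ∀ a b : ℕ, K.A i k (K.dressing.term s m (a, b) v) -
          K.dressing.term s m (a, b) (K.A i k v) = K.γ i s k •
            (K.dressing.term s (m + k) (a, b) v -
              if k ≤ a then K.dressing.term s (m + k) (a - k, b) v else 0) := by
        intro a b
        have h4 := congrArg (fun B => B v) (hterm a b)
        simp only [LinearMap.sub_apply, Module.End.mul_apply] at h4
        rw [h4, h2]
        rw [h1, eq_neg_of_add_eq_zero_left (hK.em_β i s k hk), hterm']
        split_ifs with h
        · rw [hterm', show m + ((a - k : ℕ) : ℤ) - b + k = m + a - b by push_cast [h]; ring]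
          simp [sub_eq_add_neg, add_comm]
        · simp
      simp only [h3, ← Finset.smul_sum]
      rw [Finset.sum_comm, Finset.sum_eq_zero, smul_zero]
      intro b _
      rw [Finset.sum_sub_distrib, sum_range_shift (fun a => K.dressing.term s (m + k) (a, b) v) k N fun a ha =>
        hN (a, b) (Or.inl (by simp; omega)), sub_self]
    · have hk : k ≠ 0 := by omega
      have h1 : ∀ b, K.A i (-k) * PowerSeries.coeff b F - PowerSeries.coeff b F * K.A i (-k) =
          (K.ep s k * K.β i (K.ι s) (-k)) • if k ≤ b then PowerSeries.coeff (b - k) F else 0 :=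
        commutator_coeff_expSeries hk (hK.ep_comm s s)
        fun q hq => by
          rw [mul_smul_comm, smul_mul_assoc, ← smul_sub, hK.A_A _ _ _ _ (by omega) (by omega),
            smul_smul]
          by_cases h : q = k
          · simp [h]
          · rw [if_neg h, if_neg (by omega), mul_zero]
      have h2 : ∀ a, K.A i (-k) * PowerSeries.coeff a E - PowerSeries.coeff a E * K.A i (-k) = 0 :=
        fun b => sub_eq_zero.mpr (commute_coeff_expSeries (fun q hq =>
          (hK.A_comm _ _ (by omega) (by omega) (by omega)).smul_right _) b).eq
      filter_upwards [tendsto_sub_atTop_nat k |>.eventually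
        (hT.term_eventually s (m + -k) v)] with N hN
      have h3 : ∀ a b : ℕ, K.A i (-k) (K.dressing.term s m (a, b) v) -
          K.dressing.term s m (a, b) (K.A i (-k) v) = K.γ i s (-k) •
            (K.dressing.term s (m + -k) (a, b) v -
              if k ≤ b then K.dressing.term s (m + -k) (a, b - k) v else 0) := by
        intro a b
        have h4 := congrArg (fun B => B v) (hterm a b)
        simp only [LinearMap.sub_apply, Module.End.mul_apply] at h4
        rw [h4, h2]
        rw [h1, eq_neg_of_add_eq_zero_left (hK.ep_β i s k hk), hterm']
        split_ifs with h
        · rw [hterm', show m + (a : ℤ) - ((b - k : ℕ) : ℤ) + -k = m + a - b by push_cast [h]; ring]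
          simp [sub_eq_add_neg]
        · simp
      simp only [h3, ← Finset.smul_sum]
      rw [Finset.sum_eq_zero, smul_zero]
      intro a _
      rw [Finset.sum_sub_distrib, sum_range_shift (fun b => K.dressing.term s (m + -k) (a, b) v) k N fun b hb =>
        hN (a, b) (Or.inr (by simp; omega)), sub_self]
  ext v
  obtain ⟨N, ⟨h1, h2⟩, h3⟩ := (((hT.Z_apply s m v).and (hT.Z_apply s m (K.A i n v))).and
    (key v)).exists
  rw [Module.End.mul_apply, Module.End.mul_apply, h1, h2, ← sub_eq_zero, ← h3]
  simp only [map_sum, Finset.sum_sub_distrib]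

theorem IsHeis.commute_Ep_Z (hK : K.IsHeis H) (s u : S) (b : ℕ) (m : ℤ) :
    Commute (PowerSeries.coeff b (K.dressing.Ep s)) (K.dressing.Z u m) :=
  (commute_coeff_expSeries (fun n hn =>
    ((hK.commute_A_Z (K.ι s) u (by omega) m).smul_left (K.ep s n)).symm) b).symm

end HeisData

end EllTor

end

noncomputable section

namespace EllTor

/-! ### Relations between dressed currents -/

open Filter

variable {V : Type*} [AddCommGroup V] [Module ℂ V]

theorem conv_one {G : Type*} [AddCommGroup G] {S : Set (G →+ ℤ)} {D : G → Module.End ℂ V} {g : G}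
    (hD : Adm S D) (hg : PosDir S g) : conv 1 g D = D := by
  funext e
  ext v
  obtain ⟨N, h1, h2⟩ := ((hD.conv_apply (E := 1) hg e v).and (eventually_gt_atTop 0)).exists
  rw [h1, Finset.sum_eq_single_of_mem 0 (Finset.mem_range.mpr h2)]
  · simp
  · intro n _ hn
    rw [PowerSeries.coeff_one, if_neg hn, LinearMap.zero_apply]

theorem rconv_one {G : Type*} [AddCommGroup G] (D : G → Module.End ℂ V) (g : G) :
    rconv 1 g D = D := by
  have h0 : EvZero (1 : (Module.End ℂ V)⟦X⟧) := fun v => by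
    filter_upwards [eventually_gt_atTop 0] with n hn
    rw [PowerSeries.coeff_one, if_neg hn.ne', LinearMap.zero_apply]
  funext e
  ext v
  obtain ⟨N, h1, h2⟩ := ((rconv_apply (g := g) h0 v).and (eventually_gt_atTop 0)).exists
  rw [h1, Finset.sum_eq_single_of_mem 0 (Finset.mem_range.mpr h2)]
  · simp
  · intro n _ hn
    rw [PowerSeries.coeff_one, if_neg hn, LinearMap.zero_apply, map_zero]

section Linear

variable {X : Type*} [DecidableEq X] {S : Set ((X → ℤ) →+ ℤ)} {D : Dist X V}

/-- It lets the linear prefactors of the exchange relations be absorbed into the power series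
multiplying the currents. -/
theorem mulRatio_linear_mul (hD : Adm S D) {x y : X} (hg : PosDir S (ratioDir (x, y))) (r : ℂ)
    (F : ℂ⟦X⟧) : mulRatio ((1 - PowerSeries.C r * PowerSeries.X) * F) x y D =
      mulRatio F x y D - r • fun e => mulRatio F x y D (e + ratioDir (x, y)) := by
  rw [mulRatio_eq_conv, mulRatio_eq_conv, scal_mul, conv_mul hD hg]
  have hD' := hD.conv (E := scal F) hg
  generalize conv (scal F) (ratioDir (x, y)) D = B at hD' ⊢
  funext e
  ext v
  obtain ⟨N, h1, h2⟩ := ((hD'.conv_apply (E := scal (1 - PowerSeries.C r * PowerSeries.X)) hg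
    e v).and (eventually_ge_atTop 2)).exists
  obtain ⟨M, rfl⟩ := Nat.exists_eq_add_of_le h2
  rw [h1, Finset.sum_range_add, Finset.sum_eq_zero (s := Finset.range M)]
  · simp [Finset.sum_range_succ, coeff_scal_apply, PowerSeries.coeff_one, sub_eq_add_neg,
      PowerSeries.coeff_C_mul, PowerSeries.coeff_X]
  · intro n _
    rw [coeff_scal_apply, map_sub, PowerSeries.coeff_one, if_neg (by omega),
      PowerSeries.coeff_C_mul, PowerSeries.coeff_X, if_neg (by omega), mul_zero, sub_zero, zero_smul]

end Linear

namespace Dressing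

variable {S : Type*} {T : Dressing V S} {H : ℤ → Submodule ℂ (Module.End ℂ V)}
  {σ : S → S → ℂ⟦X⟧}

section TwoVariables

variable (s u : S)

/-- The distribution `E^-_s(z_0) E^-_u(z_1) D E^+_s(z_0) E^+_u(z_1)`. -/
abbrev dressTwo (T : Dressing V S) (s u : S) (D : Dist (Fin 2) V) : Dist (Fin 2) V :=
  T.dressAll ![s, u] [0, 1] D

variable {s u}

theorem Compat.mulRatio_Z_Z (hT : T.Compat H) (hσ : T.Exchange σ)
    (hZ : ∀ s u b m, Commute (PowerSeries.coeff b (T.Ep s)) (T.Z u m)) {W W' : ℂ⟦X⟧}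
    (hW : W' * σ s u = W) :
    mulRatio W' 1 0 (prodCurrents [((0 : Fin 2), T.Z s), (1, T.Z u)]) =
      T.dressTwo s u (mulRatio W 1 0 (prodCurrents [((0 : Fin 2), T.x s), (1, T.x u)])) :=
  hT.mulPairs_prodOf_Z (sp := ![s, u]) hσ hZ (L := [0, 1]) (by decide) (List.Perm.refl _)
    (P := [(1, 0)]) (List.Perm.refl _) (W' := fun _ _ => W') (W := fun _ _ => W) (by simpa using hW)

theorem Compat.mulRatio_Z_Z' (hT : T.Compat H) (hσ : T.Exchange σ)
    (hZ : ∀ s u b m, Commute (PowerSeries.coeff b (T.Ep s)) (T.Z u m)) {W W' : ℂ⟦X⟧}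
    (hW : W' * σ u s = W) :
    mulRatio W' 0 1 (prodCurrents [((1 : Fin 2), T.Z u), (0, T.Z s)]) =
      T.dressTwo s u (mulRatio W 0 1 (prodCurrents [((1 : Fin 2), T.x u), (0, T.x s)])) :=
  hT.mulPairs_prodOf_Z (sp := ![s, u]) hσ hZ (L := [1, 0]) (by decide) (List.Perm.swap _ _ _)
    (P := [(0, 1)]) (List.Perm.refl _) (W' := fun _ _ => W') (W := fun _ _ => W) (by simpa using hW)

theorem posDir_tot_two (x : Fin 2) : PosDir {tot [(0 : Fin 2), 1]} (Pi.single x (1 : ℤ)) :=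
  posDir_tot_single (by fin_cases x <;> simp)

/-- Admissibility is weakened to the total exponent, the one functional independent of the order of
the currents. The two sides of a relation thereby become comparable. -/
theorem Compat.adm_two (hT : T.Compat H) (F : ℂ⟦X⟧) :
    Adm {tot [(0 : Fin 2), 1]}
      (mulRatio F 1 0 (prodCurrents [((0 : Fin 2), T.x s), (1, T.x u)])) := by
  have h := adm_prodOf (sp := ![s, u]) hT.grading hT.x_mem [0, 1]
  have hd : PosDir (finalTots [(0 : Fin 2), 1]) (ratioDir (1, 0)) :=
    posDir_varPairs (by decide) (by simp [varPairs])
  rw [mulRatio_eq_conv]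
  refine (h.conv (E := scal F) hd).mono ?_
  rintro _ rfl
  exact tot_mem_finalTots (by simp)

theorem Compat.adm_two' (hT : T.Compat H) (F : ℂ⟦X⟧) :
    Adm {tot [(0 : Fin 2), 1]}
      (mulRatio F 0 1 (prodCurrents [((1 : Fin 2), T.x u), (0, T.x s)])) := by
  have h := adm_prodOf (sp := ![s, u]) hT.grading hT.x_mem [1, 0]
  have hd : PosDir (finalTots [(1 : Fin 2), 0]) (ratioDir (0, 1)) :=
    posDir_varPairs (by decide) (by simp [varPairs])
  rw [mulRatio_eq_conv]
  refine (h.conv (E := scal F) hd).mono ?_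
  rintro _ rfl
  rw [tot_perm (List.Perm.swap (1 : Fin 2) 0 [])]
  exact tot_mem_finalTots (by simp)

theorem dressTwo_mulVar (x : Fin 2) (D : Dist (Fin 2) V) :
    T.dressTwo s u (mulVar x D) = mulVar x (T.dressTwo s u D) := dressAll_comp_add _ _ _

theorem Compat.dressTwo_smul (hT : T.Compat H) {D : Dist (Fin 2) V}
    (hD : Adm {tot [(0 : Fin 2), 1]} D) (r : ℂ) :
    T.dressTwo s u (r • D) = r • T.dressTwo s u D :=
  hT.dressAll_smul hD (fun x _ => posDir_tot_two x) r

theorem Compat.dressTwo_sub (hT : T.Compat H) {D D' : Dist (Fin 2) V}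
    (hD : Adm {tot [(0 : Fin 2), 1]} D) (hD' : Adm {tot [(0 : Fin 2), 1]} D') :
    T.dressTwo s u (D - D') = T.dressTwo s u D - T.dressTwo s u D' :=
  hT.dressAll_sub hD hD' fun x _ => posDir_tot_two x

/-- An exchange relation between currents implies one between the dressed currents. -/
theorem Compat.exchange_relation (hT : T.Compat H) (hσ : T.Exchange σ)
    (hZ : ∀ s u b m, Commute (PowerSeries.coeff b (T.Ep s)) (T.Z u m)) {μ ν B : ℂ} (hμ : μ * ν = 1)
    {F F' g g' : ℂ⟦X⟧} (hF : F * σ s u = (1 - PowerSeries.C (B * ν) * PowerSeries.X) * g)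
    (hF' : F' * σ u s = (1 - PowerSeries.C (B * μ) * PowerSeries.X) * g')
    (hx : μ • mulVar 0 (mulRatio g 1 0 (prodCurrents [((0 : Fin 2), T.x s), (1, T.x u)])) -
        B • mulVar 1 (mulRatio g 1 0 (prodCurrents [((0 : Fin 2), T.x s), (1, T.x u)])) =
      (μ * B) • mulVar 0 (mulRatio g' 0 1 (prodCurrents [((1 : Fin 2), T.x u), (0, T.x s)])) -
        mulVar 1 (mulRatio g' 0 1 (prodCurrents [((1 : Fin 2), T.x u), (0, T.x s)]))) :
    mulVar 0 (mulRatio F 1 0 (prodCurrents [((0 : Fin 2), T.Z s), (1, T.Z u)])) =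
      (-ν) • mulVar 1 (mulRatio F' 0 1 (prodCurrents [((1 : Fin 2), T.Z u), (0, T.Z s)])) := by
  have hd : PosDir (finalTots [(0 : Fin 2), 1]) (ratioDir (1, 0)) :=
    posDir_varPairs (by decide) (by simp [varPairs])
  have hd' : PosDir (finalTots [(1 : Fin 2), 0]) (ratioDir (0, 1)) :=
    posDir_varPairs (by decide) (by simp [varPairs])
  have hA := adm_prodOf (sp := ![s, u]) hT.grading hT.x_mem [0, 1]
  have hA' := adm_prodOf (sp := ![s, u]) hT.grading hT.x_mem [1, 0]
  rw [hT.mulRatio_Z_Z hσ hZ hF, hT.mulRatio_Z_Z' hσ hZ hF', ← dressTwo_mulVar, ← dressTwo_mulVar]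
  -- With `μ ν = 1`, the prefactors are `μ z - B w = μ z (1 - B ν w/z)` and, for `e2`, `μ B z - w =
  -- -w (1 - B μ z/w)`.
  have e1 : mulVar 0 (mulRatio ((1 - PowerSeries.C (B * ν) * PowerSeries.X) * g) 1 0
      (prodCurrents [((0 : Fin 2), T.x s), (1, T.x u)])) =
      ν • (μ • mulVar 0 (mulRatio g 1 0 (prodCurrents [((0 : Fin 2), T.x s), (1, T.x u)])) -
        B • mulVar 1 (mulRatio g 1 0 (prodCurrents [((0 : Fin 2), T.x s), (1, T.x u)]))) := by
    refine (congrArg (mulVar 0) (mulRatio_linear_mul hA hd _ _)).trans ?_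
    rw [smul_sub, smul_smul, mul_comm ν μ, hμ, one_smul, smul_smul, mul_comm ν B]
    funext e
    simp only [mulVar, Pi.sub_apply, Pi.smul_apply]
    rw [show e + Pi.single 0 1 + ratioDir (1, 0) = e + Pi.single (1 : Fin 2) 1 by
      rw [ratioDir]; abel]
    rfl
  have e2 : mulVar 1 (mulRatio ((1 - PowerSeries.C (B * μ) * PowerSeries.X) * g') 0 1
      (prodCurrents [((1 : Fin 2), T.x u), (0, T.x s)])) =
      (-1 : ℂ) • ((μ * B) • mulVar 0 (mulRatio g' 0 1
          (prodCurrents [((1 : Fin 2), T.x u), (0, T.x s)])) -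
        mulVar 1 (mulRatio g' 0 1 (prodCurrents [((1 : Fin 2), T.x u), (0, T.x s)]))) := by
    refine (congrArg (mulVar 1) (mulRatio_linear_mul hA' hd' _ _)).trans ?_
    rw [neg_smul, one_smul, neg_sub, mul_comm B μ]
    funext e
    simp only [mulVar, Pi.sub_apply, Pi.smul_apply]
    rw [show e + Pi.single 1 1 + ratioDir (0, 1) = e + Pi.single (0 : Fin 2) 1 by
      rw [ratioDir]; abel]
    rfl
  have hB : Adm {tot [(0 : Fin 2), 1]} ((μ * B) • mulVar 0 (mulRatio g' 0 1
      (prodCurrents [((1 : Fin 2), T.x u), (0, T.x s)])) -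
        mulVar 1 (mulRatio g' 0 1 (prodCurrents [((1 : Fin 2), T.x u), (0, T.x s)]))) := by
    rw [sub_eq_add_neg, ← neg_one_smul ℂ (mulVar 1 _)]
    exact (((hT.adm_two' g').comp_add _).smul _).add (((hT.adm_two' g').comp_add _).smul _)
  rw [e1, e2, hx, hT.dressTwo_smul hB, hT.dressTwo_smul hB, smul_smul, neg_mul_neg, mul_one]

end TwoVariables

end Dressing

/-! ### Enumerating pairs of variables -/

section VarPairs

variable {X : Type*}

theorem varPairs_map {Y : Type*} (f : X → Y) (L : List X) :
    varPairs (L.map f) = (varPairs L).map (Prod.map f f) := by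
  induction L with
  | nil => rfl
  | cons y L ih => simp [varPairs, ih, Function.comp_def]

/-- With `z` in the role of `w`, the three groups are the three families of factors in a Serre
relation: pairs among the `z_s`, the `w/z_s` with `z_s` to the left, and the `z_s/w` with `z_s` to
the right. -/
theorem varPairs_insert (M M' : List X) (z : X) :
    (varPairs (M ++ z :: M')).Perm (varPairs (M ++ M') ++ M.map (fun y => (z, y)) ++
      M'.map fun u => (u, z)) := by
  induction M with
  | nil => simp [varPairs]
  | cons y M ih =>
    rw [List.cons_append, varPairs, List.cons_append, varPairs]
    refine (ih.append_right _).trans ?_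
    rw [← Multiset.coe_eq_coe]
    simp only [← Multiset.coe_add, List.map_append, List.map_cons, ← Multiset.cons_coe,
      ← Multiset.singleton_add]
    abel

theorem mem_varPairs_of_pairwise {r : X → X → Prop} [Std.Asymm r] {L : List X}
    (hL : L.Pairwise r) (p : X × X) : p ∈ varPairs L ↔ p.1 ∈ L ∧ p.2 ∈ L ∧ r p.2 p.1 := by
  induction L with
  | nil => simp [varPairs]
  | cons y L ih =>
    rw [List.pairwise_cons] at hL
    rw [varPairs, List.mem_append, ih hL.2, List.mem_map]
    constructor
    · rintro (⟨h1, h2, h3⟩ | ⟨u, hu, rfl⟩)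
      · exact ⟨List.mem_cons_of_mem _ h1, List.mem_cons_of_mem _ h2, h3⟩
      · exact ⟨List.mem_cons_of_mem _ hu, List.mem_cons_self, hL.1 u hu⟩
    · rintro ⟨h1, h2, h3⟩
      rw [List.mem_cons] at h1 h2
      rcases h1 with h1 | h1 <;> rcases h2 with h2 | h2
      · rw [h1, h2] at h3; exact absurd h3 (Std.Asymm.asymm _ _ h3)
      · rw [h1] at h3; exact absurd h3 (Std.Asymm.asymm _ _ (hL.1 _ h2))
      · exact Or.inr ⟨p.1, h1, Prod.ext rfl h2.symm⟩
      · exact Or.inl ⟨h1, h2, h3⟩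

theorem nodup_varPairs {L : List X} (hL : L.Nodup) : (varPairs L).Nodup := by
  induction L with
  | nil => exact List.nodup_nil
  | cons y L ih =>
    rw [List.nodup_cons] at hL
    refine (ih hL.2).append (hL.2.map fun _ _ h => congrArg Prod.fst h) ?_
    intro p hp hp'
    obtain ⟨u, _, rfl⟩ := List.mem_map.mp hp'
    exact hL.1 (mem_of_mem_varPairs hp).2

/-- The Serre relation lists its pairs `u < v` by filtering a product of lists, whereas `varPairs`
is recursive; having no duplicates, the two need only the same members. -/
theorem varPairs_finRange (a : ℕ) :
    ((((List.finRange a).product (List.finRange a)).filter fun y => y.1 < y.2).map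
      fun y => (y.2, y.1)).Perm (varPairs (List.finRange a)) := by
  refine (List.perm_ext_iff_of_nodup ?_ (nodup_varPairs (List.nodup_finRange a))).mpr fun p => ?_
  · exact (((List.nodup_finRange a).product (List.nodup_finRange a)).filter _).map
      fun _ _ h => Prod.ext (congrArg Prod.snd h) (congrArg Prod.fst h)
  · rw [mem_varPairs_of_pairwise (r := (· < ·)) (List.pairwise_lt_finRange a)]
    simp only [List.mem_map, List.mem_filter, List.mem_finRange, true_and, decide_eq_true_eq]
    constructor
    · rintro ⟨y, ⟨_, hy⟩, rfl⟩
      exact hy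
    · intro h
      exact ⟨(p.2, p.1), ⟨List.mem_product.mpr ⟨List.mem_finRange _, List.mem_finRange _⟩, h⟩, rfl⟩

end VarPairs

namespace Dressing

variable {S : Type*} {T : Dressing V S} {H : ℤ → Submodule ℂ (Module.End ℂ V)}
  {σ : S → S → ℂ⟦X⟧}

/-- A Serre relation between currents implies one between the dressed currents. -/
theorem Compat.serreRel (hT : T.Compat H) (hσ : T.Exchange σ)
    (hZ : ∀ s u b m, Commute (PowerSeries.coeff b (T.Ep s)) (T.Z u m)) {s u : S} {a : ℕ} {x μ : ℂ}
    {F G F' G' : ℂ⟦X⟧} (hF : F' * σ s s = F)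
    (hG : PowerSeries.rescale μ⁻¹ G' * σ s u = PowerSeries.rescale μ⁻¹ G)
    (hG' : PowerSeries.rescale μ G' * σ u s = PowerSeries.rescale μ G)
    (h : SerreRel a x μ F G (T.x s) (T.x u)) : SerreRel a x μ F' G' (T.Z s) (T.Z u) := by
  let sp : Option (Fin a) → S := fun y => y.elim u fun _ => s
  -- The factor is determined by which of the two variables is `w = none`; the pair `(none, none)`
  -- never occurs.
  let Wt : ℂ⟦X⟧ → ℂ⟦X⟧ → Option (Fin a) → Option (Fin a) → ℂ⟦X⟧ := fun F G y y' =>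
    y.elim (PowerSeries.rescale μ⁻¹ G) fun _ => y'.elim (PowerSeries.rescale μ G) fun _ => F
  let P : Equiv.Perm (Fin a) → ℕ → List (Option (Fin a) × Option (Fin a)) := fun τ r =>
    (((List.finRange a).product (List.finRange a)).filter fun y => y.1 < y.2).map
      (fun y => (some (τ y.2), some (τ y.1))) ++
    ((List.finRange a).take r).map (fun q => (none, some (τ q))) ++
    ((List.finRange a).drop r).map (fun q => (some (τ q), none))
  let L : Equiv.Perm (Fin a) → ℕ → List (Option (Fin a)) := fun τ r =>
    ((List.finRange a).take r).map (fun q => some (τ q)) ++ none ::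
      ((List.finRange a).drop r).map (fun q => some (τ q))
  -- A reference order: by permutation invariance, all summands, whatever their `τ` and `r`, are
  -- dressed by one and the same operation.
  let L₀ : List (Option (Fin a)) := none :: (List.finRange a).map some
  have hLL : ∀ τ r, (L τ r).Perm L₀ := by
    intro τ r
    refine List.perm_middle.trans (List.Perm.cons _ ?_)
    rw [← List.map_append, List.take_append_drop]
    refine (List.perm_ext_iff_of_nodup ((List.nodup_finRange a).map fun _ _ h =>
      τ.injective (Option.some_injective _ h)) ((List.nodup_finRange a).map
        (Option.some_injective _))).mpr fun p => ?_
    simp only [List.mem_map, List.mem_finRange, true_and]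
    exact ⟨fun ⟨q, hq⟩ => ⟨τ q, hq⟩, fun ⟨q, hq⟩ => ⟨τ.symm q, by simpa using hq⟩⟩
  have hL₀ : L₀.Nodup := List.nodup_cons.mpr ⟨by simp, (List.nodup_finRange a).map
    (Option.some_injective _)⟩
  have hL : ∀ τ r, (L τ r).Nodup := fun τ r => (hLL τ r).nodup_iff.mpr hL₀
  have hP : ∀ τ r, (P τ r).Perm (varPairs (L τ r)) := by
    intro τ r
    refine List.Perm.trans ?_ (varPairs_insert _ _ _).symm
    rw [← List.map_append, List.take_append_drop, varPairs_map, List.map_map, List.map_map]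
    refine List.Perm.append_right _ (List.Perm.append_right _ ?_)
    have := (varPairs_finRange a).map (Prod.map (fun q => some (τ q)) fun q => some (τ q))
    rwa [List.map_map] at this
  have hterm : ∀ (F G : ℂ⟦X⟧) (A : S → ℤ → Module.End ℂ V) τ r, mulRatios
        ((((List.finRange a).product (List.finRange a)).filter fun y => y.1 < y.2).map
            (fun y => (F, some (τ y.2), some (τ y.1))) ++
          ((List.finRange a).take r).map
            (fun s => (PowerSeries.rescale μ⁻¹ G, none, some (τ s))) ++
          ((List.finRange a).drop r).map
            (fun s => (PowerSeries.rescale μ G, some (τ s), none)))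
        (prodCurrents
          (((List.finRange a).take r).map (fun q => (some (τ q), A s)) ++ [(none, A u)] ++
            ((List.finRange a).drop r).map (fun q => (some (τ q), A s)))) =
      mulPairs (Wt F G) (P τ r) (prodOf sp A (L τ r)) := by
    intro F G A τ r
    rw [← mulRatios_map]
    simp only [P, L, prodOf, List.map_append, List.map_map, List.map_cons, List.append_assoc,
      List.singleton_append]
    rfl
  have hmem : ∀ p : Option (Fin a) × Option (Fin a), ∀ τ r, p ∈ P τ r →
      Wt F' G' p.1 p.2 * σ (sp p.2) (sp p.1) = Wt F G p.1 p.2 := by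
    intro p τ r hp
    simp only [P, List.mem_append, List.mem_map] at hp
    rcases hp with (⟨y, _, rfl⟩ | ⟨y, _, rfl⟩) | ⟨y, _, rfl⟩
    exacts [hF, hG, hG']
  have hdress : ∀ τ r, mulPairs (Wt F' G') (P τ r) (prodOf sp T.Z (L τ r)) =
      T.dressAll sp L₀ (mulPairs (Wt F G) (P τ r) (prodOf sp T.x (L τ r))) := fun τ r =>
    hT.mulPairs_prodOf_Z hσ hZ (hL τ r) (hLL τ r) (hP τ r) fun p hp => hmem p τ r hp
  -- The summands have different orders, hence different final segments; the total exponent is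
  -- common to all and suffices for the linearity of the dressing.
  have hadm : ∀ τ r, Adm {tot L₀} (mulPairs (Wt F G) (P τ r) (prodOf sp T.x (L τ r))) := by
    intro τ r
    refine ((adm_prodOf hT.grading hT.x_mem (L τ r)).mulPairs fun p hp =>
      posDir_varPairs (hL τ r) ((hP τ r).mem_iff.mp hp)).mono ?_
    rintro _ rfl
    rw [← tot_perm (hLL τ r)]
    exact tot_mem_finalTots (by simp [L])
  have hu : ∀ y ∈ L₀, PosDir {tot L₀} (Pi.single y 1) := fun y hy => posDir_tot_single hy
  have hx : ∑ y ∈ (Finset.univ : Finset (Equiv.Perm (Fin a))) ×ˢ Finset.range (a + 1),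
      ((-1 : ℂ) ^ y.2 * qBinom x a y.2) •
        mulPairs (Wt F G) (P y.1 y.2) (prodOf sp T.x (L y.1 y.2)) = 0 := by
    funext e
    rw [Finset.sum_product, Finset.sum_apply]
    simp only [Finset.sum_apply, Pi.smul_apply, ← hterm]
    exact h e
  intro e
  simp only [hterm, hdress]
  have h1 := congrArg (T.dressAll sp L₀) hx
  rw [dressAll_zero, hT.dressAll_sum _ (fun y _ => (hadm _ _).smul _) hu, Finset.sum_product] at h1
  have h2 := congrFun h1 e
  simp only [Finset.sum_apply, Pi.zero_apply] at h2
  refine (Finset.sum_congr rfl fun τ _ => Finset.sum_congr rfl fun r _ => ?_).trans h2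
  rw [hT.dressAll_smul (hadm τ r) hu, Pi.smul_apply]

end Dressing

end EllTor

end

noncomputable section

namespace EllTor

/-! ### Delta functions -/

section Delta

open Filter

/-- A nonzero scalar leaves the supports unchanged, so both sides fall into the same case of the
definition and no local finiteness has to be assumed. -/
theorem locSum_smul {V : Type*} [AddCommGroup V] [Module ℂ V] {ι : Type*} {r : ℂ} (hr : r ≠ 0)
    (F : ι → Module.End ℂ V) : locSum (fun i => r • F i) = r • locSum F := by
  have h : LocFin (fun i => r • F i) ↔ LocFin F := by
    refine forall_congr' fun v => ?_
    have : (Function.support fun i => (r • F i) v) = Function.support fun i => F i v := by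
      ext i
      simp [hr]
    rw [this]
  by_cases hF : LocFin F
  · ext v
    rw [locSum_apply (h.mpr hF), LinearMap.smul_apply, locSum_apply hF, smul_finsum' r (hF v)]
    rfl
  · rw [locSum, dif_neg (h.not.mpr hF), locSum, dif_neg hF, smul_zero]

section Scale

variable {R : Type*} [Ring R] [Algebra ℂ R]

/-- The series `E(rX)`. -/
def scaleSeries (r : ℂ) (E : R⟦X⟧) : R⟦X⟧ := PowerSeries.mk fun n => r ^ n • PowerSeries.coeff n E

theorem coeff_scaleSeries (r : ℂ) (E : R⟦X⟧) (n : ℕ) :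
    PowerSeries.coeff n (scaleSeries r E) = r ^ n • PowerSeries.coeff n E :=
  PowerSeries.coeff_mk _ _

theorem scaleSeries_expSeries (r : ℂ) (f : ℕ → R) :
    scaleSeries r (expSeries f) = expSeries fun n => r ^ n • f n := by
  have hp : ∀ j n, PowerSeries.coeff n (posPart (fun s => r ^ s • f s) ^ j) =
      r ^ n • PowerSeries.coeff n (posPart f ^ j) := by
    intro j
    induction j with
    | zero =>
      intro n
      simp only [pow_zero, PowerSeries.coeff_one]
      split_ifs with hn <;> simp [hn]
    | succ j ih =>
      intro n
      rw [pow_succ, pow_succ, PowerSeries.coeff_mul, PowerSeries.coeff_mul, Finset.smul_sum]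
      refine Finset.sum_congr rfl fun p hp => ?_
      rw [ih, coeff_posPart, coeff_posPart]
      split_ifs
      · simp
      · rw [smul_mul_smul_comm, ← pow_add, Finset.HasAntidiagonal.mem_antidiagonal.mp hp]
  ext n
  rw [coeff_scaleSeries, coeff_expSeries _ n.lt_succ_self, coeff_expSeries _ n.lt_succ_self,
    Finset.smul_sum]
  exact Finset.sum_congr rfl fun j _ => by rw [hp, smul_comm]

theorem expSeries_mul_mul {B : ℕ → R} (hB : ∀ m n, m ≠ 0 → n ≠ 0 → Commute (B m) (B n))
    {f g h : ℕ → ℂ} (hfgh : ∀ n, n ≠ 0 → f n + g n + h n = 0) :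
    expSeries (fun n => f n • B n) * expSeries (fun n => g n • B n) *
      expSeries (fun n => h n • B n) = 1 := by
  have hc : ∀ f g : ℕ → ℂ, ∀ m n, m ≠ 0 → n ≠ 0 → Commute (f m • B m) (g n • B n) :=
    fun f g m n hm hn => ((hB m n hm hn).smul_left _).smul_right _
  rw [← expSeries_add (hc f f) (hc g g) (hc f g)]
  simp only [← add_smul]
  rw [← expSeries_add (hc _ _) (hc h h) (hc _ h)]
  simp only [← add_smul]
  rw [expSeries_congr (g := fun _ => (0 : R)) fun n hn => by rw [hfgh n hn, zero_smul],
    expSeries_zero]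

end Scale

variable {V : Type*} [AddCommGroup V] [Module ℂ V]

theorem EvZero.scaleSeries {E : (Module.End ℂ V)⟦X⟧} (hE : EvZero E) (r : ℂ) :
    EvZero (scaleSeries r E) := fun v => by
  filter_upwards [hE v] with n hn
  rw [coeff_scaleSeries, LinearMap.smul_apply, hn, smul_zero]

/-- On the support of `δ(r w/z)` one has `z = r w`, so a series in `z` may be replaced by the
rescaled series in `w`. -/
theorem conv_zero_deltaW {r : ℂ} (hr : r ≠ 0) (E : (Module.End ℂ V)⟦X⟧) (B : ℤ → Module.End ℂ V) :
    conv E (Pi.single 0 1) (deltaW r B) = deltaW r (conv (scaleSeries r E) 1 B) := by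
  funext e
  rw [conv, deltaW, conv, ← locSum_smul (zpow_ne_zero _ hr)]
  congr 1
  funext a
  have h1 : (e + a • Pi.single (0 : Fin 2) (1 : ℤ) : Fin 2 → ℤ) 0 = e 0 + a := by simp
  have h2 : (e + a • Pi.single (0 : Fin 2) (1 : ℤ) : Fin 2 → ℤ) 1 = e 1 := by simp
  simp only [deltaW, coeff_scaleSeries, h1, h2]
  rw [smul_mul_assoc, mul_smul_comm, smul_smul, zpow_add₀ hr, zpow_natCast,
    show e 0 + a + e 1 = e 0 + e 1 + a • (1 : ℤ) by simp; ring]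

theorem conv_one_deltaW {r : ℂ} (hr : r ≠ 0) (E : (Module.End ℂ V)⟦X⟧) (B : ℤ → Module.End ℂ V) :
    conv E (Pi.single 1 1) (deltaW r B) = deltaW r (conv E 1 B) := by
  funext e
  rw [conv, deltaW, conv, ← locSum_smul (zpow_ne_zero _ hr)]
  congr 1
  funext a
  simp [deltaW, add_assoc]

/-- Here the series is in `z^{-1} = r^{-1} w^{-1}`, whence the inverse rescaling. -/
theorem rconv_zero_deltaW {r : ℂ} (hr : r ≠ 0) (E : (Module.End ℂ V)⟦X⟧)
    (B : ℤ → Module.End ℂ V) :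
    rconv E (-Pi.single 0 1) (deltaW r B) = deltaW r (rconv (scaleSeries r⁻¹ E) (-1) B) := by
  funext e
  rw [rconv, deltaW, rconv, ← locSum_smul (zpow_ne_zero _ hr)]
  congr 1
  funext a
  have h1 : (e + a • -Pi.single (0 : Fin 2) (1 : ℤ) : Fin 2 → ℤ) 0 = e 0 - a := by
    simp [sub_eq_add_neg]
  have h2 : (e + a • -Pi.single (0 : Fin 2) (1 : ℤ) : Fin 2 → ℤ) 1 = e 1 := by simp
  simp only [deltaW, coeff_scaleSeries, h1, h2]
  rw [smul_mul_assoc, mul_smul_comm, smul_smul, zpow_sub₀ hr, zpow_natCast, inv_pow, div_eq_mul_inv,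
    show e 0 - a + e 1 = e 0 + e 1 + a • (-1 : ℤ) by simp; ring]

theorem rconv_one_deltaW {r : ℂ} (hr : r ≠ 0) (E : (Module.End ℂ V)⟦X⟧)
    (B : ℤ → Module.End ℂ V) :
    rconv E (-Pi.single 1 1) (deltaW r B) = deltaW r (rconv E (-1) B) := by
  funext e
  rw [rconv, deltaW, rconv, ← locSum_smul (zpow_ne_zero _ hr)]
  congr 1
  funext a
  simp [deltaW, add_assoc]

theorem adm_deltaW {B : ℤ → Module.End ℂ V} (hB : Adm {AddMonoidHom.id ℤ} B) (r : ℂ) :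
    Adm {tot [(0 : Fin 2), 1]} (deltaW r B) := by
  rintro _ rfl v
  obtain ⟨C, hC⟩ := hB _ rfl v
  refine ⟨C, fun e he => ?_⟩
  rw [deltaW, LinearMap.smul_apply, hC _ (by simpa [tot] using he), smul_zero]

theorem adm_constCurrent (K : Module.End ℂ V) : Adm {AddMonoidHom.id ℤ} (constCurrent K) := by
  rintro _ rfl v
  refine ⟨0, fun e he => ?_⟩
  rw [constCurrent, if_neg (by rintro rfl; exact lt_irrefl _ he), LinearMap.zero_apply]

theorem posDir_id : PosDir {AddMonoidHom.id ℤ} (1 : ℤ) :=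
  ⟨by rintro _ rfl; exact zero_le_one, _, rfl, zero_lt_one⟩

/-- The modes of `K P(z) Q(z^{-1})`. -/
theorem locSum_eq_conv_rconv {K : Module.End ℂ V} {P Q : (Module.End ℂ V)⟦X⟧}
    (hK : ∀ a, Commute K (PowerSeries.coeff a P)) (hQ : EvZero Q) (n : ℤ) :
    (locSum fun y : ℕ × ℕ => if (y.2 : ℤ) - y.1 = n then
      K * PowerSeries.coeff y.1 P * PowerSeries.coeff y.2 Q else 0) =
    conv P 1 (rconv Q (-1) (constCurrent K)) n := by
  have hfin : ∀ v, ∀ᶠ N : ℕ in atTop, ∀ y : ℕ × ℕ, N ≤ y.1 ∨ N ≤ y.2 →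
      (if (y.2 : ℤ) - y.1 = n then
        K * PowerSeries.coeff y.1 P * PowerSeries.coeff y.2 Q else 0) v = 0 := by
    intro v
    obtain ⟨M, hM⟩ := (eventually_forall_le (hQ v)).exists
    -- The series `Q` bounds `y.2` by `M` on `v`, and the constraint `y.2 - y.1 = n` then bounds
    -- `y.1` by `M + |n|`.
    filter_upwards [eventually_ge_atTop (M + n.natAbs)] with N hN y hy
    split_ifs with h
    · rw [Module.End.mul_apply, hM _ (by omega), map_zero]
    · rfl
  have hL : LocFin fun y : ℕ × ℕ => if (y.2 : ℤ) - y.1 = n then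
      K * PowerSeries.coeff y.1 P * PowerSeries.coeff y.2 Q else 0 := by
    intro v
    obtain ⟨N, hN⟩ := (hfin v).exists
    refine (Finset.range N ×ˢ Finset.range N).finite_toSet.subset fun y hy => ?_
    by_contra h
    simp only [Finset.coe_product, Finset.coe_range, Set.mem_prod, Set.mem_Iio, not_and_or,
      not_lt] at h
    exact hy (hN y h)
  ext v
  obtain ⟨N, ⟨h1, h2⟩, h3⟩ := (((hfin v).and (rconv_apply (g := (-1 : ℤ)) hQ v)).and
    (((adm_constCurrent K).rconv (g := (-1 : ℤ)) hQ).conv_apply (E := P) posDir_id n v)).exists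
  rw [h3, locSum_apply hL]
  simp only [h2, map_sum]
  rw [← Finset.sum_product']
  refine (finsum_eq_sum_of_support_subset _ (s := Finset.range N ×ˢ Finset.range N)
    fun y hy => ?_).trans (Finset.sum_congr rfl fun y _ => ?_)
  · by_contra h
    simp only [Finset.coe_product, Finset.coe_range, Set.mem_prod, Set.mem_Iio, not_and_or,
      not_lt] at h
    exact hy (h1 y h)
  · rw [constCurrent]
    by_cases h : (y.2 : ℤ) - y.1 = n
    · rw [if_pos h, if_pos (by simp; omega), (hK _).eq]
      rfl
    · rw [if_neg h, if_neg (by simp; omega), LinearMap.zero_apply, LinearMap.zero_apply, map_zero]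

/-- On the support of `δ(r^{-1} w/z)` one has `w = r z`, so `B(r z)` may be read as `B(w)`. Both
delta terms of the commutator thus take the same form. -/
theorem deltaZ_scaleCurrent {r : ℂ} (hr : r ≠ 0) (B : ℤ → Module.End ℂ V) :
    deltaZ r⁻¹ (scaleCurrent r B) = deltaW r⁻¹ B := by
  funext e
  rw [deltaZ, scaleCurrent, deltaW, smul_smul, inv_zpow', inv_zpow', ← zpow_add₀ hr]
  congr 2
  ring

namespace Dressing

variable {S : Type*} {T : Dressing V S} {H : ℤ → Submodule ℂ (Module.End ℂ V)} {s u : S}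

/-- On the support everything becomes a product in the single variable `w`. The three series to the
left of `K` multiply to `1` by `hP1`, those to the right by `hQ1`. -/
theorem Compat.dressTwo_deltaW (hT : T.Compat H) {r : ℂ} (hr : r ≠ 0) (K : Module.End ℂ V)
    {P Q : (Module.End ℂ V)⟦X⟧} (hQ : EvZero Q) (hP1 : scaleSeries r (T.Em s) * T.Em u * P = 1)
    (hQ1 : Q * T.Ep u * scaleSeries r⁻¹ (T.Ep s) = 1) :
    T.dressTwo s u (deltaW r (conv P 1 (rconv Q (-1) (constCurrent K)))) =
      deltaW r (constCurrent K) := by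
  have hE := hT.evZero
  have h1 : T.dressTwo s u (deltaW r (conv P 1 (rconv Q (-1) (constCurrent K)))) =
      T.dress ![s, u] 0 (T.dress ![s, u] 1
        (deltaW r (conv P 1 (rconv Q (-1) (constCurrent K))))) := rfl
  have h2 : ∀ B, T.dress ![s, u] 1 (deltaW r B) =
      deltaW r (conv (T.Em u) 1 (rconv (T.Ep u) (-1) B)) := fun B => by
    rw [dress, rconv_one_deltaW hr, conv_one_deltaW hr]; rfl
  have h3 : ∀ B, T.dress ![s, u] 0 (deltaW r B) = deltaW r (conv (scaleSeries r (T.Em s)) 1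
      (rconv (scaleSeries r⁻¹ (T.Ep s)) (-1) B)) := fun B => by
    rw [dress, rconv_zero_deltaW hr, conv_zero_deltaW hr]; rfl
  have hK := adm_constCurrent K
  have hE' := (hE s).scaleSeries r⁻¹
  have hA1 := hK.rconv (g := (-1 : ℤ)) hQ
  have hA2 := hA1.rconv (g := (-1 : ℤ)) (hE u)
  have hA3 := hA2.rconv (g := (-1 : ℤ)) hE'
  rw [h1, h2, h3, ← conv_rconv_comm hA1 posDir_id (hE u),
    ← conv_rconv_comm (hA2.conv posDir_id) posDir_id hE',
    ← conv_rconv_comm hA2 posDir_id hE', ← rconv_mul (hE u) hQ, ← rconv_mul hE' ((hE u).mul hQ),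
    hQ1, rconv_one, ← conv_mul hK posDir_id, ← conv_mul hK posDir_id, ← mul_assoc, hP1,
    conv_one hK posDir_id]

/-- A relation `[x_s(z), x_u(w)] = D` for currents, for dressed currents. -/
theorem Compat.commutator_relation (hT : T.Compat H) {σ : S → S → ℂ⟦X⟧} (hσ : T.Exchange σ)
    (hZ : ∀ s u b m, Commute (PowerSeries.coeff b (T.Ep s)) (T.Z u m)) {F F' : ℂ⟦X⟧}
    (hF : F * σ s u = 1) (hF' : F' * σ u s = 1) :
    mulRatio F 1 0 (prodCurrents [((0 : Fin 2), T.Z s), (1, T.Z u)]) -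
        mulRatio F' 0 1 (prodCurrents [((1 : Fin 2), T.Z u), (0, T.Z s)]) =
      T.dressTwo s u (prodCurrents [((0 : Fin 2), T.x s), (1, T.x u)] -
        prodCurrents [((1 : Fin 2), T.x u), (0, T.x s)]) := by
  have hd : PosDir (finalTots [(0 : Fin 2), 1]) (ratioDir (1, 0)) :=
    posDir_varPairs (by decide) (by simp [varPairs])
  have hd' : PosDir (finalTots [(1 : Fin 2), 0]) (ratioDir (0, 1)) :=
    posDir_varPairs (by decide) (by simp [varPairs])
  have hA := adm_prodOf (sp := ![s, u]) hT.grading hT.x_mem [0, 1]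
  have hA' := adm_prodOf (sp := ![s, u]) hT.grading hT.x_mem [1, 0]
  have hs : (scal 1 : (Module.End ℂ V)⟦X⟧) = 1 := map_one _
  have h1 : mulRatio 1 1 0 (prodCurrents [((0 : Fin 2), T.x s), (1, T.x u)]) =
      prodCurrents [((0 : Fin 2), T.x s), (1, T.x u)] := by
    rw [mulRatio_eq_conv, hs]; exact conv_one hA hd
  have h2 : mulRatio 1 0 1 (prodCurrents [((1 : Fin 2), T.x u), (0, T.x s)]) =
      prodCurrents [((1 : Fin 2), T.x u), (0, T.x s)] := by
    rw [mulRatio_eq_conv, hs]; exact conv_one hA' hd'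
  have h3 := hT.adm_two (s := s) (u := u) 1
  have h4 := hT.adm_two' (s := s) (u := u) 1
  rw [hT.mulRatio_Z_Z hσ hZ hF, hT.mulRatio_Z_Z' hσ hZ hF', ← hT.dressTwo_sub h3 h4, h1, h2]

end Dressing

end Delta

/-! ### Infinite products as exponentials -/

section Products

open Filter

theorem one_sub_pow_ne_zero {s : ℂ} (hs : ‖s‖ < 1) {n : ℕ} (hn : n ≠ 0) : 1 - s ^ n ≠ 0 := by
  intro h
  have h1 : ‖s ^ n‖ = 1 := by rw [← sub_eq_zero.mp h, norm_one]
  rw [norm_pow] at h1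
  exact (pow_lt_one₀ (norm_nonneg s) hs hn).ne h1

/-- The Euler equation holds because `-∑_{n ≥ 1} y ^ n X ^ n`, multiplied by `1 - y X`, telescopes
to `-y X`. -/
theorem expSeries_log (y : ℂ) :
    expSeries (fun n => -(y ^ n / n)) = 1 - PowerSeries.C y * PowerSeries.X := by
  symm
  refine eq_expSeries (fun _ _ _ _ => Commute.all _ _) (by simp) ?_
  ext n
  rw [coeff_euler, euler_posPart, mul_sub, mul_one, map_sub, mul_left_comm,
    PowerSeries.coeff_C_mul, map_sub, PowerSeries.coeff_C_mul]
  rcases n with _ | _ | n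
  · simp
  · simp [PowerSeries.coeff_succ_mul_X, coeff_posPart, PowerSeries.coeff_one]
  · have h1 : ((n : ℂ) + 1 + 1) ≠ 0 := by exact_mod_cast (n + 1).succ_ne_zero
    have h2 : ((n : ℂ) + 1) ≠ 0 := by exact_mod_cast n.succ_ne_zero
    rw [PowerSeries.coeff_succ_mul_X, coeff_posPart, coeff_posPart, PowerSeries.coeff_one,
      PowerSeries.coeff_X]
    simp only [Nat.add_eq_zero_iff, one_ne_zero, and_false, if_false, nsmul_eq_mul, Nat.cast_add,
      Nat.cast_one, show n + 1 + 1 ≠ 1 by omega]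
    field_simp
    ring

/-- The exponential `E` on the right satisfies `E(X) = (1 - y X) E(s X)`. Iteration gives `E(X)` as
the `M`-th partial product times `E(s ^ M X)`, and the last factor tends to `1` coefficientwise
since `|s| < 1`. -/
theorem qPoch_eq_expSeries {s : ℂ} (hs : ‖s‖ < 1) (y : ℂ) :
    qPoch s y = expSeries fun n => -(y ^ n / (n * (1 - s ^ n))) := by
  have hstep : ∀ y : ℂ, expSeries (fun n => -(y ^ n / (n * (1 - s ^ n)))) =
      (1 - PowerSeries.C y * PowerSeries.X) *
        expSeries fun n => -((y * s) ^ n / (n * (1 - s ^ n))) := by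
    intro y
    rw [← expSeries_log, ← expSeries_add (fun _ _ _ _ => Commute.all _ _)
      (fun _ _ _ _ => Commute.all _ _) (fun _ _ _ _ => Commute.all _ _)]
    refine expSeries_congr fun n hn => ?_
    have h1 := one_sub_pow_ne_zero hs hn
    have h2 : (n : ℂ) ≠ 0 := Nat.cast_ne_zero.mpr hn
    rw [mul_pow]
    field_simp
    ring
  have hiter : ∀ M : ℕ, expSeries (fun n => -(y ^ n / (n * (1 - s ^ n)))) =
      (∏ r ∈ Finset.range M, (1 - PowerSeries.C (y * s ^ r) * PowerSeries.X)) *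
        PowerSeries.rescale (s ^ M) (expSeries fun n => -(y ^ n / (n * (1 - s ^ n)))) := by
    intro M
    rw [rescale_expSeries]
    have h0 : ∀ M : ℕ, (expSeries fun n => (s ^ M) ^ n * -(y ^ n / (n * (1 - s ^ n)))) =
        expSeries fun n => -((y * s ^ M) ^ n / (n * (1 - s ^ n))) := fun M =>
      expSeries_congr fun n _ => by rw [mul_pow]; ring
    induction M with
    | zero => simp
    | succ M ih =>
      rw [Finset.prod_range_succ, ih, h0, h0, hstep (y * s ^ M), mul_assoc y (s ^ M) s, ← pow_succ,
        mul_assoc]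
  ext n
  refine tendsto_nhds_unique (qPoch_tendsto s y hs n) ?_
  set E := expSeries fun n => -(y ^ n / (n * (1 - s ^ n))) with hE
  -- The error of the `M`-th partial product is its product with `E(s ^ M X) - 1`: the first factor
  -- has convergent coefficients, those of the second tend to `0`.
  have hlim : Tendsto (fun M : ℕ => ∑ p ∈ Finset.HasAntidiagonal.antidiagonal n,
      PowerSeries.coeff p.1 (∏ r ∈ Finset.range M,
        (1 - PowerSeries.C (y * s ^ r) * PowerSeries.X)) *
      ((s ^ p.2) ^ M * PowerSeries.coeff p.2 E - PowerSeries.coeff p.2 (1 : ℂ⟦X⟧)))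
      atTop (nhds 0) := by
    rw [show (0 : ℂ) = ∑ p ∈ Finset.HasAntidiagonal.antidiagonal n,
      PowerSeries.coeff p.1 (qPoch s y) * 0 by simp]
    refine tendsto_finsetSum _ fun p _ => (qPoch_tendsto s y hs p.1).mul ?_
    rcases Nat.eq_zero_or_pos p.2 with h | h
    · rw [h]; simp [hE]
    · have h1 : ‖s ^ p.2‖ < 1 := by
        rw [norm_pow]; exact pow_lt_one₀ (norm_nonneg s) hs h.ne'
      have := (tendsto_pow_atTop_nhds_zero_of_norm_lt_one h1).mul_const (PowerSeries.coeff p.2 E)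
      simpa [PowerSeries.coeff_one, h.ne'] using this
  have h2 : ∀ M : ℕ, PowerSeries.coeff n (∏ r ∈ Finset.range M,
        (1 - PowerSeries.C (y * s ^ r) * PowerSeries.X)) = PowerSeries.coeff n E -
      ∑ p ∈ Finset.HasAntidiagonal.antidiagonal n, PowerSeries.coeff p.1 (∏ r ∈ Finset.range M,
        (1 - PowerSeries.C (y * s ^ r) * PowerSeries.X)) *
      ((s ^ p.2) ^ M * PowerSeries.coeff p.2 E - PowerSeries.coeff p.2 (1 : ℂ⟦X⟧)) := by
    intro M
    have h3 : ∀ p : ℕ × ℕ, (s ^ p.2) ^ M * PowerSeries.coeff p.2 E =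
        PowerSeries.coeff p.2 (PowerSeries.rescale (s ^ M) E) := fun p => by
      rw [PowerSeries.coeff_rescale, ← pow_mul, ← pow_mul, mul_comm M]
    simp only [h3, mul_sub, Finset.sum_sub_distrib, ← PowerSeries.coeff_mul, mul_one]
    rw [← hiter M]
    ring
  simp only [h2]
  simpa using (tendsto_const_nhds (x := PowerSeries.coeff n E)).sub hlim

theorem qRatio_eq_expSeries {s : ℂ} (hs : ‖s‖ < 1) (x y : ℂ) :
    qRatio s x y = expSeries fun n => (y ^ n - x ^ n) / (n * (1 - s ^ n)) := by
  rw [qRatio, qPoch_eq_expSeries hs, qPoch_eq_expSeries hs, expSeries_inv,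
    ← expSeries_add (fun _ _ _ _ => Commute.all _ _) (fun _ _ _ _ => Commute.all _ _)
      (fun _ _ _ _ => Commute.all _ _)]
  exact expSeries_congr fun n _ => by ring

end Products

end EllTor

end

noncomputable section

namespace EllTor

/-! ### Parameters and the Cartan matrix -/

namespace Params

variable (c : Params)

theorem qpow_ne_zero (x : ℂ) : c.qpow x ≠ 0 := Complex.exp_ne_zero _

theorem qpow_neg (x : ℂ) : c.qpow (-x) = (c.qpow x)⁻¹ := by
  rw [qpow, mul_neg, Complex.exp_neg, qpow]

theorem qpow_add (x y : ℂ) : c.qpow (x + y) = c.qpow x * c.qpow y := by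
  rw [qpow, mul_add, Complex.exp_add, qpow, qpow]

theorem qpow_mul_intCast (x : ℂ) (n : ℤ) : c.qpow (x * n) = c.qpow x ^ n := by
  rw [qpow, qpow, ← Complex.exp_int_mul]
  congr 1
  ring

theorem qpow_mul_natCast (x : ℂ) (n : ℕ) : c.qpow (x * n) = c.qpow x ^ n := by
  exact_mod_cast c.qpow_mul_intCast x n

theorem qpow_two_mul (x : ℂ) : c.qpow (2 * x) = c.qpow x ^ 2 := by
  rw [two_mul, qpow_add, sq]

theorem p_eq : c.p = c.pst * c.qpow c.k ^ 2 := by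
  have h := c.qpow_ne_zero c.k
  rw [pst, neg_mul, qpow_neg, qpow_two_mul]
  field_simp

end Params

namespace SimpleType

variable (t : SimpleType)

theorem dNat_pos (i : ℕ) : 0 < t.dNat i := by
  cases t <;> simp only [dNat] <;> (try split_ifs) <;> norm_num

/-- For each type the `d_i` take at most one value other than `1`. Hence the division of natural
numbers in the Cartan matrix is exact. -/
theorem dNat_dvd_max (i j : ℕ) : t.dNat i ∣ max (t.dNat i) (t.dNat j) := by
  cases t <;> simp only [dNat] <;> (try split_ifs) <;> norm_num

/-- Off the diagonal, for adjacent nodes, the entry is `-bond * max (d_i) (d_j)`, which is visibly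
symmetric. -/
theorem b_comm (i j : t.Idx) : t.b j i = t.b i j := by
  by_cases h : i = j
  · rw [h]
  · have hi : ∀ i j : t.Idx, (t.d i : ℤ) * -((t.bond * (max (t.d i) (t.d j) / t.d i) : ℕ) : ℤ) =
        -(t.bond * max (t.d i) (t.d j) : ℕ) := fun i j => by
      obtain ⟨r, hr⟩ := t.dNat_dvd_max i j
      simp only [d]
      rw [hr, Nat.mul_div_cancel_left _ (t.dNat_pos i)]
      push_cast
      ring
    simp only [b, a, if_neg h, if_neg (Ne.symm h), min_comm (j : ℕ), max_comm (j : ℕ)]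
    split_ifs
    · rw [hi, hi, max_comm]
    · simp

theorem m_comm (i j : t.Idx) : t.m j i = -t.m i j := by
  cases t
  case A N hN =>
    change (if j = i + 1 then (1 : ℤ) else 0) - (if j + 1 = i then 1 else 0) =
      -((if i = j + 1 then (1 : ℤ) else 0) - (if i + 1 = j then 1 else 0))
    rw [neg_sub]
    simp only [eq_comm]
  all_goals exact neg_zero.symm

theorem m_self (i : t.Idx) : t.m i i = 0 := by
  have := t.m_comm i i
  omega

end SimpleType

namespace GenOps

variable (t : SimpleType) (c : Params)

theorem qi_sub_inv_ne_zero (hq : ∀ n : ℤ, n ≠ 0 → c.qpow n ≠ 1) (i : t.Idx) :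
    qi t c i - (qi t c i)⁻¹ ≠ 0 := by
  intro h
  have h0 : qi t c i ≠ 0 := c.qpow_ne_zero _
  have h1 : qi t c i * qi t c i = 1 := by
    conv_lhs => rw [sub_eq_zero.mp h]
    rw [inv_mul_eq_iff_eq_mul₀ h0, mul_one, ← sub_eq_zero.mp h]
  refine hq (2 * t.d i) (mul_ne_zero two_ne_zero (Nat.cast_ne_zero.mpr (t.dNat_pos i).ne')) ?_
  rw [← h1, qi, ← c.qpow_add]
  push_cast
  congr 1
  ring

theorem q_sub_inv_ne_zero (hq : ∀ n : ℤ, n ≠ 0 → c.qpow n ≠ 1) : c.q - c.q⁻¹ ≠ 0 := by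
  intro h
  have h0 : c.q ≠ 0 := c.qpow_ne_zero _
  have h1 : c.q * c.q = 1 := by
    conv_lhs => rw [sub_eq_zero.mp h]
    rw [inv_mul_eq_iff_eq_mul₀ h0, mul_one, ← sub_eq_zero.mp h]
  refine hq 2 two_ne_zero ?_
  rw [← h1, Params.q, ← c.qpow_add]
  norm_num

theorem qInt_q (i : t.Idx) :
    qInt c.q (t.d i) = (qi t c i - (qi t c i)⁻¹) / (c.q - c.q⁻¹) := by
  rw [qInt, zpow_neg, qi, Params.q, ← c.qpow_mul_intCast]
  simp

theorem qInt_qi (i j : t.Idx) (n : ℤ) : qInt (qi t c i) (t.a i j * n) =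
    (c.qpow (t.b i j) ^ n - (c.qpow (t.b i j) ^ n)⁻¹) / (qi t c i - (qi t c i)⁻¹) := by
  rw [qInt, zpow_neg, zpow_mul, qi, ← c.qpow_mul_intCast _ (t.a i j), SimpleType.b]
  push_cast
  rfl

end GenOps

end EllTor

end

noncomputable section

namespace EllTor

/-! ### The Heisenberg data of a representation -/

namespace GenOps

variable {t : SimpleType} (c : Params)

/-- The coefficient of `α^∨_{i,n}` in the exponents of the vertex operators that dress `x^+_i(z)`
(for `true`) and `x^-_i(z)` (for `false`). -/
def dressCoef (s : t.Idx × Bool) (n : ℤ) : ℂ :=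
  (qi t c s.1 - (qi t c s.1)⁻¹) / (c.qpow c.k ^ n - (c.qpow c.k ^ n)⁻¹) *
    bif s.2 then 1 else -((1 - c.pst ^ n) / (1 - c.p ^ n) * c.qpow c.k ^ n)

/-- The commutator of `α^∨_{i,n}` and `α^∨_{j,-n}`. -/
def heisCoef (i j : t.Idx) (n : ℤ) : ℂ :=
  (c.qpow (t.b i j) ^ n - (c.qpow (t.b i j) ^ n)⁻¹) / (qi t c i - (qi t c i)⁻¹) / n *
    ((c.qpow c.k ^ n - (c.qpow c.k ^ n)⁻¹) / (qi t c j - (qi t c j)⁻¹)) *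
    ((1 - c.p ^ n) / (1 - c.pst ^ n)) * (c.κ ^ (-t.m i j)) ^ n * (c.qpow c.k ^ n)⁻¹

/-- The coefficient in the commutator of `α^∨_{i,n}` and `x^±_j(z)`. -/
def currentCoef (i : t.Idx) (s : t.Idx × Bool) (n : ℤ) : ℂ :=
  (c.qpow (t.b i s.1) ^ n - (c.qpow (t.b i s.1) ^ n)⁻¹) / (qi t c i - (qi t c i)⁻¹) / n *
    (c.κ ^ (-t.m i s.1)) ^ n *
    bif s.2 then (1 - c.p ^ n) / (1 - c.pst ^ n) * (c.qpow c.k ^ n)⁻¹ else -1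

/-! ### Identities between the structure constants -/

section Scalars

variable {c}

theorem one_sub_sq_ne_zero (hq2k : ‖c.qpow (2 * c.k)‖ < 1) {n : ℕ} (hn : n ≠ 0) :
    1 - (c.qpow c.k ^ n) ^ 2 ≠ 0 := by
  rw [c.qpow_two_mul] at hq2k
  rw [← pow_mul, mul_comm n, pow_mul]
  exact one_sub_pow_ne_zero hq2k hn

/-- The vertex operators are chosen such that their commutators with `α^∨_{i,n}` cancel those of
the currents. -/
theorem dressCoef_mul_heisCoef (hq : ∀ n : ℤ, n ≠ 0 → c.qpow n ≠ 1) (hp : c.p ≠ 0)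
    (hp1 : ‖c.p‖ < 1) (hps : ‖c.pst‖ < 1) (hq2k : ‖c.qpow (2 * c.k)‖ < 1)
    (i : t.Idx) (s : t.Idx × Bool) {n : ℤ} (hn : n ≠ 0) :
    dressCoef c s (-n) * heisCoef c i s.1 n + currentCoef c i s n = 0 := by
  obtain ⟨j, e⟩ := s
  have hi := qi_sub_inv_ne_zero t c hq i
  have hj := qi_sub_inv_ne_zero t c hq j
  have hQ0 := c.qpow_ne_zero c.k
  have hpQ := c.p_eq
  have hpst : c.pst ≠ 0 := fun h => hp (by rw [hpQ, h, zero_mul])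
  have hQ : ∀ n : ℤ, n ≠ 0 → c.qpow c.k ^ n - (c.qpow c.k ^ n)⁻¹ ≠ 0 ∧ 1 - c.p ^ n ≠ 0 ∧
      1 - c.pst ^ n ≠ 0 := by
    have h0 : ∀ (x : ℂ), x ≠ 0 → ∀ n : ℕ, 1 - x ^ n ≠ 0 → 1 - (x ^ n)⁻¹ ≠ 0 := by
      intro x hx n h h'
      rw [sub_eq_zero, eq_comm, inv_eq_one, eq_comm] at h'
      exact h (sub_eq_zero.mpr h')
    have h1 : ∀ n : ℕ, n ≠ 0 → c.qpow c.k ^ n - (c.qpow c.k ^ n)⁻¹ ≠ 0 := by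
      intro n hn h
      refine one_sub_sq_ne_zero hq2k hn ?_
      have h2 := pow_ne_zero n hQ0
      field_simp at h
      linear_combination -h
    intro n hn
    obtain ⟨m, rfl | rfl⟩ := n.eq_nat_or_neg
    · simp only [zpow_natCast]
      exact ⟨h1 m (by omega), one_sub_pow_ne_zero hp1 (by omega),
        one_sub_pow_ne_zero hps (by omega)⟩
    · simp only [zpow_neg, zpow_natCast, inv_inv]
      exact ⟨by rw [← neg_sub]; exact neg_ne_zero.mpr (h1 m (by omega)),
        h0 _ hp _ (one_sub_pow_ne_zero hp1 (by omega)),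
        h0 _ hpst _ (one_sub_pow_ne_zero hps (by omega))⟩
  obtain ⟨h1, h2, h3⟩ := hQ n hn
  obtain ⟨h1', h2', h3'⟩ := hQ (-n) (neg_ne_zero.mpr hn)
  have hx := zpow_ne_zero n hQ0
  have hS := zpow_ne_zero n hpst
  have hP : c.p ^ n = c.pst ^ n * (c.qpow c.k ^ n) ^ 2 := by
    rw [hpQ, mul_zpow, sq, sq, mul_zpow]
  have hnC : (n : ℂ) ≠ 0 := Int.cast_ne_zero.mpr hn
  simp only [dressCoef, heisCoef, currentCoef]
  rw [zpow_neg] at h1' h2' h3'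
  rw [zpow_neg, zpow_neg, zpow_neg]
  -- With `x = q^{kn}`, `S = p^{*n}` and `p^n = S x^2`, what remains is an identity of rational
  -- functions.
  generalize c.qpow c.k ^ n = x at *
  generalize c.pst ^ n = S at *
  generalize c.p ^ n = P at *
  subst hP
  generalize c.qpow (t.b i j) ^ n - (c.qpow (t.b i j) ^ n)⁻¹ = y at *
  generalize (c.κ ^ (-t.m i j)) ^ n = z at *
  generalize qi t c i - (qi t c i)⁻¹ = wi at *
  generalize qi t c j - (qi t c j)⁻¹ = wj at *
  rw [inv_inv] at h1' ⊢
  have e1 : wj / (x⁻¹ - x) = -(wj / (x - x⁻¹)) := by rw [← neg_sub, div_neg]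
  have e2 : wj / (x - x⁻¹) * (y / wi / n * ((x - x⁻¹) / wj)) = y / wi / n := by
    generalize x - x⁻¹ = r at h1
    field_simp
  cases e
  -- The normalisation of `α'` at `-n` is inverse to the elliptic factor of the Heisenberg relation
  -- at `n`. Accordingly the commutator of `α^∨` with `x^-` has no elliptic factor.
  · have e3 : (1 - S⁻¹) / (1 - (S * x ^ 2)⁻¹) * x⁻¹ *
        ((1 - S * x ^ 2) / (1 - S) * x⁻¹) = 1 := by
      have h4 : S * x ^ 2 - 1 ≠ 0 := by rw [← neg_sub]; exact neg_ne_zero.mpr h2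
      have e4 : 1 - (S * x ^ 2)⁻¹ = (S * x ^ 2 - 1) / (S * x ^ 2) := by field_simp
      have e5 : 1 - S⁻¹ = (S - 1) / S := by field_simp
      rw [e4, e5]
      field_simp
      ring
    simp only [cond_false]
    rw [e1]
    linear_combination (y / wi / n * z) * e3 + ((1 - S⁻¹) / (1 - (S * x ^ 2)⁻¹) * x⁻¹ *
        ((1 - S * x ^ 2) / (1 - S) * x⁻¹) * z) * e2
  · simp only [cond_true]
    rw [e1]
    linear_combination -((1 - S * x ^ 2) / (1 - S) * z * x⁻¹) * e2

/-- The exponents of the exchange factors of currents and vertex operators, at `κ = 1`. -/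
def exchangeCoef (c : Params) (b : ℤ) (e e' : Bool) (n : ℕ) : ℂ :=
  (c.qpow b ^ n - (c.qpow b ^ n)⁻¹) / (n * (1 - (c.qpow c.k ^ n) ^ 2)) *
    match e, e' with
    | true, true => -((1 - c.p ^ n) / (1 - c.pst ^ n))
    | false, false => -((c.qpow c.k ^ n) ^ 2 * ((1 - c.pst ^ n) / (1 - c.p ^ n)))
    | _, _ => c.qpow c.k ^ n

/-- Both the sign of the mode `-n` and the antisymmetry of `m` invert the power of `κ`, so
`κ^{-m_{ij}}` results; symmetry of `b` removes the remaining asymmetry between `i` and `j`. -/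
theorem exchangeCoef_eq (hq : ∀ n : ℤ, n ≠ 0 → c.qpow n ≠ 1) (hp : c.p ≠ 0)
    (hp1 : ‖c.p‖ < 1) (hps : ‖c.pst‖ < 1) (hq2k : ‖c.qpow (2 * c.k)‖ < 1)
    (i j : t.Idx) (e e' : Bool) {n : ℕ} (hn : n ≠ 0) :
    -(dressCoef c (j, e') (-n) * currentCoef c j (i, e) (-n)) =
      (c.κ ^ (-t.m i j)) ^ n * exchangeCoef c (t.b i j) e e' n := by
  have hj := qi_sub_inv_ne_zero t c hq j
  have hQ0 := c.qpow_ne_zero c.k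
  have hpQ := c.p_eq
  have hpst : c.pst ≠ 0 := fun h => hp (by rw [hpQ, h, zero_mul])
  have h1 := one_sub_sq_ne_zero hq2k hn
  have h2 := one_sub_pow_ne_zero hp1 hn
  have h3 := one_sub_pow_ne_zero hps hn
  have hx := pow_ne_zero n hQ0
  have hS := pow_ne_zero n hpst
  have hP : c.p ^ n = c.pst ^ n * (c.qpow c.k ^ n) ^ 2 := by
    rw [hpQ, mul_pow, ← pow_mul, ← pow_mul, mul_comm n]
  have hnC : (n : ℂ) ≠ 0 := Nat.cast_ne_zero.mpr hn
  have hκ : (c.κ ^ (t.m i j)) ^ (-(n : ℤ)) = (c.κ ^ (-t.m i j)) ^ n := by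
    rw [zpow_neg, zpow_neg, zpow_natCast, inv_pow]
  simp only [dressCoef, currentCoef, exchangeCoef]
  rw [t.m_comm i j, neg_neg, hκ, t.b_comm i j]
  simp only [zpow_neg, zpow_natCast, inv_inv, Int.cast_neg, Int.cast_natCast]
  generalize (c.κ ^ t.m i j)⁻¹ ^ n = z at *
  generalize c.qpow c.k ^ n = x at *
  generalize c.pst ^ n = S at *
  generalize c.p ^ n = P at *
  subst hP
  generalize qi t c j - (qi t c j)⁻¹ = w at *
  generalize c.qpow (t.b i j) ^ n = y at *
  have e1 : x⁻¹ - x = (1 - x ^ 2) / x := by field_simp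
  have e2 : w / (x⁻¹ - x) * ((y⁻¹ - y) / w / -n) = (y - y⁻¹) / (n * (1 - x ^ 2)) * x := by
    rw [e1, ← neg_sub y]
    generalize y - y⁻¹ = Y
    generalize 1 - x ^ 2 = X at h1
    field_simp
  have h4 : S * x ^ 2 - 1 ≠ 0 := by rw [← neg_sub]; exact neg_ne_zero.mpr h2
  have h5 : S - 1 ≠ 0 := by rw [← neg_sub]; exact neg_ne_zero.mpr h3
  have e4 : 1 - (S * x ^ 2)⁻¹ = (1 - S * x ^ 2) / -(S * x ^ 2) := by field_simp; ring
  have e5 : 1 - S⁻¹ = (1 - S) / -S := by field_simp; ring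
  have e6 : (1 - (S * x ^ 2)⁻¹) / (1 - S⁻¹) = (1 - S * x ^ 2) / (1 - S) / x ^ 2 := by
    rw [e4, e5]; field_simp
  have e7 : (1 - S⁻¹) / (1 - (S * x ^ 2)⁻¹) = (1 - S) / (1 - S * x ^ 2) * x ^ 2 := by
    rw [e4, e5]; field_simp
  have key : ∀ u v r : ℂ, -(x * u * v) = r →
      -(w / (x⁻¹ - x) * u * ((y⁻¹ - y) / w / -n * z * v)) =
        z * ((y - y⁻¹) / (n * (1 - x ^ 2)) * r) := by
    rintro u v r rfl
    linear_combination -(u * z * v) * e2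
  rw [e6, e7]
  refine key _ _ _ ?_
  generalize 1 - S * x ^ 2 = X at h2
  generalize 1 - S = Y at h3
  cases e <;> cases e' <;> simp only [cond_true, cond_false] <;> field_simp

/-- All identities between scalar series below reduce through this lemma to one identity of
exponents for each `n ≥ 1`. -/
theorem rescale_qRatio_mul {s : ℂ} (hs : ‖s‖ < 1) (μ x y : ℂ) {f g : ℕ → ℂ}
    (h : ∀ n, n ≠ 0 → (y ^ n - x ^ n) / (n * (1 - s ^ n)) + f n = g n) :
    PowerSeries.rescale μ (qRatio s x y) * expSeries (fun n => μ ^ n * f n) =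
      PowerSeries.rescale μ (expSeries g) := by
  rw [← rescale_expSeries, ← map_mul, qRatio_eq_expSeries hs,
    ← expSeries_add (fun _ _ _ _ => Commute.all _ _) (fun _ _ _ _ => Commute.all _ _)
      (fun _ _ _ _ => Commute.all _ _), expSeries_congr h]

theorem gSer_eq (c : Params) (b : ℤ) (s : ℂ) : gSer c b s = expSeries fun n =>
    -((c.qpow b ^ n - (c.qpow b ^ n)⁻¹) / n * (s ^ n / (1 - s ^ n))) := by
  rw [gSer]
  refine expSeries_congr fun n _ => ?_
  rw [c.qpow_neg, c.qpow_mul_natCast]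
  ring

theorem gSer_inv_eq (c : Params) (b : ℤ) (s : ℂ) : (gSer c b s)⁻¹ = expSeries fun n =>
    (c.qpow b ^ n - (c.qpow b ^ n)⁻¹) / n * (s ^ n / (1 - s ^ n)) := by
  rw [gSer_eq, expSeries_inv]
  simp only [neg_neg]

/-- The exchange factors of currents and vertex operators. -/
def exchangeSeries (c : Params) (s u : t.Idx × Bool) : ℂ⟦X⟧ := expSeries fun n =>
  (c.κ ^ (-t.m s.1 u.1)) ^ n * exchangeCoef c (t.b s.1 u.1) s.2 u.2 n

section Series

theorem p_pow_eq (n : ℕ) : c.p ^ n = c.pst ^ n * (c.qpow c.k ^ n) ^ 2 := by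
  rw [c.p_eq, mul_pow, ← pow_mul, ← pow_mul, mul_comm n]

theorem qpow_two_pow (n : ℕ) : c.qpow (2 * c.k) ^ n = (c.qpow c.k ^ n) ^ 2 := by
  rw [c.qpow_two_mul, ← pow_mul, ← pow_mul, mul_comm n]

/-- The exponents match because `1 - (1 - p^n)/(1 - p^{*n}) = -p^{*n} (1 - q^{2kn})/(1 - p^{*n})`:
the denominator `1 - q^{2kn}` of the infinite products cancels and the exponent of `g_{ij}(·; p^*)`
remains. -/
theorem rescale_qRatio_mul_exchangeSeries_plus (hps : ‖c.pst‖ < 1)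
    (hq2k : ‖c.qpow (2 * c.k)‖ < 1) (i j : t.Idx) :
    PowerSeries.rescale (c.κ ^ (-t.m i j))
        (qRatio (c.qpow (2 * c.k)) (c.qpow (-(t.b i j))) (c.qpow (t.b i j))) *
      exchangeSeries c (i, true) (j, true) =
      PowerSeries.rescale (c.κ ^ (-t.m i j)) (gSer c (t.b i j) c.pst) := by
  rw [gSer_eq]
  refine rescale_qRatio_mul hq2k _ _ _ fun n hn => ?_
  have h1 := one_sub_sq_ne_zero hq2k hn
  have h3 := one_sub_pow_ne_zero hps hn
  have hn' : (n : ℂ) ≠ 0 := Nat.cast_ne_zero.mpr hn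
  rw [exchangeCoef, p_pow_eq, qpow_two_pow, c.qpow_neg, inv_pow]
  generalize c.qpow (t.b i j) ^ n - _ = y
  generalize c.qpow c.k ^ n = x at *
  generalize c.pst ^ n = S at *
  field_simp
  ring

/-- Here `q^{2kn} (1 - (1 - p^{*n})/(1 - p^n)) = p^n (1 - q^{2kn})/(1 - p^n)`, which leads to `p` in
place of `p^*` and to the inverse of `g_{ij}`. -/
theorem rescale_qRatio_mul_exchangeSeries_minus (hp1 : ‖c.p‖ < 1)
    (hq2k : ‖c.qpow (2 * c.k)‖ < 1) (i j : t.Idx) :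
    PowerSeries.rescale (c.κ ^ (-t.m i j))
        (qRatio (c.qpow (2 * c.k)) (c.qpow (-(t.b i j)) * c.qpow (2 * c.k))
          (c.qpow (t.b i j) * c.qpow (2 * c.k))) *
      exchangeSeries c (i, false) (j, false) =
      PowerSeries.rescale (c.κ ^ (-t.m i j)) (gSer c (t.b i j) c.p)⁻¹ := by
  rw [gSer_inv_eq]
  refine rescale_qRatio_mul hq2k _ _ _ fun n hn => ?_
  have h1 := one_sub_sq_ne_zero hq2k hn
  have h3 := one_sub_pow_ne_zero hp1 hn
  have hn' : (n : ℂ) ≠ 0 := Nat.cast_ne_zero.mpr hn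
  rw [p_pow_eq, mul_comm] at h3
  rw [exchangeCoef, p_pow_eq, mul_pow, mul_pow, qpow_two_pow, c.qpow_neg, inv_pow, ← sub_mul]
  generalize c.qpow (t.b i j) ^ n - _ = y
  generalize c.qpow c.k ^ n = x at *
  generalize c.pst ^ n = S at *
  field_simp
  ring

/-- For currents of opposite sign the elliptic factors drop out of the exchange exponent, so it
cancels exactly against the quotient of infinite products. -/
theorem rescale_qRatio_mul_exchangeSeries_mixed (hq2k : ‖c.qpow (2 * c.k)‖ < 1) (i j : t.Idx)
    (e : Bool) :
    PowerSeries.rescale (c.κ ^ (-t.m i j))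
        (qRatio (c.qpow (2 * c.k)) (c.qpow (t.b i j) * c.qpow c.k)
          (c.qpow (-(t.b i j)) * c.qpow c.k)) *
      exchangeSeries c (i, e) (j, !e) = 1 := by
  rw [exchangeSeries, rescale_qRatio_mul hq2k _ _ _ (g := fun _ => 0) fun n hn => ?_,
    expSeries_zero, map_one]
  have h1 := one_sub_sq_ne_zero hq2k hn
  have hn' : (n : ℂ) ≠ 0 := Nat.cast_ne_zero.mpr hn
  rw [mul_pow, mul_pow, qpow_two_pow, c.qpow_neg, inv_pow, ← sub_mul, ← neg_sub]
  cases e <;> simp only [exchangeCoef, Bool.not_true, Bool.not_false] <;> ring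

theorem rescale_log (μ y : ℂ) : 1 - PowerSeries.C (y * μ) * PowerSeries.X =
    PowerSeries.rescale μ (expSeries fun n => -(y ^ n / n)) := by
  have h : PowerSeries.rescale μ (PowerSeries.C y) = PowerSeries.C y := by
    ext n
    rw [PowerSeries.coeff_rescale, PowerSeries.coeff_C]
    split_ifs with hn <;> simp [hn]
  rw [expSeries_log, map_sub, map_one, map_mul (PowerSeries.rescale μ), h, PowerSeries.rescale_X,
    map_mul PowerSeries.C, mul_assoc]

/-- The quotient differs from the Serre factor of `𝒵^+` by the first factor `1 - q^b X` of its
denominator; this linear term accounts for the prefactor `z - q^b w` of the current relation. -/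
theorem exchange_plus (hps : ‖c.pst‖ < 1) (hq2k : ‖c.qpow (2 * c.k)‖ < 1) (i j : t.Idx) :
    PowerSeries.rescale (c.κ ^ (-t.m i j)) (qRatio (c.qpow (2 * c.k)) (c.qpow (-(t.b i j)))
        (c.qpow (2 * c.k) * c.qpow (t.b i j))) * exchangeSeries c (i, true) (j, true) =
      (1 - PowerSeries.C (c.qpow (t.b i j) * c.κ ^ (-t.m i j)) * PowerSeries.X) *
        PowerSeries.rescale (c.κ ^ (-t.m i j)) (gSer c (t.b i j) c.pst) := by
  rw [gSer_eq, rescale_log, ← map_mul,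
    ← expSeries_add (fun _ _ _ _ => Commute.all _ _) (fun _ _ _ _ => Commute.all _ _)
      (fun _ _ _ _ => Commute.all _ _)]
  refine rescale_qRatio_mul hq2k _ _ _ fun n hn => ?_
  have h1 := one_sub_sq_ne_zero hq2k hn
  have h3 := one_sub_pow_ne_zero hps hn
  have hn' : (n : ℂ) ≠ 0 := Nat.cast_ne_zero.mpr hn
  rw [exchangeCoef, p_pow_eq, mul_pow, qpow_two_pow, c.qpow_neg, inv_pow]
  generalize (c.qpow (t.b i j) ^ n)⁻¹ = z
  generalize c.qpow (t.b i j) ^ n = y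
  generalize c.qpow c.k ^ n = x at *
  generalize c.pst ^ n = S at *
  field_simp
  ring

/-- The same quotient as for `𝒵^+` is now the Serre factor of `𝒵^-` times `1 - q^{-b} X`, the first
factor of its numerator. Hence one exchange relation serves both signs. -/
theorem exchange_minus (hp1 : ‖c.p‖ < 1) (hq2k : ‖c.qpow (2 * c.k)‖ < 1) (i j : t.Idx) :
    PowerSeries.rescale (c.κ ^ (-t.m i j)) (qRatio (c.qpow (2 * c.k)) (c.qpow (-(t.b i j)))
        (c.qpow (2 * c.k) * c.qpow (t.b i j))) * exchangeSeries c (i, false) (j, false) =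
      (1 - PowerSeries.C (c.qpow (-(t.b i j)) * c.κ ^ (-t.m i j)) * PowerSeries.X) *
        PowerSeries.rescale (c.κ ^ (-t.m i j)) (gSer c (t.b i j) c.p)⁻¹ := by
  rw [gSer_inv_eq, rescale_log, ← map_mul,
    ← expSeries_add (fun _ _ _ _ => Commute.all _ _) (fun _ _ _ _ => Commute.all _ _)
      (fun _ _ _ _ => Commute.all _ _)]
  refine rescale_qRatio_mul hq2k _ _ _ fun n hn => ?_
  have h1 := one_sub_sq_ne_zero hq2k hn
  have h3 := one_sub_pow_ne_zero hp1 hn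
  have hn' : (n : ℂ) ≠ 0 := Nat.cast_ne_zero.mpr hn
  rw [p_pow_eq, mul_comm] at h3
  rw [exchangeCoef, p_pow_eq, mul_pow, qpow_two_pow, c.qpow_neg, inv_pow]
  generalize (c.qpow (t.b i j) ^ n)⁻¹ = z
  generalize c.qpow (t.b i j) ^ n = y
  generalize c.qpow c.k ^ n = x at *
  generalize c.pst ^ n = S at *
  field_simp
  ring

end Series

end Scalars

end GenOps

end EllTor

end

/-! ### From a representation to Heisenberg data -/

noncomputable section

namespace EllTor

namespace GenOps

variable {t : SimpleType} {V : Type*} [AddCommGroup V] [Module ℂ V] (c : Params) (R : GenOps t V)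

/-- The operators of degree `n` with respect to `q^d`. -/
def degree (n : ℤ) : Submodule ℂ (Module.End ℂ V) where
  carrier := {T | (R.qd : Module.End ℂ V) * T = c.qpow n • (T * (R.qd : Module.End ℂ V))}
  add_mem' {T T'} hT hT' := by
    simp only [Set.mem_ofPred_eq] at *
    rw [mul_add, add_mul, hT, hT', smul_add]
  zero_mem' := by simp
  smul_mem' r T hT := by
    simp only [Set.mem_ofPred_eq] at *
    rw [mul_smul_comm, hT, smul_mul_assoc, smul_comm]

theorem mem_degree {T : Module.End ℂ V} {n : ℤ} : T ∈ R.degree c n ↔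
    (R.qd : Module.End ℂ V) * T = c.qpow n • (T * (R.qd : Module.End ℂ V)) := Iff.rfl

theorem mul_eq_smul_mul {A : Type*} [Ring A] [Algebra ℂ A] (u : Aˣ) {T : A} {r : ℂ}
    (h : (u : A) * T * (u⁻¹ : Aˣ) = r • T) : (u : A) * T = r • (T * u) := by
  rw [← smul_mul_assoc, ← h, Units.inv_mul_cancel_right]

theorem mul_mul_inv_eq_smul {A : Type*} [Ring A] [Algebra ℂ A] (u : Aˣ) {T : A} {r : ℂ}
    (h : (u : A) * T = r • (T * u)) : (u : A) * T * (u⁻¹ : Aˣ) = r • T := by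
  rw [h, smul_mul_assoc, Units.mul_inv_cancel_right]

variable {c R}

/-- A vector is a finite sum of eigenvectors of `q^d`, and an operator of degree `n` maps `V_ω` into
`V_{ω+n}`, which is zero for large `n`. -/
theorem IsInC.isTruncGrading (hC : R.IsInC c) : IsTruncGrading (R.degree c) where
  one_mem := by
    rw [mem_degree]
    simp [Params.qpow]
  mul_mem {m n T T'} hT hT' := by
    rw [mem_degree] at *
    rw [← mul_assoc, hT, smul_mul_assoc, mul_assoc, hT', mul_smul_comm, smul_smul, mul_assoc,
      Int.cast_add, c.qpow_add]
  locSum_mem {ι F n} hF := by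
    rw [mem_degree]
    by_cases h : LocFin F
    · ext v
      simp only [Module.End.mul_apply, LinearMap.smul_apply]
      rw [locSum_apply h, locSum_apply h, smul_finsum' _ (h _)]
      exact ((R.qd : Module.End ℂ V).toAddMonoidHom.map_finsum (h v)).trans
        (finsum_congr fun i => LinearMap.congr_fun ((R.mem_degree c).mp (hF i)) v)
    · rw [locSum, dif_neg h]
      simp
  trunc v := by
    have hv : v ∈ ⨆ ω : ℂ, Module.End.eigenspace (R.qd : Module.End ℂ V) (c.qpow ω) := by
      rw [hC.graded]; trivial
    induction hv using Submodule.iSup_induction' with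
    | mem ω v hv =>
      obtain ⟨N, hN⟩ := hC.truncated ω
      refine ⟨N, fun n hn T hT => ?_⟩
      obtain ⟨n, rfl⟩ := Int.eq_ofNat_of_zero_le (by omega : 0 ≤ n)
      have h := hN n (by omega)
      rw [← Submodule.mem_bot ℂ, ← h, Module.End.mem_eigenspace_iff]
      rw [Module.End.mem_eigenspace_iff] at hv
      have := LinearMap.congr_fun ((R.mem_degree c).mp hT) v
      rw [Module.End.mul_apply, LinearMap.smul_apply, Module.End.mul_apply, hv, map_smul,
        smul_smul] at this
      rw [this, c.qpow_add, mul_comm]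
      rfl
    | zero => exact ⟨0, fun _ _ T _ => map_zero T⟩
    | add v w _ _ hv hw =>
      obtain ⟨M, hM⟩ := hv
      obtain ⟨N, hN⟩ := hw
      exact ⟨max M N, fun n hn T hT => by
        rw [map_add, hM n (by omega) T hT, hN n (by omega) T hT, add_zero]⟩

variable (c R)

/-- The Heisenberg data of a representation, with currents `x^+_i(z)`, indexed by `(i, true)`, and
`x^-_i(z)`, indexed by `(i, false)`. -/
def heisData : HeisData V t.Idx (t.Idx × Bool) where
  A := R.αv
  x s := bif s.2 then R.xp s.1 else R.xm s.1
  ι := Prod.fst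
  em s n := dressCoef c s (-n)
  ep s n := dressCoef c s n
  β := heisCoef c
  γ := currentCoef c

/-- The dressed currents of a representation are the `Z`-operators. -/
abbrev dressing : Dressing V (t.Idx × Bool) := (R.heisData c).dressing

variable {c}

/-- Since `(q - q⁻¹)[d_i] = q_i - q_i⁻¹`, the passage from `α` to `α^∨` only changes the base in the
numerator. -/
theorem eCoef_mul_qInt (hq : ∀ n : ℤ, n ≠ 0 → c.qpow n ≠ 1) (i : t.Idx) (n : ℕ) :
    eCoef c n * qInt c.q (t.d i) =
      (qi t c i - (qi t c i)⁻¹) / (c.qpow c.k ^ n - (c.qpow c.k ^ n)⁻¹) := by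
  have h := q_sub_inv_ne_zero c hq
  rw [eCoef, qInt_q, c.qpow_neg, c.qpow_mul_natCast]
  generalize c.q - c.q⁻¹ = w at h
  field_simp

theorem dressing_Em_true (hq : ∀ n : ℤ, n ≠ 0 → c.qpow n ≠ 1) (i : t.Idx) :
    (R.dressing c).Em (i, true) = R.Em c i := by
  refine expSeries_congr fun n _ => ?_
  rw [al, smul_smul, neg_mul, eCoef_mul_qInt hq]
  simp only [heisData, dressCoef, cond_true, zpow_neg, zpow_natCast, inv_inv, mul_one]
  rw [← neg_sub (c.qpow c.k ^ n), div_neg]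

theorem dressing_Ep_true (hq : ∀ n : ℤ, n ≠ 0 → c.qpow n ≠ 1) (i : t.Idx) :
    (R.dressing c).Ep (i, true) = R.Ep c i := by
  refine expSeries_congr fun n _ => ?_
  rw [al, smul_smul, eCoef_mul_qInt hq]
  simp only [heisData, dressCoef, cond_true, zpow_natCast, mul_one]

theorem dressing_Em_false (hq : ∀ n : ℤ, n ≠ 0 → c.qpow n ≠ 1) (i : t.Idx) :
    (R.dressing c).Em (i, false) = R.EmPrime c i := by
  refine expSeries_congr fun n _ => ?_
  rw [alPrime, al, smul_smul, smul_smul, mul_right_comm, eCoef_mul_qInt hq, c.qpow_mul_intCast]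
  simp only [heisData, dressCoef, cond_false, zpow_neg, zpow_natCast, inv_inv]
  rw [← neg_sub (c.qpow c.k ^ n), div_neg, neg_mul_neg]

theorem dressing_Ep_false (hq : ∀ n : ℤ, n ≠ 0 → c.qpow n ≠ 1) (i : t.Idx) :
    (R.dressing c).Ep (i, false) = R.EpPrime c i := by
  refine expSeries_congr fun n _ => ?_
  rw [alPrime, al, smul_smul, smul_smul, mul_right_comm, neg_mul, eCoef_mul_qInt hq,
    c.qpow_mul_intCast]
  simp only [heisData, dressCoef, cond_false, zpow_natCast]
  rw [mul_neg, neg_mul]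

theorem dressing_term_true (hq : ∀ n : ℤ, n ≠ 0 → c.qpow n ≠ 1) (i : t.Idx) :
    (R.dressing c).term (i, true) = R.ZpTerm c i := by
  funext n y
  rw [Dressing.term, ZpTerm, R.dressing_Em_true hq, R.dressing_Ep_true hq]
  rfl

theorem dressing_term_false (hq : ∀ n : ℤ, n ≠ 0 → c.qpow n ≠ 1) (i : t.Idx) :
    (R.dressing c).term (i, false) = R.ZmTerm c i := by
  funext n y
  rw [Dressing.term, ZmTerm, R.dressing_Em_false hq, R.dressing_Ep_false hq]
  rfl

theorem dressing_Z_true (hq : ∀ n : ℤ, n ≠ 0 → c.qpow n ≠ 1) (i : t.Idx) :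
    (R.dressing c).Z (i, true) = R.Zp c i := by
  funext n
  rw [Dressing.Z, R.dressing_term_true hq, Zp]

theorem dressing_Z_false (hq : ∀ n : ℤ, n ≠ 0 → c.qpow n ≠ 1) (i : t.Idx) :
    (R.dressing c).Z (i, false) = R.Zm c i := by
  funext n
  rw [Dressing.Z, R.dressing_term_false hq, Zm]

section Rep

variable {R} {hS pS : Type*} [NormedAddCommGroup hS] [NormedSpace ℂ hS]
  [NormedAddCommGroup pS] [NormedSpace ℂ pS] {ρ : Realization t hS pS} [Module (Mero (hS × pS)) V]

theorem κ_pow_eq (c : Params) (n m : ℤ) : c.κ ^ (-(n * m)) = (c.κ ^ (-m)) ^ n := by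
  rw [← zpow_mul, neg_mul, mul_comm]

theorem qpow_intCast_mul (c : Params) (n : ℤ) (x : ℂ) : c.qpow (n * x) = c.qpow x ^ n := by
  rw [mul_comm, c.qpow_mul_intCast]

theorem IsRep.isHeis (hR : R.IsRep c ρ) (hC : R.IsInC c) (hq : ∀ n : ℤ, n ≠ 0 → c.qpow n ≠ 1)
    (hp : c.p ≠ 0) (hp1 : ‖c.p‖ < 1) (hps : ‖c.pst‖ < 1) (hq2k : ‖c.qpow (2 * c.k)‖ < 1) :
    (R.heisData c).IsHeis (R.degree c) where
  grading := hC.isTruncGrading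
  A_mem i n hn := mul_eq_smul_mul _ (hR.qd_α i n hn)
  x_mem := by
    rintro ⟨i, e⟩ n
    cases e
    · exact mul_eq_smul_mul _ (hR.qd_xm i n)
    · exact mul_eq_smul_mul _ (hR.qd_xp i n)
  A_A i j n m hn hm := by
    refine (hR.α_α i j n m hn hm).trans ?_
    rw [qInt_qi, κ_pow_eq, c.qpow_neg, qpow_intCast_mul]
    rfl
  A_x := by
    rintro i ⟨j, e⟩ n m hn
    cases e
    · refine (hR.α_xm i j n m hn).trans ?_
      rw [qInt_qi, κ_pow_eq, ← mul_neg_one]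
      rfl
    · refine (hR.α_xp i j n m hn).trans ?_
      rw [qInt_qi, κ_pow_eq, c.qpow_neg, qpow_intCast_mul]
      simp only [heisData, currentCoef, cond_true]
      congr 1
      ring
  em_β i s n hn := dressCoef_mul_heisCoef hq hp hp1 hps hq2k i s (Int.natCast_ne_zero.mpr hn)
  ep_β i s n hn := by
    have := dressCoef_mul_heisCoef hq hp hp1 hps hq2k i s
      (neg_ne_zero.mpr (Int.natCast_ne_zero.mpr hn))
    rwa [neg_neg] at this

theorem IsRep.exchange (hR : R.IsRep c ρ) (hC : R.IsInC c)
    (hq : ∀ n : ℤ, n ≠ 0 → c.qpow n ≠ 1) (hp : c.p ≠ 0) (hp1 : ‖c.p‖ < 1) (hps : ‖c.pst‖ < 1)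
    (hq2k : ‖c.qpow (2 * c.k)‖ < 1) : (R.dressing c).Exchange (exchangeSeries c) := by
  have h := (hR.isHeis hC hq hp hp1 hps hq2k).exchange
  have h2 : (fun s u : t.Idx × Bool => expSeries fun n => -((R.heisData c).em u n *
      (R.heisData c).γ ((R.heisData c).ι u) s (-n))) = exchangeSeries c := by
    funext s u
    exact expSeries_congr fun n hn => exchangeCoef_eq hq hp hp1 hps hq2k s.1 u.1 s.2 u.2 hn
  rwa [h2] at h

/-- Operators that commute with the `α^∨_{i,n}` commute with the vertex operators. -/
theorem commute_dressing {A : Module.End ℂ V} (hA : ∀ i n, n ≠ 0 → Commute A (R.αv i n))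
    (s : t.Idx × Bool) (a : ℕ) : Commute A (PowerSeries.coeff a ((R.dressing c).Em s)) ∧
      Commute A (PowerSeries.coeff a ((R.dressing c).Ep s)) :=
  ⟨commute_coeff_expSeries (fun n hn => (hA _ _ (by omega)).smul_right _) a,
    commute_coeff_expSeries (fun n hn => (hA _ _ (by omega)).smul_right _) a⟩

theorem commute_prod_units {A : Type*} [Ring A] {n : ℕ} (K : Fin n → Aˣ) (a : Fin n → ℕ) {T : A}
    (h : ∀ i, Commute (K i : A) T) : Commute (((List.ofFn fun i => K i ^ a i).prod : Aˣ) : A) T := by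
  rw [← Units.coeHom_apply, map_list_prod]
  refine (Commute.list_prod_right _ _ fun y hy => ?_).symm
  rw [List.mem_map] at hy
  obtain ⟨u, hu, rfl⟩ := hy
  obtain ⟨i, rfl⟩ := List.mem_ofFn.mp hu
  rw [map_pow]
  exact ((h i).pow_left _).symm

end Rep

end GenOps

end EllTor

end

noncomputable section

namespace EllTor

/-! ### The relations between the `Z`-operators -/

section Heis

variable {V : Type*} [AddCommGroup V] [Module ℂ V]

theorem evZero_expSeries {H : ℤ → Submodule ℂ (Module.End ℂ V)} (hH : IsTruncGrading H)
    {A : ℤ → Module.End ℂ V} (hA : ∀ n, n ≠ 0 → A n ∈ H n) (f : ℕ → ℂ) :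
    EvZero (expSeries fun n : ℕ => f n • A n) :=
  (coeff_expSeries_homog hH fun n hn => by
    rw [mul_one]
    exact Submodule.smul_mem _ _ (hA _ (by omega))).evZero hH

/-- Dressing `δ(rw/z) K e^{∑ f_n α^∨_{i,-n} w^n} e^{∑ g_n α^∨_{i,n} w^{-n}}`, with exponents
cancelling those of the vertex operators, gives `δ(rw/z) K`. -/
theorem HeisData.IsHeis.dressTwo_deltaW_expSeries {I S : Type*} {D : HeisData V I S}
    {H : ℤ → Submodule ℂ (Module.End ℂ V)} (hD : D.IsHeis H) {s u : S} {i : I} (hs : D.ι s = i)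
    (hu : D.ι u = i) {r : ℂ} (hr : r ≠ 0) {K : Module.End ℂ V}
    (hK : ∀ n, n ≠ 0 → Commute K (D.A i n)) {f g : ℕ → ℂ}
    (hf : ∀ n, n ≠ 0 → r ^ n * D.em s n + D.em u n + f n = 0)
    (hg : ∀ n, n ≠ 0 → g n + D.ep u n + r⁻¹ ^ n * D.ep s n = 0) {φ' : ℤ → Module.End ℂ V}
    (hφ : ∀ n, φ' n = locSum fun y : ℕ × ℕ => if (y.2 : ℤ) - y.1 = n then
      K * PowerSeries.coeff y.1 (expSeries fun n : ℕ => f n • D.A i (-(n : ℤ))) *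
        PowerSeries.coeff y.2 (expSeries fun n : ℕ => g n • D.A i n) else 0) :
    Adm {tot [(0 : Fin 2), 1]} (deltaW r φ') ∧
      D.dressing.dressTwo s u (deltaW r φ') = deltaW r (constCurrent K) := by
  have hQ : EvZero (expSeries fun n : ℕ => g n • D.A i n) :=
    evZero_expSeries hD.grading (hD.A_mem i) g
  have h1 : φ' = conv (expSeries fun n : ℕ => f n • D.A i (-(n : ℤ))) 1
      (rconv (expSeries fun n : ℕ => g n • D.A i n) (-1) (constCurrent K)) := by
    funext n
    rw [hφ, locSum_eq_conv_rconv
      (commute_coeff_expSeries fun n hn => (hK _ (by omega)).smul_right _) hQ]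
  subst hs
  refine ⟨adm_deltaW ?_ r, ?_⟩
  · rw [h1]
    exact ((adm_constCurrent K).rconv hQ).conv posDir_id
  · rw [h1]
    refine hD.compat.dressTwo_deltaW hr K hQ ?_ ?_
    · simp only [HeisData.dressing, hu, scaleSeries_expSeries, smul_smul]
      exact expSeries_mul_mul (B := fun n : ℕ => D.A (D.ι s) (-(n : ℤ)))
        (fun m n hm hn => hD.A_comm _ _ (by omega) (by omega) (by omega)) hf
    · simp only [HeisData.dressing, hu, scaleSeries_expSeries, smul_smul]
      exact expSeries_mul_mul (B := fun n : ℕ => D.A (D.ι s) n)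
        (fun m n hm hn => hD.A_comm _ _ (by omega) (by omega) (by omega)) hg

end Heis

namespace GenOps

variable {t : SimpleType} {V : Type*} [AddCommGroup V] [Module ℂ V] {c : Params} {R : GenOps t V}

section Delta

/-- The exponents of the dressed `φ^±_i` cancel. -/
theorem dressCoef_cancel (hp : c.p ≠ 0) (hp1 : ‖c.p‖ < 1) (hps : ‖c.pst‖ < 1)
    (hq2k : ‖c.qpow (2 * c.k)‖ < 1) (i : t.Idx) {n : ℕ} (hn : n ≠ 0) :
    (c.qpow c.k ^ n * dressCoef c (i, true) (-n) + dressCoef c (i, false) (-n) +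
        -((qi t c i - (qi t c i)⁻¹) * (c.p ^ n / (1 - c.p ^ n))) = 0 ∧
      (qi t c i - (qi t c i)⁻¹) * (1 / (1 - c.p ^ n)) + dressCoef c (i, false) n +
        (c.qpow c.k)⁻¹ ^ n * dressCoef c (i, true) n = 0) ∧
    ((c.qpow c.k)⁻¹ ^ n * dressCoef c (i, true) (-n) + dressCoef c (i, false) (-n) +
        -((qi t c i - (qi t c i)⁻¹) * (1 / (1 - c.p ^ n))) = 0 ∧
      (qi t c i - (qi t c i)⁻¹) * (c.p ^ n / (1 - c.p ^ n)) + dressCoef c (i, false) n +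
        c.qpow c.k ^ n * dressCoef c (i, true) n = 0) := by
  have hpst : c.pst ≠ 0 := fun h => hp (by rw [c.p_eq, h, zero_mul])
  have h1 := one_sub_sq_ne_zero hq2k hn
  have h2 := one_sub_pow_ne_zero hp1 hn
  have h3 := one_sub_pow_ne_zero hps hn
  have hx := pow_ne_zero n (c.qpow_ne_zero c.k)
  have hS := pow_ne_zero n hpst
  rw [p_pow_eq] at h2
  simp only [dressCoef, cond_true, cond_false, zpow_neg, zpow_natCast, inv_inv, inv_pow, p_pow_eq]
  generalize c.qpow c.k ^ n = x at *
  generalize c.pst ^ n = S at *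
  generalize qi t c i - (qi t c i)⁻¹ = w at *
  -- Again only `x = q^{kn}`, `S = p^{*n}` and the common factor `w = q_i - q_i⁻¹` are involved; all
  -- denominators are brought to the form `1 - x^2`, `1 - S`, `1 - S x^2`.
  have e1 : w / (x⁻¹ - x) = w * (x / (1 - x ^ 2)) := by
    rw [show x⁻¹ - x = (1 - x ^ 2) / x by field_simp]; field_simp
  have e1' : w / (x - x⁻¹) = -(w * (x / (1 - x ^ 2))) := by rw [← neg_sub, div_neg, e1]
  have e4 : 1 - (S * x ^ 2)⁻¹ = (1 - S * x ^ 2) / -(S * x ^ 2) := by field_simp; ring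
  have e5 : 1 - S⁻¹ = (1 - S) / -S := by field_simp; ring
  have e7 : (1 - S⁻¹) / (1 - (S * x ^ 2)⁻¹) = (1 - S) / (1 - S * x ^ 2) * x ^ 2 := by
    rw [e4, e5]; field_simp
  rw [e1, e1', e7]
  have h2' : 1 - x ^ 2 * S ≠ 0 := by rwa [mul_comm]
  refine ⟨⟨?_, ?_⟩, ?_, ?_⟩ <;> field_simp <;> ring

variable {hS pS : Type*} [NormedAddCommGroup hS] [NormedSpace ℂ hS]
  [NormedAddCommGroup pS] [NormedSpace ℂ pS] {ρ : Realization t hS pS} [Module (Mero (hS × pS)) V]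

/-- The two delta terms are supported on `z = q^k w` and `z = q^{-k} w`. On each of them the
exponentials of `φ^±` cancel those of the dressing, by `dressCoef_cancel`. -/
theorem IsRep.dressTwo_commutator (hR : R.IsRep c ρ) (hC : R.IsInC c)
    (hq : ∀ n : ℤ, n ≠ 0 → c.qpow n ≠ 1) (hp : c.p ≠ 0) (hp1 : ‖c.p‖ < 1) (hps : ‖c.pst‖ < 1)
    (hq2k : ‖c.qpow (2 * c.k)‖ < 1) (i : t.Idx) :
    (R.dressing c).dressTwo (i, true) (i, false) ((qi t c i - (qi t c i)⁻¹)⁻¹ •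
        (deltaW (c.qpow c.k) (R.phiP c i) -
          deltaZ (c.qpow (-c.k)) (scaleCurrent (c.qpow c.k) (R.phiM c i)))) =
      (qi t c i - (qi t c i)⁻¹)⁻¹ •
        (deltaW (c.qpow c.k) (constCurrent (R.Kp i : Module.End ℂ V)) -
          deltaW (c.qpow (-c.k)) (constCurrent (R.Km i : Module.End ℂ V))) := by
  have hH := hR.isHeis hC hq hp hp1 hps hq2k
  have hQ := c.qpow_ne_zero c.k
  have hcan := fun n (hn : n ≠ 0) => dressCoef_cancel hp hp1 hps hq2k i hn
  obtain ⟨h1, h1'⟩ := hH.dressTwo_deltaW_expSeries (s := (i, true)) (u := (i, false))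
    (i := i) rfl rfl hQ (K := R.Kp i) (fun n hn => (hR.K_α i i n hn).1)
    (fun n hn => (hcan n hn).1.1) (fun n hn => (hcan n hn).1.2) (φ' := R.phiP c i) fun _ => rfl
  obtain ⟨h2, h2'⟩ := hH.dressTwo_deltaW_expSeries (s := (i, true)) (u := (i, false))
    (i := i) rfl rfl (inv_ne_zero hQ) (K := R.Km i) (fun n hn => (hR.K_α i i n hn).2)
    (fun n hn => (hcan n hn).2.1)
    (fun n hn => by rw [inv_inv]; exact (hcan n hn).2.2) (φ' := R.phiM c i) fun _ => rfl
  have h3 := Adm.add h1 (Adm.smul h2 (-1))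
  rw [neg_one_smul, ← sub_eq_add_neg] at h3
  rw [c.qpow_neg, deltaZ_scaleCurrent hQ, hH.compat.dressTwo_smul h3,
    hH.compat.dressTwo_sub h1 h2, h1', h2']

end Delta

/-! ### The relations of the theorem -/

section Relations

variable {hS pS : Type*} [NormedAddCommGroup hS] [NormedSpace ℂ hS]
  [NormedAddCommGroup pS] [NormedSpace ℂ pS] {ρ : Realization t hS pS} [Module (Mero (hS × pS)) V]

theorem IsRep.exchange_Zp (hR : R.IsRep c ρ) (hC : R.IsInC c)
    (hq : ∀ n : ℤ, n ≠ 0 → c.qpow n ≠ 1) (hκ : c.κ ≠ 0) (hp : c.p ≠ 0) (hp1 : ‖c.p‖ < 1)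
    (hps : ‖c.pst‖ < 1) (hq2k : ‖c.qpow (2 * c.k)‖ < 1) (i j : t.Idx) :
    mulVar 0 (mulRatio (PowerSeries.rescale (c.κ ^ (-t.m i j)) (qRatio (c.qpow (2 * c.k))
        (c.qpow (-(t.b i j))) (c.qpow (2 * c.k) * c.qpow (t.b i j)))) 1 0
          (prodCurrents [((0 : Fin 2), R.Zp c i), (1, R.Zp c j)])) =
      (-(c.κ ^ (-t.m i j))) • mulVar 1 (mulRatio (PowerSeries.rescale (c.κ ^ t.m i j)
        (qRatio (c.qpow (2 * c.k)) (c.qpow (-(t.b i j))) (c.qpow (2 * c.k) * c.qpow (t.b i j))))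
          0 1 (prodCurrents [((1 : Fin 2), R.Zp c j), (0, R.Zp c i)])) := by
  have hH := hR.isHeis hC hq hp hp1 hps hq2k
  -- The product in reversed order needs the exchange factor of the pair `(j, i)`; antisymmetry of
  -- `m` and symmetry of `b` restate it in terms of `(i, j)`.
  have h' := exchange_plus (c := c) hps hq2k j i
  rw [t.m_comm i j, neg_neg, t.b_comm i j] at h'
  have := hH.compat.exchange_relation (hR.exchange hC hq hp hp1 hps hq2k) hH.commute_Ep_Z
    (s := (i, true)) (u := (j, true))
    (μ := c.κ ^ t.m i j) (ν := c.κ ^ (-t.m i j)) (by rw [← zpow_add₀ hκ, add_neg_cancel, zpow_zero])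
    (exchange_plus hps hq2k i j) h' (hR.xp_xp i j)
  rwa [R.dressing_Z_true hq, R.dressing_Z_true hq] at this

theorem IsRep.exchange_Zm (hR : R.IsRep c ρ) (hC : R.IsInC c)
    (hq : ∀ n : ℤ, n ≠ 0 → c.qpow n ≠ 1) (hκ : c.κ ≠ 0) (hp : c.p ≠ 0) (hp1 : ‖c.p‖ < 1)
    (hps : ‖c.pst‖ < 1) (hq2k : ‖c.qpow (2 * c.k)‖ < 1) (i j : t.Idx) :
    mulVar 0 (mulRatio (PowerSeries.rescale (c.κ ^ (-t.m i j)) (qRatio (c.qpow (2 * c.k))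
        (c.qpow (-(t.b i j))) (c.qpow (2 * c.k) * c.qpow (t.b i j)))) 1 0
          (prodCurrents [((0 : Fin 2), R.Zm c i), (1, R.Zm c j)])) =
      (-(c.κ ^ (-t.m i j))) • mulVar 1 (mulRatio (PowerSeries.rescale (c.κ ^ t.m i j)
        (qRatio (c.qpow (2 * c.k)) (c.qpow (-(t.b i j))) (c.qpow (2 * c.k) * c.qpow (t.b i j))))
          0 1 (prodCurrents [((1 : Fin 2), R.Zm c j), (0, R.Zm c i)])) := by
  have hH := hR.isHeis hC hq hp hp1 hps hq2k
  have h' := exchange_minus (c := c) hp1 hq2k j i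
  rw [t.m_comm i j, neg_neg, t.b_comm i j] at h'
  have := hH.compat.exchange_relation (hR.exchange hC hq hp hp1 hps hq2k) hH.commute_Ep_Z
    (s := (i, false)) (u := (j, false))
    (μ := c.κ ^ t.m i j) (ν := c.κ ^ (-t.m i j)) (by rw [← zpow_add₀ hκ, add_neg_cancel, zpow_zero])
    (exchange_minus hp1 hq2k i j) h' (hR.xm_xm i j)
  rwa [R.dressing_Z_false hq, R.dressing_Z_false hq] at this

theorem IsRep.commutator_Zp_Zm (hR : R.IsRep c ρ) (hC : R.IsInC c)
    (hq : ∀ n : ℤ, n ≠ 0 → c.qpow n ≠ 1) (hp : c.p ≠ 0) (hp1 : ‖c.p‖ < 1)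
    (hps : ‖c.pst‖ < 1) (hq2k : ‖c.qpow (2 * c.k)‖ < 1) (i j : t.Idx) :
    mulRatio (PowerSeries.rescale (c.κ ^ (-t.m i j)) (qRatio (c.qpow (2 * c.k))
        (c.qpow (t.b i j) * c.qpow c.k) (c.qpow (-(t.b i j)) * c.qpow c.k))) 1 0
          (prodCurrents [((0 : Fin 2), R.Zp c i), (1, R.Zm c j)]) -
        mulRatio (PowerSeries.rescale (c.κ ^ t.m i j) (qRatio (c.qpow (2 * c.k))
          (c.qpow (t.b i j) * c.qpow c.k) (c.qpow (-(t.b i j)) * c.qpow c.k))) 0 1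
          (prodCurrents [((1 : Fin 2), R.Zm c j), (0, R.Zp c i)]) =
      if i = j then (qi t c i - (qi t c i)⁻¹)⁻¹ •
        (deltaW (c.qpow c.k) (constCurrent (R.Kp i : Module.End ℂ V)) -
          deltaW (c.qpow (-c.k)) (constCurrent (R.Km i : Module.End ℂ V)))
      else 0 := by
  have hH := hR.isHeis hC hq hp hp1 hps hq2k
  have h := rescale_qRatio_mul_exchangeSeries_mixed (c := c) hq2k i j true
  have h' := rescale_qRatio_mul_exchangeSeries_mixed (c := c) hq2k j i false
  rw [t.m_comm i j, neg_neg, t.b_comm i j] at h'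
  have := hH.compat.commutator_relation (hR.exchange hC hq hp hp1 hps hq2k) hH.commute_Ep_Z
    (s := (i, true)) (u := (j, false)) h h'
  rw [R.dressing_Z_true hq, R.dressing_Z_false hq] at this
  rw [this]
  -- No scalar factor is left, so the bare commutator can be substituted inside the dressing.
  refine (congrArg _ (hR.xp_xm i j)).trans ?_
  split_ifs with hij
  · subst hij
    exact hR.dressTwo_commutator hC hq hp hp1 hps hq2k i
  · exact Dressing.dressAll_zero _

theorem IsRep.serre_Zp (hR : R.IsRep c ρ) (hC : R.IsInC c)
    (hq : ∀ n : ℤ, n ≠ 0 → c.qpow n ≠ 1) (hp : c.p ≠ 0) (hp1 : ‖c.p‖ < 1)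
    (hps : ‖c.pst‖ < 1) (hq2k : ‖c.qpow (2 * c.k)‖ < 1) {i j : t.Idx} (hij : i ≠ j) :
    SerreRel (1 - t.a i j).toNat (qi t c i) (c.κ ^ t.m i j)
      (qRatio (c.qpow (2 * c.k)) (c.qpow (-(t.b i i))) (c.qpow (t.b i i)))
      (qRatio (c.qpow (2 * c.k)) (c.qpow (-(t.b i j))) (c.qpow (t.b i j)))
      (R.Zp c i) (R.Zp c j) := by
  have hH := hR.isHeis hC hq hp hp1 hps hq2k
  have h0 := rescale_qRatio_mul_exchangeSeries_plus (c := c) hps hq2k i i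
  have h := rescale_qRatio_mul_exchangeSeries_plus (c := c) hps hq2k i j
  have h' := rescale_qRatio_mul_exchangeSeries_plus (c := c) hps hq2k j i
  rw [t.m_comm i j, neg_neg, t.b_comm i j] at h'
  -- Between two currents of the same index `κ` disappears, as `m_{ii} = 0`; the factors `F` of the
  -- Serre relation accordingly carry no rescaling.
  rw [t.m_self, neg_zero, zpow_zero, PowerSeries.rescale_one] at h0
  rw [zpow_neg] at h
  have := hH.compat.serreRel (hR.exchange hC hq hp hp1 hps hq2k) hH.commute_Ep_Z
    (s := (i, true)) (u := (j, true)) h0 h h' (hR.serre_p i j hij)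
  rwa [R.dressing_Z_true hq, R.dressing_Z_true hq] at this

theorem IsRep.serre_Zm (hR : R.IsRep c ρ) (hC : R.IsInC c)
    (hq : ∀ n : ℤ, n ≠ 0 → c.qpow n ≠ 1) (hp : c.p ≠ 0) (hp1 : ‖c.p‖ < 1)
    (hps : ‖c.pst‖ < 1) (hq2k : ‖c.qpow (2 * c.k)‖ < 1) {i j : t.Idx} (hij : i ≠ j) :
    SerreRel (1 - t.a i j).toNat (qi t c i) (c.κ ^ t.m i j)
      (qRatio (c.qpow (2 * c.k)) (c.qpow (-(t.b i i)) * c.qpow (2 * c.k))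
        (c.qpow (t.b i i) * c.qpow (2 * c.k)))
      (qRatio (c.qpow (2 * c.k)) (c.qpow (-(t.b i j)) * c.qpow (2 * c.k))
        (c.qpow (t.b i j) * c.qpow (2 * c.k)))
      (R.Zm c i) (R.Zm c j) := by
  have hH := hR.isHeis hC hq hp hp1 hps hq2k
  have h0 := rescale_qRatio_mul_exchangeSeries_minus (c := c) hp1 hq2k i i
  have h := rescale_qRatio_mul_exchangeSeries_minus (c := c) hp1 hq2k i j
  have h' := rescale_qRatio_mul_exchangeSeries_minus (c := c) hp1 hq2k j i
  rw [t.m_comm i j, neg_neg, t.b_comm i j] at h'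
  rw [t.m_self, neg_zero, zpow_zero, PowerSeries.rescale_one] at h0
  rw [zpow_neg] at h
  have := hH.compat.serreRel (hR.exchange hC hq hp hp1 hps hq2k) hH.commute_Ep_Z
    (s := (i, false)) (u := (j, false)) h0 h h' (hR.serre_m i j hij)
  rwa [R.dressing_Z_false hq, R.dressing_Z_false hq] at this

/-- An operator that commutes with the `α^∨_{i,n}` and intertwines a current of the representation
intertwines the `Z`-operator. -/
theorem IsRep.mul_Z (hR : R.IsRep c ρ) (hC : R.IsInC c)
    (hq : ∀ n : ℤ, n ≠ 0 → c.qpow n ≠ 1) (hp : c.p ≠ 0) (hp1 : ‖c.p‖ < 1)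
    (hps : ‖c.pst‖ < 1) (hq2k : ‖c.qpow (2 * c.k)‖ < 1) {A B : Module.End ℂ V}
    (hA : ∀ i n, n ≠ 0 → Commute A (R.αv i n)) (hB : ∀ i n, n ≠ 0 → Commute B (R.αv i n)) (r : ℂ)
    (j : t.Idx) :
    ((∀ n, A * R.xp j n = r • (R.xp j n * B)) → ∀ n, A * R.Zp c j n = r • (R.Zp c j n * B)) ∧
      ((∀ n, A * R.xm j n = r • (R.xm j n * B)) → ∀ n, A * R.Zm c j n = r • (R.Zm c j n * B)) := by
  have hT := (hR.isHeis hC hq hp hp1 hps hq2k).compat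
  rw [← R.dressing_Z_true hq, ← R.dressing_Z_false hq]
  exact ⟨fun h => hT.mul_Z r (fun a => (commute_dressing hA _ a).1)
      (fun a => (commute_dressing hB _ a).2) h,
    fun h => hT.mul_Z r (fun a => (commute_dressing hA _ a).1)
      (fun a => (commute_dressing hB _ a).2) h⟩

/-- Multiplication by a meromorphic function is a `ℂ`-linear operator that commutes with the `α^∨`.
It turns into its translate on passing the current, which is the case `A ≠ B` of `IsRep.mul_Z`. -/
theorem IsRep.smul_Z [IsScalarTower ℂ (Mero (hS × pS)) V] (hR : R.IsRep c ρ) (hC : R.IsInC c)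
    (hq : ∀ n : ℤ, n ≠ 0 → c.qpow n ≠ 1) (hp : c.p ≠ 0) (hp1 : ‖c.p‖ < 1)
    (hps : ‖c.pst‖ < 1) (hq2k : ‖c.qpow (2 * c.k)‖ < 1) (g g' : Mero (hS × pS)) (i : t.Idx) :
    ((∀ n v, g • R.xp i n v = R.xp i n (g' • v)) →
        ∀ n v, g • R.Zp c i n v = R.Zp c i n (g' • v)) ∧
      ((∀ n v, g • R.xm i n v = R.xm i n (g' • v)) →
        ∀ n v, g • R.Zm c i n v = R.Zm c i n (g' • v)) := by
  obtain ⟨L, hL⟩ : ∃ L : Mero (hS × pS) → Module.End ℂ V, ∀ g v, L g v = g • v :=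
    ⟨fun g => Algebra.lsmul ℂ ℂ V g, fun _ _ => rfl⟩
  have hg : ∀ g i n, n ≠ 0 → Commute (L g) (R.αv i n) := fun g i n hn => LinearMap.ext fun v => by
    rw [Module.End.mul_apply, Module.End.mul_apply, hL, hL, hR.g_α g i n v hn]
  have hx : ∀ A : Module.End ℂ V, L g * A = (1 : ℂ) • (A * L g') ↔
      ∀ v, g • A v = A (g' • v) := fun A => by
    simp only [one_smul, LinearMap.ext_iff, Module.End.mul_apply, hL]
  have h := hR.mul_Z hC hq hp hp1 hps hq2k (hg g) (hg g') 1 i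
  simp only [hx] at h
  exact h

end Relations

end GenOps

end EllTor

end

/-! ### Assembly of the theorem -/

theorem mainTheorem4 (t : EllTor.SimpleType)
    {hS pS : Type*} [NormedAddCommGroup hS] [NormedSpace ℂ hS] [FiniteDimensional ℂ hS]
    [NormedAddCommGroup pS] [NormedSpace ℂ pS] [FiniteDimensional ℂ pS]
    (ρ : EllTor.Realization t hS pS) (c : EllTor.Params)
    (hq : ∀ n : ℤ, n ≠ 0 → c.qpow n ≠ 1) (hκ : c.κ ≠ 0) (hp : c.p ≠ 0) (hk : c.k ≠ 0)
    (hp1 : ‖c.p‖ < 1) (hps : ‖c.pst‖ < 1) (hq2k : ‖c.qpow (2 * c.k)‖ < 1)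
    {V : Type*} [AddCommGroup V] [Module ℂ V] [Module (EllTor.Mero (hS × pS)) V]
    [IsScalarTower ℂ (EllTor.Mero (hS × pS)) V]
    (R : EllTor.GenOps t V) (hR : R.IsRep c ρ) (hC : R.IsInC c) :
    -- the `Z`-operators are well defined
    (∀ i n, EllTor.LocFin (R.ZpTerm c i n) ∧ EllTor.LocFin (R.ZmTerm c i n)) ∧
    -- they commute with the Heisenberg generators
    (∀ i j (n s : ℤ), n ≠ 0 →
      Commute (R.al c i n) (R.Zp c j s) ∧ Commute (R.al c i n) (R.Zm c j s)) ∧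
    -- they commute with the products of the `K_i`
    (∀ j s,
      (Commute (R.KpProd : Module.End ℂ V) (R.Zp c j s) ∧
        Commute (R.KpProd : Module.End ℂ V) (R.Zm c j s)) ∧
      (Commute (R.KmProd : Module.End ℂ V) (R.Zp c j s) ∧
        Commute (R.KmProd : Module.End ℂ V) (R.Zm c j s))) ∧
    -- the dynamical relations
    (∀ (g : EllTor.Mero (hS × pS)) i s v,
      g • R.Zp c i s v = R.Zp c i s (EllTor.shift (ρ.α i, -ρ.Q i) g • v) ∧
      g • R.Zm c i s v = R.Zm c i s (EllTor.shift (-ρ.α i, 0) g • v)) ∧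
    (∀ (g : EllTor.Mero (hS × pS)) i v,
      g • (R.Kp i : Module.End ℂ V) v =
        (R.Kp i : Module.End ℂ V) (EllTor.shift (0, -ρ.Q i) g • v) ∧
      g • (R.Km i : Module.End ℂ V) v =
        (R.Km i : Module.End ℂ V) (EllTor.shift (0, -ρ.Q i) g • v)) ∧
    -- the relations with `K_i^±`
    (∀ i j s,
      (R.Kp i : Module.End ℂ V) * R.Zp c j s * ((R.Kp i)⁻¹ : (Module.End ℂ V)ˣ) =
        c.qpow (t.a i j) • R.Zp c j s ∧
      (R.Km i : Module.End ℂ V) * R.Zp c j s * ((R.Km i)⁻¹ : (Module.End ℂ V)ˣ) =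
        c.qpow (-(t.a i j)) • R.Zp c j s ∧
      (R.Kp i : Module.End ℂ V) * R.Zm c j s * ((R.Kp i)⁻¹ : (Module.End ℂ V)ˣ) =
        c.qpow (-(t.a i j)) • R.Zm c j s ∧
      (R.Km i : Module.End ℂ V) * R.Zm c j s * ((R.Km i)⁻¹ : (Module.End ℂ V)ˣ) =
        c.qpow (t.a i j) • R.Zm c j s) ∧
    -- the exchange relations, for `Z = Z^+` and `Z = Z^-` (`z` is variable 0, `w` is variable 1)
    (∀ Z, (Z = R.Zp c ∨ Z = R.Zm c) → ∀ i j,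
      let F := EllTor.qRatio (c.qpow (2 * c.k)) (c.qpow (-(t.b i j)))
        (c.qpow (2 * c.k) * c.qpow (t.b i j))
      EllTor.mulVar 0 (EllTor.mulRatio (PowerSeries.rescale (c.κ ^ (-t.m i j)) F) 1 0
          (EllTor.prodCurrents [((0 : Fin 2), Z i), (1, Z j)])) =
        (-(c.κ ^ (-t.m i j))) •
          EllTor.mulVar 1 (EllTor.mulRatio (PowerSeries.rescale (c.κ ^ t.m i j) F) 0 1
            (EllTor.prodCurrents [((1 : Fin 2), Z j), (0, Z i)]))) ∧
    -- the relation between `Z^+` and `Z^-`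
    (∀ i j,
      let M := EllTor.qRatio (c.qpow (2 * c.k)) (c.qpow (t.b i j) * c.qpow c.k)
        (c.qpow (-(t.b i j)) * c.qpow c.k)
      EllTor.mulRatio (PowerSeries.rescale (c.κ ^ (-t.m i j)) M) 1 0
          (EllTor.prodCurrents [((0 : Fin 2), R.Zp c i), (1, R.Zm c j)]) -
        EllTor.mulRatio (PowerSeries.rescale (c.κ ^ t.m i j) M) 0 1
          (EllTor.prodCurrents [((1 : Fin 2), R.Zm c j), (0, R.Zp c i)]) =
      if i = j then (EllTor.GenOps.qi t c i - (EllTor.GenOps.qi t c i)⁻¹)⁻¹ •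
        (EllTor.deltaW (c.qpow c.k) (EllTor.constCurrent (R.Kp i : Module.End ℂ V)) -
          EllTor.deltaW (c.qpow (-c.k)) (EllTor.constCurrent (R.Km i : Module.End ℂ V)))
      else 0) ∧
    -- the Serre relations
    (∀ i j, i ≠ j →
      EllTor.SerreRel (1 - t.a i j).toNat (EllTor.GenOps.qi t c i) (c.κ ^ t.m i j)
        (EllTor.qRatio (c.qpow (2 * c.k)) (c.qpow (-(t.b i i))) (c.qpow (t.b i i)))
        (EllTor.qRatio (c.qpow (2 * c.k)) (c.qpow (-(t.b i j))) (c.qpow (t.b i j)))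
        (R.Zp c i) (R.Zp c j) ∧
      EllTor.SerreRel (1 - t.a i j).toNat (EllTor.GenOps.qi t c i) (c.κ ^ t.m i j)
        (EllTor.qRatio (c.qpow (2 * c.k)) (c.qpow (-(t.b i i)) * c.qpow (2 * c.k))
          (c.qpow (t.b i i) * c.qpow (2 * c.k)))
        (EllTor.qRatio (c.qpow (2 * c.k)) (c.qpow (-(t.b i j)) * c.qpow (2 * c.k))
          (c.qpow (t.b i j) * c.qpow (2 * c.k)))
        (R.Zm c i) (R.Zm c j)) := by

  have hH := hR.isHeis hC hq hp hp1 hps hq2k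
  have hKp : ∀ i j n, n ≠ 0 → Commute (R.Kp i : Module.End ℂ V) (R.αv j n) :=
    fun i j n hn => (hR.K_α i j n hn).1
  have hKm : ∀ i j n, n ≠ 0 → Commute (R.Km i : Module.End ℂ V) (R.αv j n) :=
    fun i j n hn => (hR.K_α i j n hn).2
  have hmul {A B : Module.End ℂ V} (hA : ∀ i n, n ≠ 0 → Commute A (R.αv i n))
      (hB : ∀ i n, n ≠ 0 → Commute B (R.αv i n)) :=
    hR.mul_Z hC hq hp hp1 hps hq2k hA hB
  -- Commuting is intertwining with `A = B` and scalar `1`; this covers the products of the `K_i^±`.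
  have hcomm : ∀ K : Module.End ℂ V, (∀ i n, n ≠ 0 → Commute K (R.αv i n)) →
      (∀ j n, Commute K (R.xp j n) ∧ Commute K (R.xm j n)) →
      ∀ j s, Commute K (R.Zp c j s) ∧ Commute K (R.Zm c j s) := by
    intro K hK hx j s
    refine ⟨?_, ?_⟩
    · exact ((hmul hK hK 1 j).1 (fun n => ((hx j n).1.eq.trans (one_smul _ _).symm)) s).trans
        (one_smul _ _)
    · exact ((hmul hK hK 1 j).2 (fun n => ((hx j n).2.eq.trans (one_smul _ _).symm)) s).trans
        (one_smul _ _)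
  refine ⟨fun i n => ⟨?_, ?_⟩, fun i j n s hn => ⟨?_, ?_⟩, fun j s => ⟨?_, ?_⟩,
    fun g i s v => ⟨?_, ?_⟩, fun g i v => ⟨hR.g_Kp g i v, hR.g_Km g i v⟩,
    fun i j s => ⟨?_, ?_, ?_, ?_⟩, ?_, hR.commutator_Zp_Zm hC hq hp hp1 hps hq2k,
    fun i j hij => ⟨hR.serre_Zp hC hq hp hp1 hps hq2k hij,
      hR.serre_Zm hC hq hp hp1 hps hq2k hij⟩⟩
  · rw [← R.dressing_term_true hq]
    exact hH.compat.locFin_term _ n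
  · rw [← R.dressing_term_false hq]
    exact hH.compat.locFin_term _ n
  · rw [← R.dressing_Z_true hq]
    exact (hH.commute_A_Z i _ hn s).smul_left _
  · rw [← R.dressing_Z_false hq]
    exact (hH.commute_A_Z i _ hn s).smul_left _
  · exact hcomm _ (fun i n hn => EllTor.GenOps.commute_prod_units _ _ fun j => hKp j i n hn)
      hR.Kp_central_x j s
  · exact hcomm _ (fun i n hn => EllTor.GenOps.commute_prod_units _ _ fun j => hKm j i n hn)
      hR.Km_central_x j s
  · exact (hR.smul_Z hC hq hp hp1 hps hq2k g _ i).1 (fun n v => hR.g_xp g i n v) s v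
  · exact (hR.smul_Z hC hq hp hp1 hps hq2k g _ i).2 (fun n v => hR.g_xm g i n v) s v
  · exact EllTor.GenOps.mul_mul_inv_eq_smul _ ((hmul (hKp i) (hKp i) _ j).1
      (fun n => EllTor.GenOps.mul_eq_smul_mul _ (hR.Kp_xp i j n)) s)
  · exact EllTor.GenOps.mul_mul_inv_eq_smul _ ((hmul (hKm i) (hKm i) _ j).1
      (fun n => EllTor.GenOps.mul_eq_smul_mul _ (hR.Km_xp i j n)) s)
  · exact EllTor.GenOps.mul_mul_inv_eq_smul _ ((hmul (hKp i) (hKp i) _ j).2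
      (fun n => EllTor.GenOps.mul_eq_smul_mul _ (hR.Kp_xm i j n)) s)
  · exact EllTor.GenOps.mul_mul_inv_eq_smul _ ((hmul (hKm i) (hKm i) _ j).2
      (fun n => EllTor.GenOps.mul_eq_smul_mul _ (hR.Km_xm i j n)) s)
  · rintro Z (rfl | rfl) i j
    · exact hR.exchange_Zp hC hq hκ hp hp1 hps hq2k i j
    · exact hR.exchange_Zm hC hq hκ hp hp1 hps hq2k i j
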